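/- Let $\mathcal H=L^2(\mathbb R)$ with Fourier--Plancherel operator $\mathcal F$, $\widehat\psi(p)=(\mathcal F\psi)(p)=(2\pi)^{-1/2}\int e^{-ipx}\psi(x)\,dx$. An observable on a measurable space $(\Omega,\mathcal A)$ is a map $E:\mathcal A\to\mathcal L(\mathcal H)$ which is weakly $\sigma$-additive, positive operator valued and satisfies $E(\Omega)=I$; a state is a positive operator of trace one; for an observable $E$ and a state $S$, $p^E_S$ is the probability measure $p^E_S(X)=\mathrm{tr}[S\,E(X)]$. For Borel probability measures $\rho,\nu$ on $\mathbb R$ let $E_\rho$ be the position observable and $F_\nu$ the momentum observable $$E_\rho(X)=\int\rho(X-q)\,d\Pi_Q(q),\qquad F_\nu(Y)=\int\nu(Y-p)\,d\Pi_P(p)\qquad(X,Y\in\mathcal B(\mathbb R)),$$ where $\Pi_Q(X)$ is multiplication by the characteristic function of $X$ and $\Pi_P(X)=\mathcal F^{-1}\Pi_Q(X)\mathcal F$; that is, $E_\rho(X)$ is multiplication by $q\mapsto\rho(X-q)$ and $F_\nu(Y)=\mathcal F^{-1}E_\nu(Y)\mathcal F$. Observables $E,F$ on $\mathbb R$ are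 functionally coexistent if there are a measurable space $\Omega$, an observable $G$ on $\Omega$ and measurable $f_1,f_2:\Omega\to\mathbb R$ with $E(X)=G(f_1^{-1}(X))$ and $F(Y)=G(f_2^{-1}(Y))$ for all Borel $X,Y$; they have a joint observable (are jointly measurable) if there is an observable $G$ on $\mathbb R^2$ with $E(X)=G(X\times\mathbb R)$ and $F(Y)=G(\mathbb R\times Y)$ for all Borel $X,Y$. **Corollary.** For all Borel probability measures $\rho,\nu$ on $\mathbb R$, the following are equivalent: (a) $E_\rho$ and $F_\nu$ are functionally coexistent; (b) $E_\rho$ and $F_\nu$ have a joint observable; (c) there is a state $T$ with spectral decomposition $T=\sum_i\lambda_i|\varphi_i\rangle\langle\varphi_i|$ ($\varphi_i$ orthonormal, $\lambda_i\ge0$, $\sum_i\lambda_i=1$) such that $$d\rho(q)=\Big(\sum_i\lambda_i|\varphi_i(-q)|^2\Big)dq,\qquad d\nu(p)=\Big(\sum_i\lambda_i|\widehat\varphi_i(-p)|^2\Big)dp.$$ In particular, if $E_\rho$ and $F_\nu$ are functionally coexistent, or have a joint observable, then for every state $S$ $$\mathrm{Var}(p^{E_\rho}_S)\,\mathrm{Var}(p^{F_\nu}_S)\ge1,$$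 where $\mathrm{Var}(p)=\int\big(x-\int x\,dp(x)\big)^2dp(x)\in[0,\infty]$, with $\mathrm{Var}(p)=\infty$ if $p$ has no finite second moment. -/

import Mathlib

universe u

open MeasureTheory ProbabilityTheory
open scoped ENNReal InnerProductSpace FourierTransform ComplexInnerProductSpace

/-! ### Observables, states and outcome distributions on a complex Hilbert space -/

section General

/-- An observable: a normalized positive operator measure, i.e. a set function on the measurable
sets with values in the positive bounded operators which is `σ`-additive in the weak operator
topology and maps the whole space to the identity.  Values on non-measurable sets are irrelevant. -/
structure Observable (Ω : Type*) [MeasurableSpace Ω] (H : Type*) [NormedAddCommGroup H]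
    [InnerProductSpace ℂ H] where
  toFun : Set Ω → H →L[ℂ] H
  positive : ∀ X, MeasurableSet X → (toFun X).IsPositive
  normalized : toFun Set.univ = ContinuousLinearMap.id ℂ H
  additive : ∀ X : ℕ → Set Ω, (∀ n, MeasurableSet (X n)) → Pairwise (Function.onFun Disjoint X) →
    ∀ φ ψ : H, HasSum (fun n => ⟪φ, toFun (X n) ψ⟫_ℂ) ⟪φ, toFun (⋃ n, X n) ψ⟫_ℂ

instance (Ω : Type*) [MeasurableSpace Ω] (H : Type*) [NormedAddCommGroup H]
    [InnerProductSpace ℂ H] : CoeFun (Observable Ω H) (fun _ => Set Ω → H →L[ℂ] H) :=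
  ⟨Observable.toFun⟩

variable {H : Type*} [NormedAddCommGroup H] [InnerProductSpace ℂ H]

/-- `HasTrace A t`: in every Hilbert basis the diagonal sum of `A` converges to `t`, that is,
`A` is of trace class and `tr A = t`. -/
def HasTrace (A : H →L[ℂ] H) (t : ℂ) : Prop :=
  ∀ (w : Set H) (b : HilbertBasis w ℂ H), HasSum (fun i => ⟪b i, A (b i)⟫_ℂ) t

/-- A state: a positive operator of trace one. -/
structure IsState (T : H →L[ℂ] H) : Prop where
  positive : T.IsPositive
  trace_one : HasTrace T 1

/-- `p` is the outcome distribution of the observable `E` in the state `S`: the probability measure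
`p` with `p X = tr (S E(X))` for all measurable `X` (these values determine `p`). -/
structure IsOutcomeDistribution {Ω : Type*} [MeasurableSpace Ω] (E : Observable Ω H)
    (S : H →L[ℂ] H) (p : Measure Ω) : Prop where
  probability : IsProbabilityMeasure p
  eq_trace : ∀ X, MeasurableSet X → HasTrace (S ∘L E X) ((p.real X : ℝ) : ℂ)

/-- A spectral decomposition `T = ∑ i, lam i • |φ i⟩⟨φ i|` of a state: the `φ i` are orthonormal,
the weights are nonnegative with sum one (weights `0` are allowed). -/
structure IsSpectralDecomposition (T : H →L[ℂ] H) (lam : ℕ → ℝ) (φ : ℕ → H) : Prop where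
  orthonormal : Orthonormal ℂ φ
  nonneg : ∀ i, 0 ≤ lam i
  sum_one : HasSum lam 1
  hasSum_apply : ∀ ψ : H, HasSum (fun i => ((lam i : ℂ) * ⟪φ i, ψ⟫_ℂ) • φ i) (T ψ)

/-- Functional coexistence: both observables are functions of one observable `G`. -/
def FunctionallyCoexistent {Ω₁ Ω₂ : Type*} [MeasurableSpace Ω₁] [MeasurableSpace Ω₂]
    (E₁ : Observable Ω₁ H) (E₂ : Observable Ω₂ H) : Prop :=
  ∃ (Ω : Type u) (_ : MeasurableSpace Ω) (G : Observable Ω H) (f₁ : Ω → Ω₁) (f₂ : Ω → Ω₂),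
    Measurable f₁ ∧ Measurable f₂ ∧
    (∀ X, MeasurableSet X → E₁ X = G (f₁ ⁻¹' X)) ∧
    (∀ Y, MeasurableSet Y → E₂ Y = G (f₂ ⁻¹' Y))

/-- Two observables on `ℝ` are the margins of an observable on `ℝ²`. -/
def HaveJointObservable (E₁ E₂ : Observable ℝ H) : Prop :=
  ∃ G : Observable (ℝ × ℝ) H,
    (∀ X, MeasurableSet X → E₁ X = G (X ×ˢ Set.univ)) ∧
    (∀ Y, MeasurableSet Y → E₂ Y = G (Set.univ ×ˢ Y))

/-- The uncertainty relation `Var(p_S^E) Var(p_S^F) ≥ 1` for every state `S`.  Variances take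
values in `[0, ∞]`. -/
def UncertaintyRelation (E F : Observable ℝ H) : Prop :=
  ∀ S : H →L[ℂ] H, IsState S → ∃ p r : Measure ℝ,
    IsOutcomeDistribution E S p ∧ IsOutcomeDistribution F S r ∧
    1 ≤ evariance id p * evariance id r

end General

/-! ### The Hilbert space `L²(ℝ)` -/

/-- The Hilbert space `L²(ℝ)`. -/
abbrev L2R : Type := Lp ℂ 2 (volume : Measure ℝ)

section Multiplication

open Classical in
/-- Multiplication by an essentially bounded function `g` on `L²(ℝ)`
(and `0` if `g` is not essentially bounded). -/
noncomputable def mulOp (g : ℝ → ℂ) : L2R →L[ℂ] L2R :=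
  if h : MemLp g ∞ volume then
    (ContinuousLinearMap.mul ℂ ℂ).holderL volume ∞ 2 2 (h.toLp g)
  else 0

lemma mulOp_coeFn {g : ℝ → ℂ} (h : MemLp g ∞ volume) (ψ : L2R) :
    mulOp g ψ =ᵐ[volume] fun x => g x * ψ x := by
  rw [mulOp, dif_pos h]
  filter_upwards [ContinuousLinearMap.coeFn_holder (r := 2) (ContinuousLinearMap.mul ℂ ℂ)
    (h.toLp g) ψ, h.coeFn_toLp] with x h1 h2
  simpa [h2] using h1

/-- The function `q ↦ ρ(X - q)`, where `X - q = {x - q | x ∈ X}`. -/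
noncomputable def smear (ρ : Measure ℝ) (X : Set ℝ) (q : ℝ) : ℝ :=
  ρ.real ((fun x => x - q) '' X)

lemma image_sub_eq_preimage (X : Set ℝ) (q : ℝ) :
    (fun x => x - q) '' X = (fun x => x + q) ⁻¹' X := by
  ext y
  constructor
  · rintro ⟨x, hx, rfl⟩
    simpa using hx
  · intro hy
    exact ⟨y + q, hy, by simp⟩

lemma smear_eq (ρ : Measure ℝ) (X : Set ℝ) (q : ℝ) :
    smear ρ X q = ρ.real ((fun x => x + q) ⁻¹' X) := by
  rw [smear, image_sub_eq_preimage]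

lemma smear_nonneg (ρ : Measure ℝ) (X : Set ℝ) (q : ℝ) : 0 ≤ smear ρ X q := measureReal_nonneg

variable (ρ : Measure ℝ) [IsProbabilityMeasure ρ]

lemma measurable_smear {X : Set ℝ} (hX : MeasurableSet X) : Measurable (smear ρ X) := by
  have h : MeasurableSet ((fun z : ℝ × ℝ => z.2 + z.1) ⁻¹' X) :=
    (measurable_snd.add measurable_fst) hX
  have := (measurable_measure_prodMk_left (ν := ρ) h).ennreal_toReal
  have he : smear ρ X
      = fun q => (ρ (Prod.mk q ⁻¹' ((fun z : ℝ × ℝ => z.2 + z.1) ⁻¹' X))).toReal :=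
    funext fun q => smear_eq ρ X q
  exact he ▸ this

lemma memLp_smear {X : Set ℝ} (hX : MeasurableSet X) :
    MemLp (fun q => (smear ρ X q : ℂ)) ∞ volume := by
  refine memLp_top_of_bound
    (Complex.measurable_ofReal.comp (measurable_smear ρ hX)).aestronglyMeasurable 1 ?_
  refine .of_forall fun q => ?_
  rw [Complex.norm_real, Real.norm_of_nonneg (smear_nonneg ρ X q)]
  exact measureReal_le_one

lemma hasSum_smear {X : ℕ → Set ℝ} (hX : ∀ n, MeasurableSet (X n))
    (hd : Pairwise (Function.onFun Disjoint X)) (q : ℝ) :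
    HasSum (fun n => smear ρ (X n) q) (smear ρ (⋃ n, X n) q) := by
  simp only [smear_eq, Set.preimage_iUnion]
  have hm : ∀ n, MeasurableSet ((fun x => x + q) ⁻¹' X n) :=
    fun n => (measurable_id.add_const q) (hX n)
  have hd' : Pairwise (Function.onFun Disjoint fun n => (fun x => x + q) ⁻¹' X n) :=
    fun i j hij => (hd hij).preimage _
  have h := measure_iUnion (μ := ρ) hd' hm
  have hfin : ∑' n, ρ ((fun x => x + q) ⁻¹' X n) ≠ ∞ := h ▸ measure_ne_top _ _
  simp only [Measure.real]
  rw [h, ENNReal.tsum_toReal_eq fun n => measure_ne_top _ _]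
  exact ENNReal.hasSum_toReal hfin

lemma inner_mulOp_smear {X : Set ℝ} (hX : MeasurableSet X) (φ ψ : L2R) :
    ⟪φ, mulOp (fun q => (smear ρ X q : ℂ)) ψ⟫_ℂ = ∫ q, (smear ρ X q : ℂ) * ⟪φ q, ψ q⟫_ℂ := by
  rw [L2.inner_def]
  refine integral_congr_ae ?_
  filter_upwards [mulOp_coeFn (memLp_smear ρ hX) ψ] with q hq
  rw [hq]
  simp only [RCLike.inner_apply]
  ring

/-- The position observable `E_ρ(X) = ∫ ρ(X - q) dΠ_Q(q)`, where `Π_Q(X)` is multiplication by the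
characteristic function of `X`: that is, `E_ρ(X)` is multiplication by `q ↦ ρ(X - q)`. -/
noncomputable def positionObservable : Observable ℝ L2R where
  toFun X := mulOp (fun q => (smear ρ X q : ℂ))
  positive X hX := by
    rw [ContinuousLinearMap.isPositive_iff_complex]
    intro ψ
    have hc := inner_mulOp_smear ρ hX ψ ψ
    have h2 : ∫ q, (smear ρ X q : ℂ) * ⟪ψ q, ψ q⟫_ℂ
        = ((∫ q, smear ρ X q * ‖ψ q‖ ^ 2 : ℝ) : ℂ) := by
      rw [← integral_complex_ofReal]
      refine integral_congr_ae (.of_forall fun q => ?_)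
      simp [inner_self_eq_norm_sq_to_K]
    have h3 : ⟪mulOp (fun q => (smear ρ X q : ℂ)) ψ, ψ⟫_ℂ
        = ((∫ q, smear ρ X q * ‖ψ q‖ ^ 2 : ℝ) : ℂ) := by
      rw [← inner_conj_symm, hc, h2, Complex.conj_ofReal]
    rw [h3]
    refine ⟨by simp, ?_⟩
    simp only [RCLike.re_to_complex, Complex.ofReal_re]
    exact integral_nonneg fun q => mul_nonneg (smear_nonneg ρ X q) (by positivity)
  normalized := by
    ext1 ψ
    refine Lp.ext ?_
    filter_upwards [mulOp_coeFn (memLp_smear ρ MeasurableSet.univ) ψ] with q hq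
    rw [hq]
    simp [smear_eq]
  additive X hX hd φ ψ := by
    have hi : Integrable (fun q => ⟪φ q, ψ q⟫_ℂ) := L2.integrable_inner φ ψ
    simp only [inner_mulOp_smear ρ (hX _), inner_mulOp_smear ρ (MeasurableSet.iUnion hX)]
    have hs := hasSum_smear ρ hX hd
    have hmeas : ∀ Y : Set ℝ, MeasurableSet Y →
        AEStronglyMeasurable (fun q => (smear ρ Y q : ℂ)) volume :=
      fun Y hY => (memLp_smear ρ hY).1
    refine hasSum_integral_of_dominated_convergence
      (fun n q => smear ρ (X n) q * ‖⟪φ q, ψ q⟫_ℂ‖) ?_ ?_ ?_ ?_ ?_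
    · exact fun n => (hmeas _ (hX n)).mul hi.1
    · refine fun n => .of_forall fun q => ?_
      rw [norm_mul, Complex.norm_real, Real.norm_of_nonneg (smear_nonneg ρ _ q)]
    · exact .of_forall fun q => ((hs q).mul_right _).summable
    · have : (fun q => ∑' n, smear ρ (X n) q * ‖⟪φ q, ψ q⟫_ℂ‖)
          = fun q => smear ρ (⋃ n, X n) q * ‖⟪φ q, ψ q⟫_ℂ‖ :=
        funext fun q => ((hs q).mul_right _).tsum_eq
      rw [this]
      refine hi.norm.bdd_mul (c := 1)
        (measurable_smear ρ (MeasurableSet.iUnion hX)).aestronglyMeasurable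
        (.of_forall fun q => ?_)
      rw [Real.norm_of_nonneg (smear_nonneg ρ _ q)]
      exact measureReal_le_one
    · refine .of_forall fun q => ?_
      have := (Complex.hasSum_ofReal.mpr (hs q)).mul_right ⟪φ q, ψ q⟫_ℂ
      exact this

end Multiplication

/-! ### The Fourier-Plancherel operator -/

section Fourier

lemma ae_comp_mul {c : ℝ} (hc : c ≠ 0) {P : ℝ → Prop} (h : ∀ᵐ x, P x) : ∀ᵐ x : ℝ, P (c * x) := by
  have hq : Measure.QuasiMeasurePreserving (fun x : ℝ => c * x) volume volume := by
    refine ⟨measurable_const_mul c, ?_⟩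
    rw [Real.map_volume_mul_left hc]
    exact Measure.smul_absolutelyContinuous
  exact hq.ae h

lemma eLpNorm_comp_mul {c : ℝ} (hc : 0 < c) {g : ℝ → ℂ} (hg : AEStronglyMeasurable g volume) :
    eLpNorm (fun x => ((√c : ℝ) : ℂ) * g (c * x)) 2 volume = eLpNorm g 2 volume := by
  have hmap : Measure.map (fun x : ℝ => c * x) volume = ENNReal.ofReal c⁻¹ • volume := by
    rw [Real.map_volume_mul_left hc.ne', abs_of_pos (inv_pos.mpr hc)]
  have h1 : eLpNorm (g ∘ fun x => c * x) 2 volume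
      = eLpNorm g 2 (ENNReal.ofReal c⁻¹ • volume) := by
    rw [← hmap]
    refine (eLpNorm_map_measure ?_ (measurable_const_mul c).aemeasurable).symm
    rw [hmap]
    exact hg.smul_measure _
  have h2 : (fun x => ((√c : ℝ) : ℂ) * g (c * x))
      = ((√c : ℝ) : ℂ) • (g ∘ fun x => c * x) := rfl
  rw [h2, eLpNorm_const_smul, h1,
    eLpNorm_smul_measure_of_ne_zero (by simpa using hc), smul_eq_mul, ← mul_assoc]
  have h3 : ‖((√c : ℝ) : ℂ)‖ₑ * ENNReal.ofReal c⁻¹ ^ (1 / (2 : ℝ≥0∞)).toReal = 1 := by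
    rw [← ofReal_norm, Complex.norm_real,
      Real.norm_of_nonneg (Real.sqrt_nonneg c), ENNReal.ofReal_rpow_of_pos (inv_pos.mpr hc),
      ← ENNReal.ofReal_mul (Real.sqrt_nonneg c)]
    have : (1 / (2 : ℝ≥0∞)).toReal = 1 / 2 := by simp
    rw [this, ← Real.sqrt_eq_rpow, ← Real.sqrt_mul hc.le, mul_inv_cancel₀ hc.ne']
    simp
  rw [h3, one_mul]

lemma memLp_comp_mul {c : ℝ} (hc : 0 < c) (g : L2R) :
    MemLp (fun x => ((√c : ℝ) : ℂ) * g (c * x)) 2 volume := by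
  refine ⟨?_, ?_⟩
  · refine aestronglyMeasurable_const.mul ?_
    exact ((Lp.stronglyMeasurable g).comp_measurable
      (measurable_const_mul c)).aestronglyMeasurable
  · rw [eLpNorm_comp_mul hc (Lp.memLp g).1]
    exact (Lp.memLp g).2

/-- The unitary dilation `(D_c g)(x) = √c · g(c x)` of `L²(ℝ)`, as an isometry. -/
noncomputable def dilationIsometry (c : ℝ) (hc : 0 < c) : L2R →ₗᵢ[ℂ] L2R where
  toFun g := (memLp_comp_mul hc g).toLp _
  map_add' f g := by
    rw [← MemLp.toLp_add]
    refine MemLp.toLp_congr _ _ ?_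
    filter_upwards [ae_comp_mul hc.ne' (Lp.coeFn_add f g)] with x hx
    simp only [Pi.add_apply] at hx ⊢
    rw [hx, mul_add]
  map_smul' a g := by
    simp only [RingHom.id_apply]
    rw [← MemLp.toLp_const_smul]
    refine MemLp.toLp_congr _ _ ?_
    filter_upwards [ae_comp_mul hc.ne' (Lp.coeFn_smul a g)] with x hx
    simp only [Pi.smul_apply, smul_eq_mul] at hx ⊢
    rw [hx]
    ring
  norm_map' g := by
    change ‖(memLp_comp_mul hc g).toLp _‖ = ‖g‖
    rw [Lp.norm_toLp, eLpNorm_comp_mul hc (Lp.memLp g).1, Lp.norm_def]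

lemma dilationIsometry_coeFn (c : ℝ) (hc : 0 < c) (g : L2R) :
    dilationIsometry c hc g =ᵐ[volume] fun x => ((√c : ℝ) : ℂ) * g (c * x) :=
  (memLp_comp_mul hc g).coeFn_toLp

lemma dilationIsometry_surjective (c : ℝ) (hc : 0 < c) :
    Function.Surjective (dilationIsometry c hc) := by
  intro g
  refine ⟨dilationIsometry c⁻¹ (inv_pos.mpr hc) g, Lp.ext ?_⟩
  filter_upwards [dilationIsometry_coeFn c hc (dilationIsometry c⁻¹ (inv_pos.mpr hc) g),
    ae_comp_mul hc.ne' (dilationIsometry_coeFn c⁻¹ (inv_pos.mpr hc) g)] with x h1 h2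
  rw [h1, h2, ← mul_assoc, ← Complex.ofReal_mul, ← Real.sqrt_mul hc.le,
    mul_inv_cancel₀ hc.ne', inv_mul_cancel_left₀ hc.ne']
  simp

/-- The unitary dilation `(D_c g)(x) = √c · g(c x)` of `L²(ℝ)`. -/
noncomputable def dilation (c : ℝ) (hc : 0 < c) : L2R ≃ₗᵢ[ℂ] L2R :=
  LinearIsometryEquiv.ofSurjective (dilationIsometry c hc) (dilationIsometry_surjective c hc)

/-- The Fourier-Plancherel operator in the normalization
`(F ψ)(p) = (2π)^(-1/2) ∫ e^(-ipx) ψ(x) dx`.  Mathlib's operator is the unitary extension of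
`ψ ↦ ∫ e^(-2πi x ·) ψ(x) dx`, so `F` is that operator followed by `g ↦ (2π)^(-1/2) g(· / 2π)`. -/
noncomputable def fourierPlancherel : L2R ≃ₗᵢ[ℂ] L2R :=
  (Lp.fourierTransformₗᵢ ℝ ℂ).trans (dilation (2 * Real.pi)⁻¹ (inv_pos.mpr Real.two_pi_pos))

end Fourier

/-- The observable `X ↦ W⁻¹ E(X) W` for a unitary `W`. -/
noncomputable def Observable.conj {Ω : Type*} [MeasurableSpace Ω] (E : Observable Ω L2R)
    (W : L2R ≃ₗᵢ[ℂ] L2R) : Observable Ω L2R where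
  toFun X := (W.symm.toContinuousLinearEquiv : L2R →L[ℂ] L2R) ∘L E X ∘L
    (W.toContinuousLinearEquiv : L2R →L[ℂ] L2R)
  positive X hX := by
    rw [ContinuousLinearMap.isPositive_iff_complex]
    intro ψ
    have h := (ContinuousLinearMap.isPositive_iff_complex _).mp (E.positive X hX) (W ψ)
    have h2 : ⟪W.symm (E X (W ψ)), ψ⟫_ℂ = ⟪E X (W ψ), W ψ⟫_ℂ := by
      rw [← W.inner_map_map, W.apply_symm_apply]
    simpa [h2] using h
  normalized := by
    ext1 ψ
    simp [E.normalized]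
  additive X hX hd φ ψ := by
    have h := E.additive X hX hd (W φ) (W ψ)
    have h2 : ∀ χ : L2R, ⟪φ, W.symm χ⟫_ℂ = ⟪W φ, χ⟫_ℂ := fun χ => by
      rw [← W.inner_map_map, W.apply_symm_apply]
    simpa [h2] using h

/-- The momentum observable `F_ν(Y) = ∫ ν(Y - p) dΠ_P(p)`, where `Π_P(Y) = F⁻¹ Π_Q(Y) F` with the
Fourier-Plancherel operator `F`; that is, `F_ν(Y) = F⁻¹ E_ν(Y) F`. -/
noncomputable def momentumObservable (ν : Measure ℝ) [IsProbabilityMeasure ν] :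
    Observable ℝ L2R :=
  (positionObservable ν).conj fourierPlancherel

/-- The measure `(∑ i, lam i |φ i (-x)|²) dx`. -/
noncomputable def reflectedDensity (lam : ℕ → ℝ) (φ : ℕ → L2R) : Measure ℝ :=
  volume.withDensity fun x => ∑' i, ENNReal.ofReal (lam i) * ‖φ i (-x)‖ₑ ^ 2

/-- There is a state `T = ∑ i, lam i • |φ i⟩⟨φ i|` such that `dρ(q) = (∑ i, lam i |φ i (-q)|²) dq`
and `dν(p) = (∑ i, lam i |(F φ i)(-p)|²) dp`. -/
def ArisesFromState (ρ ν : Measure ℝ) : Prop :=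
  ∃ T : L2R →L[ℂ] L2R, IsState T ∧ ∃ (lam : ℕ → ℝ) (φ : ℕ → L2R),
    IsSpectralDecomposition T lam φ ∧
    ρ = reflectedDensity lam φ ∧
    ν = reflectedDensity lam (fun i => fourierPlancherel (φ i))

/-! The equivalence of (a) and (b) is formal: a common observable is pushed forward along `(f₁,
f₂)`. The substance is the equivalence of (b) and (c). Write `W(q,p)` for the Weyl operator `M_p
T_q`.

From (b) to (c): a joint observable `G` need not be covariant, and the usual averaging over phase
space is replaced by a direct construction of the state. Cut the plane into cells `C_ab` of side `ε`
and take a Hilbert-Schmidt operator `K` of norm one whose kernel lives on `0 ≤ x - y ≤ ε` both in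
position and in momentum (`diagOp`, of the form `m(Q) n(P)` with `m`, `n` conjugated Fourier
integrals of a box). The operator `∑ W* K* G(C_ab) K W`, with `W = W(aε, bε)`, has trace one.
Covariance turns its position distribution into a sum over `a` that involves only the margin `E_ρ`,
and this is the reflection of `ρ` up to `2ε`; likewise for momentum and `ν` (`exists_approx`). As `ε
→ 0`, a weak limit exists along an ultrafilter. No mass escapes: the position and momentum tails are
uniformly small, and localization to bounded sets in both variables is Hilbert-Schmidt, so that
traces converge there (`exists_limit_operator`). The distributions of the limit state are dominated
on closed sets by the reflected `ρ` and `ν`, hence equal to them.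

From (c) to (b): `ψ ↦ (2π)^(-1/2) ⟨W(q,p) φ_j, ψ⟩` is an isometry into the square integrable
functions of `(j, q, p)` with weights `λ_j`. Compressing indicator functions along it gives an
observable, whose margins follow from Plancherel on the fibres
(`ArisesFromState.haveJointObservable`).

Uncertainty relation: the outcome distribution of `E_ρ` in `S` is the convolution of the position
distribution of `S` with `ρ`, so variances add. Heisenberg's inequality with constant `1/4` holds
for `S` and for the state behind `(ρ, ν)`, and `(A + a)(B + b) ≥ (√(AB) + √(ab))² ≥ 1`. -/

/-! ### The Fourier-Plancherel operator on integrable functions -/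

/-- The Fourier integral `p ↦ (2π)^(-1/2) ∫ e^(iσpx) g(x) dx`. -/
noncomputable def fourierInt (σ : ℝ) (g : ℝ → ℂ) (p : ℝ) : ℂ :=
  ((√(2 * Real.pi))⁻¹ : ℝ) * ∫ x, Complex.exp (((σ * p * x : ℝ) : ℂ) * Complex.I) * g x

/-- The unitary `U` is given by the Fourier integral on `L¹ ∩ L²`. -/
def IsPlancherel (σ : ℝ) (U : L2R ≃ₗᵢ[ℂ] L2R) : Prop :=
  ∀ (g : ℝ → ℂ) (_ : Integrable g) (h2 : MemLp g 2),
    U (h2.toLp g) =ᵐ[volume] fourierInt σ g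

lemma integrable_toSchwartz {φ : ℝ → ℝ} (h1 : ContDiff ℝ ((⊤ : ℕ∞) : WithTop ℕ∞) φ) (h2 : HasCompactSupport φ) :
    Integrable φ ∧ MemLp (fun x => (φ x : ℂ)) 2 := by
  have hc := h1.continuous
  refine ⟨hc.integrable_of_hasCompactSupport h2, ?_⟩
  have := (hc.memLp_of_hasCompactSupport (p := 2) (μ := (volume : Measure ℝ)) h2)
  exact this.ofReal

/-- Both sides agree against smooth compactly supported `Φ`: the left one through the Fourier
transform of tempered distributions, the right one through the multiplication formula `∫ 𝓕Φ · g = ∫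
Φ · 𝓕g`. -/
lemma lp_fourier_ae_eq {g : ℝ → ℂ} (h1 : Integrable g) (h2 : MemLp g 2) :
    Lp.fourierTransformₗᵢ ℝ ℂ (h2.toLp g) =ᵐ[volume] 𝓕 g := by
  have hloc : LocallyIntegrable (Lp.fourierTransformₗᵢ ℝ ℂ (h2.toLp g) : L2R) volume :=
    (Lp.memLp _).locallyIntegrable (by norm_num)
  have hcont : Continuous (𝓕 g) :=
    VectorFourier.fourierIntegral_continuous Real.continuous_fourierChar
      (innerSL ℝ).continuous₂ h1
  refine ae_eq_of_integral_contDiff_smul_eq hloc hcont.locallyIntegrable fun φ hφ hs => ?_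
  have hφ' : ContDiff ℝ ((⊤ : ℕ∞) : WithTop ℕ∞) (fun x => (φ x : ℂ)) := Complex.ofRealCLM.contDiff.comp hφ
  have hs' : HasCompactSupport (fun x => (φ x : ℂ)) := hs.comp_left (g := fun x : ℝ => (x : ℂ)) rfl
  set Φ := hs'.toSchwartzMap hφ' with hΦ
  have key := congrArg (fun T => T Φ) (Lp.fourier_toTemperedDistribution_eq (h2.toLp g))
  simp only [TemperedDistribution.fourier_apply, Lp.toTemperedDistribution_apply] at key
  have e1 : ∫ x, φ x • (Lp.fourierTransformₗᵢ ℝ ℂ (h2.toLp g) : L2R) x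
      = ∫ x, Φ x • (𝓕 (h2.toLp g) : L2R) x := by
    refine integral_congr_ae (.of_forall fun x => ?_)
    simp only [hΦ]
    rfl
  rw [e1, ← key]
  have e2 : ∫ x, (𝓕 Φ) x • (h2.toLp g) x = ∫ x, (𝓕 Φ) x • g x := by
    refine integral_congr_ae ?_
    filter_upwards [h2.coeFn_toLp] with x hx
    rw [hx]
  rw [e2]
  have e3 := VectorFourier.integral_fourierIntegral_smul_eq_flip (f := Φ) (g := g)
    (μ := volume) (ν := volume) (L := innerₗ ℝ) Real.continuous_fourierChar
    (innerSL ℝ).continuous₂ Φ.integrable h1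
  rw [flip_innerₗ] at e3
  refine Eq.trans ?_ (e3.trans ?_)
  · rfl
  · refine integral_congr_ae (.of_forall fun x => ?_)
    simp only [hΦ]
    rfl

theorem isPlancherel_fourierPlancherel : IsPlancherel (-1) fourierPlancherel := by
  intro g h1 h2
  have hpos : (0:ℝ) < (2 * Real.pi)⁻¹ := inv_pos.mpr Real.two_pi_pos
  have ha := dilationIsometry_coeFn _ hpos (Lp.fourierTransformₗᵢ ℝ ℂ (h2.toLp g))
  have hb := ae_comp_mul hpos.ne' (lp_fourier_ae_eq h1 h2)
  have hc : fourierPlancherel (h2.toLp g)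
      = dilationIsometry _ hpos (Lp.fourierTransformₗᵢ ℝ ℂ (h2.toLp g)) := rfl
  rw [hc]
  filter_upwards [ha, hb] with p h h'
  rw [h, h', fourierInt, Real.sqrt_inv, Real.fourier_real_eq_integral_exp_smul]
  congr 1
  refine integral_congr_ae (.of_forall fun x => ?_)
  simp only [smul_eq_mul]
  congr 2
  push_cast
  have : (Real.pi : ℂ) ≠ 0 := by exact_mod_cast Real.pi_ne_zero
  field_simp

lemma fourierInt_continuous (σ : ℝ) {g : ℝ → ℂ} (h1 : Integrable g) :
    Continuous (fourierInt σ g) := by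
  refine continuous_const.mul ?_
  refine continuous_of_dominated (bound := fun x => ‖g x‖) ?_ ?_ h1.norm ?_
  · intro p
    exact (Continuous.aestronglyMeasurable (by fun_prop)).mul h1.1
  · intro p
    refine .of_forall fun x => ?_
    rw [norm_mul, Complex.norm_exp_ofReal_mul_I, one_mul]
  · refine .of_forall fun x => ?_
    fun_prop

/-- Against a test function, unitarity moves `U⁻¹` to the other side as `U`, and Fubini carries the
conjugated kernel back onto `g`. With both signs available, each fact about `U` also holds for
`F⁻¹`; momentum statements thus follow from position statements. -/
theorem IsPlancherel.symm {σ : ℝ} {U : L2R ≃ₗᵢ[ℂ] L2R} (hU : IsPlancherel σ U) :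
    IsPlancherel (-σ) U.symm := by
  intro g h1 h2
  have hloc : LocallyIntegrable (U.symm (h2.toLp g) : L2R) volume :=
    (Lp.memLp _).locallyIntegrable (by norm_num)
  refine ae_eq_of_integral_contDiff_smul_eq hloc
    (fourierInt_continuous _ h1).locallyIntegrable fun φ hφ hs => ?_
  obtain ⟨hi, hm⟩ := integrable_toSchwartz hφ hs
  have e1 : ∫ x, φ x • (U.symm (h2.toLp g) : L2R) x = ⟪hm.toLp _, U.symm (h2.toLp g)⟫_ℂ := by
    rw [L2.inner_def]
    refine integral_congr_ae ?_
    filter_upwards [hm.coeFn_toLp] with x hx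
    rw [hx]
    simp [mul_comm]
  have e2 : ⟪hm.toLp _, U.symm (h2.toLp g)⟫_ℂ = ⟪U (hm.toLp _), h2.toLp g⟫_ℂ := by
    rw [← U.inner_map_map, U.apply_symm_apply]
  have e3 : ⟪U (hm.toLp _), h2.toLp g⟫_ℂ
      = ∫ p, g p * (starRingEnd ℂ) (fourierInt σ (fun x => (φ x : ℂ)) p) := by
    rw [L2.inner_def]
    refine integral_congr_ae ?_
    have hi' : Integrable (fun x => (φ x : ℂ)) := hi.ofReal
    filter_upwards [hU _ hi' hm, h2.coeFn_toLp] with x hx hx'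
    rw [hx, hx']
    simp
  rw [e1, e2, e3]
  have e4 : ∀ p, g p * (starRingEnd ℂ) (fourierInt σ (fun x => (φ x : ℂ)) p)
      = ∫ x, ((√(2 * Real.pi))⁻¹ : ℝ) *
        (Complex.exp (((-σ * x * p : ℝ) : ℂ) * Complex.I) * g p * φ x) := by
    intro p
    rw [fourierInt, map_mul, Complex.conj_ofReal, ← integral_conj, mul_left_comm,
      ← integral_const_mul, ← integral_const_mul]
    refine integral_congr_ae (.of_forall fun x => ?_)
    simp only [map_mul, Complex.conj_ofReal, ← Complex.exp_conj, Complex.conj_I]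
    have : Complex.exp (((σ * p * x : ℝ) : ℂ) * -Complex.I)
      = Complex.exp (((-σ * x * p : ℝ) : ℂ) * Complex.I) := by
      congr 1; push_cast; ring
    rw [this]; ring
  have e5 : ∀ x, φ x • fourierInt (-σ) g x = ∫ p, ((√(2 * Real.pi))⁻¹ : ℝ) *
        (Complex.exp (((-σ * x * p : ℝ) : ℂ) * Complex.I) * g p * φ x) := by
    intro x
    rw [fourierInt, Complex.real_smul, mul_left_comm, ← integral_const_mul, ← integral_const_mul]
    refine integral_congr_ae (.of_forall fun p => ?_)
    simp only []
    ring
  simp_rw [e4, e5]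
  refine integral_integral_swap ?_
  have hprod : Integrable (fun z : ℝ × ℝ => g z.1 * (φ z.2 : ℂ)) (volume.prod volume) :=
    h1.mul_prod hi.ofReal
  refine Integrable.const_mul ?_ _
  have := hprod.bdd_mul (c := 1)
    (f := fun z : ℝ × ℝ => Complex.exp (((-σ * z.2 * z.1 : ℝ) : ℂ) * Complex.I))
    (Continuous.aestronglyMeasurable (by fun_prop))
    (.of_forall fun z => (Complex.norm_exp_ofReal_mul_I _).le)
  refine this.congr (.of_forall fun z => ?_)
  simp only []
  ring

/-! ### Hilbert-Schmidt operators -/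

section HilbertSchmidt

set_option linter.unusedSectionVars false

variable {H H₁ H₂ : Type*} [NormedAddCommGroup H] [InnerProductSpace ℂ H] [CompleteSpace H]
  [NormedAddCommGroup H₁] [InnerProductSpace ℂ H₁] [CompleteSpace H₁]
  [NormedAddCommGroup H₂] [InnerProductSpace ℂ H₂] [CompleteSpace H₂]
  {ι κ : Type*}

/-- `∑ i, ‖A (b i)‖²` for a Hilbert basis `b`. -/
noncomputable def hsSum (b : HilbertBasis ι ℂ H) (A : H →L[ℂ] H₁) : ℝ≥0∞ :=
  ∑' i, ‖A (b i)‖ₑ ^ 2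

lemma enorm_sq_eq_ofReal {E : Type*} [NormedAddCommGroup E] (x : E) :
    ‖x‖ₑ ^ 2 = ENNReal.ofReal (‖x‖ ^ 2) := by
  rw [← ofReal_norm, ENNReal.ofReal_pow (norm_nonneg x)]

lemma HilbertBasis.hasSum_norm_inner_sq (b : HilbertBasis ι ℂ H) (x : H) :
    HasSum (fun i => ‖⟪b i, x⟫_ℂ‖ ^ 2) (‖x‖ ^ 2) := by
  have h := b.hasSum_inner_mul_inner x x
  have h2 : (fun i => ⟪x, b i⟫_ℂ * ⟪b i, x⟫_ℂ) = fun i => ((‖⟪b i, x⟫_ℂ‖ ^ 2 : ℝ) : ℂ) := by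
    funext i
    rw [← inner_conj_symm x (b i), mul_comm, Complex.mul_conj, Complex.normSq_eq_norm_sq]
  have h3 : ⟪x, x⟫_ℂ = ((‖x‖ ^ 2 : ℝ) : ℂ) := by
    rw [inner_self_eq_norm_sq_to_K]; simp
  rw [h2, h3] at h
  exact Complex.hasSum_ofReal.mp h

lemma HilbertBasis.tsum_enorm_inner_sq (b : HilbertBasis ι ℂ H) (x : H) :
    ∑' i, ‖⟪b i, x⟫_ℂ‖ₑ ^ 2 = ‖x‖ₑ ^ 2 := by
  simp_rw [enorm_sq_eq_ofReal]
  rw [← ENNReal.ofReal_tsum_of_nonneg (fun i => by positivity) (b.hasSum_norm_inner_sq x).summable,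
    (b.hasSum_norm_inner_sq x).tsum_eq]

lemma HilbertBasis.tsum_enorm_inner_sq' (b : HilbertBasis ι ℂ H) (x : H) :
    ∑' i, ‖⟪x, b i⟫_ℂ‖ₑ ^ 2 = ‖x‖ₑ ^ 2 := by
  rw [← b.tsum_enorm_inner_sq x]
  refine tsum_congr fun i => ?_
  rw [← inner_conj_symm, RCLike.enorm_conj]

/-- Parseval in both bases makes each side the double sum of `|⟨c k, A (b i)⟩|²`. Basis independence
follows, and so do bounds for composition on the right from those on the left. -/
lemma hsSum_eq_hsSum_adjoint (b : HilbertBasis ι ℂ H) (c : HilbertBasis κ ℂ H₁) (A : H →L[ℂ] H₁) :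
    hsSum b A = hsSum c (ContinuousLinearMap.adjoint A) := by
  simp only [hsSum]
  simp_rw [← c.tsum_enorm_inner_sq (A _),
    ← b.tsum_enorm_inner_sq' (ContinuousLinearMap.adjoint A _),
    ContinuousLinearMap.adjoint_inner_left]
  exact ENNReal.tsum_comm

lemma hsSum_eq (b : HilbertBasis ι ℂ H) (c : HilbertBasis κ ℂ H) (A : H →L[ℂ] H₁) :
    hsSum b A = hsSum c A := by
  obtain ⟨w, d, -⟩ := exists_hilbertBasis ℂ H₁
  rw [hsSum_eq_hsSum_adjoint b d, hsSum_eq_hsSum_adjoint c d]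

lemma hsSum_comp_le (b : HilbertBasis ι ℂ H) (A : H →L[ℂ] H₁) (D : H₁ →L[ℂ] H₂) :
    hsSum b (D ∘L A) ≤ ‖D‖ₑ ^ 2 * hsSum b A := by
  simp only [hsSum]
  rw [← ENNReal.tsum_mul_left]
  refine ENNReal.tsum_le_tsum fun i => ?_
  rw [← mul_pow]
  gcongr
  exact D.le_opENorm _

lemma hsSum_comp_le' (b : HilbertBasis ι ℂ H) (c : HilbertBasis κ ℂ H₁) (A : H₁ →L[ℂ] H₂)
    (D : H →L[ℂ] H₁) : hsSum b (A ∘L D) ≤ ‖D‖ₑ ^ 2 * hsSum c A := by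
  obtain ⟨w, d, -⟩ := exists_hilbertBasis ℂ H₂
  rw [hsSum_eq_hsSum_adjoint b d, hsSum_eq_hsSum_adjoint c d, ContinuousLinearMap.adjoint_comp]
  refine (hsSum_comp_le d _ _).trans_eq ?_
  congr 2
  rw [← ofReal_norm, ← ofReal_norm, LinearIsometryEquiv.norm_map]

lemma enorm_le_one_of_norm_le {E : Type*} [NormedAddCommGroup E] {D : E} (h : ‖D‖ ≤ 1) :
    ‖D‖ₑ ^ 2 ≤ 1 := by
  rw [enorm_sq_eq_ofReal, ENNReal.ofReal_le_one]
  exact pow_le_one₀ (norm_nonneg _) h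

lemma hsSum_comp_le_of_norm_le_one (b : HilbertBasis ι ℂ H) (A : H →L[ℂ] H₁) {D : H →L[ℂ] H}
    (hD : ‖D‖ ≤ 1) : hsSum b (A ∘L D) ≤ hsSum b A := by
  refine (hsSum_comp_le' b b A D).trans ?_
  exact mul_le_of_le_one_left zero_le (enorm_le_one_of_norm_le hD)

lemma hsSum_comp_of_inverse (b : HilbertBasis ι ℂ H) (A : H →L[ℂ] H₁) {V V' : H →L[ℂ] H}
    (hV : ‖V‖ ≤ 1) (hV' : ‖V'‖ ≤ 1) (h : V ∘L V' = ContinuousLinearMap.id ℂ H) :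
    hsSum b (A ∘L V) = hsSum b A := by
  refine le_antisymm (hsSum_comp_le_of_norm_le_one b A hV) ?_
  have := hsSum_comp_le_of_norm_le_one b (A ∘L V) hV'
  rwa [ContinuousLinearMap.comp_assoc, h, ContinuousLinearMap.comp_id] at this

/-- Young's inequality `2‖x‖‖y‖ ≤ t‖x‖² + t⁻¹‖y‖²`. The parameter stays free because the limit
argument sends `t → 0`, so that the leading term keeps constant one. -/
lemma enorm_add_sq_le {E : Type*} [NormedAddCommGroup E] (x y : E) {t : ℝ} (ht : 0 < t) :
    ‖x + y‖ₑ ^ 2 ≤ ENNReal.ofReal (1 + t) * ‖x‖ₑ ^ 2 + ENNReal.ofReal (1 + t⁻¹) * ‖y‖ₑ ^ 2 := by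
  simp_rw [enorm_sq_eq_ofReal]
  rw [← ENNReal.ofReal_mul (by positivity), ← ENNReal.ofReal_mul (by positivity),
    ← ENNReal.ofReal_add (by positivity) (by positivity)]
  refine ENNReal.ofReal_le_ofReal ?_
  have h1 : ‖x + y‖ ^ 2 ≤ (‖x‖ + ‖y‖) ^ 2 := by gcongr; exact norm_add_le x y
  have h2 : t * (‖x‖ - t⁻¹ * ‖y‖) ^ 2 = t * ‖x‖ ^ 2 - 2 * ‖x‖ * ‖y‖ + t⁻¹ * ‖y‖ ^ 2 := by
    field_simp
    ring
  have h3 : 0 ≤ t * (‖x‖ - t⁻¹ * ‖y‖) ^ 2 := by positivity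
  nlinarith

lemma hsSum_add_le (b : HilbertBasis ι ℂ H) (A D : H →L[ℂ] H₁) {t : ℝ} (ht : 0 < t) :
    hsSum b (A + D) ≤ ENNReal.ofReal (1 + t) * hsSum b A + ENNReal.ofReal (1 + t⁻¹) * hsSum b D := by
  simp only [hsSum]
  rw [← ENNReal.tsum_mul_left, ← ENNReal.tsum_mul_left, ← ENNReal.tsum_add]
  exact ENNReal.tsum_le_tsum fun i => enorm_add_sq_le _ _ ht

lemma enorm_apply_sq_le_hsSum (b : HilbertBasis ι ℂ H) (A : H →L[ℂ] H₁) (x : H) :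
    ‖A x‖ₑ ^ 2 ≤ hsSum b A * ‖x‖ₑ ^ 2 := by
  obtain ⟨w, c, -⟩ := exists_hilbertBasis ℂ H₁
  rw [hsSum_eq_hsSum_adjoint b c, hsSum, ← c.tsum_enorm_inner_sq, ← ENNReal.tsum_mul_right]
  refine ENNReal.tsum_le_tsum fun i => ?_
  rw [← ContinuousLinearMap.adjoint_inner_left, ← mul_pow, ← ofReal_norm, ← ofReal_norm,
    ← ofReal_norm, ← ENNReal.ofReal_mul (norm_nonneg _)]
  gcongr
  exact norm_inner_le_norm _ _

lemma opNorm_le_sqrt_hsSum (b : HilbertBasis ι ℂ H) (A : H →L[ℂ] H₁) (hA : hsSum b A ≠ ∞) :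
    ‖A‖ ≤ √(hsSum b A).toReal := by
  refine A.opNorm_le_bound (Real.sqrt_nonneg _) fun x => ?_
  have h := enorm_apply_sq_le_hsSum b A x
  refine (sq_le_sq₀ (norm_nonneg _) (by positivity)).mp ?_
  rw [mul_pow, Real.sq_sqrt ENNReal.toReal_nonneg]
  have h2 := ENNReal.toReal_mono (ENNReal.mul_ne_top hA (by simp)) h
  simpa using h2

/-- An operator with finite Hilbert-Schmidt sum is compact. -/
lemma isCompactOperator_of_hsSum (b : HilbertBasis ι ℂ H) (A : H →L[ℂ] H₁)
    (hA : hsSum b A ≠ ∞) : IsCompactOperator A := by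
  classical
  -- Finite rank truncations: `A - R s` kills the basis vectors in `s`, so its Hilbert-Schmidt sum
  -- is a tail of a convergent series and dominates the squared operator norm.
  set R : Finset ι → H →L[ℂ] H₁ := fun s =>
    ∑ i ∈ s, (ContinuousLinearMap.toSpanSingleton ℂ (A (b i))) ∘L (innerSL ℂ (b i)) with hR
  have hRc : ∀ s, IsCompactOperator (R s) := by
    intro s
    refine Submodule.sum_mem (compactOperator (RingHom.id ℂ) H H₁) (fun i _ => ?_)
    have h1 : IsCompactOperator (innerSL ℂ (b i)) :=
      isCompactOperator_of_locallyCompactSpace_dom _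
    exact h1.clm_comp (ContinuousLinearMap.toSpanSingleton ℂ (A (b i)))
  have hRb : ∀ s j, R s (b j) = if j ∈ s then A (b j) else 0 := by
    intro s j
    have := b.orthonormal
    rw [orthonormal_iff_ite] at this
    simp [hR, this]
  have hdiff : ∀ s : Finset ι, hsSum b (A - R s) = ∑' j : { j // j ∉ s }, ‖A (b j)‖ₑ ^ 2 := by
    intro s
    rw [hsSum]
    have : ∀ j, ‖(A - R s) (b j)‖ₑ ^ 2 = Set.indicator {j | j ∉ s} (fun j => ‖A (b j)‖ₑ ^ 2) j := by
      intro j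
      by_cases hj : j ∈ s <;> simp [hRb, hj]
    simp_rw [this]
    exact (tsum_subtype {j | j ∉ s} (fun j => ‖A (b j)‖ₑ ^ 2)).symm
  have ht : Filter.Tendsto (fun s => hsSum b (A - R s)) Filter.atTop (nhds 0) := by
    simp_rw [hdiff]
    exact ENNReal.tendsto_tsum_compl_atTop_zero hA
  have hfin : ∀ s, hsSum b (A - R s) ≠ ∞ := by
    intro s
    refine ne_top_of_le_ne_top hA ?_
    rw [hdiff]
    exact ENNReal.tsum_comp_le_tsum_of_injective Subtype.val_injective _
  refine isCompactOperator_of_tendsto (l := Filter.atTop) (F := R) ?_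
    (Filter.Eventually.of_forall hRc)
  rw [tendsto_iff_norm_sub_tendsto_zero]
  have ht2 : Filter.Tendsto (fun s => √(hsSum b (A - R s)).toReal) Filter.atTop (nhds 0) := by
    have := (ENNReal.tendsto_toReal ENNReal.zero_ne_top).comp ht
    have h0 := (Real.continuous_sqrt.tendsto _).comp this
    rw [ENNReal.toReal_zero, Real.sqrt_zero] at h0
    exact h0
  refine squeeze_zero (fun s => norm_nonneg _) (fun s => ?_) ht2
  rw [norm_sub_rev]
  exact opNorm_le_sqrt_hsSum b _ (hfin s)

end HilbertSchmidt

/-! ### Hilbert bases of `L²(ℝ)` indexed by `ℕ` -/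

lemma countable_of_hilbertBasis {w : Type*} (b : HilbertBasis w ℂ L2R) : Countable w := by
  have : Fact ((2 : ℝ≥0∞) ≠ ∞) := ⟨by norm_num⟩
  -- Basis vectors are `√2` apart, so these balls are disjoint open sets in a separable space.
  have hd : (Set.univ : Set w).PairwiseDisjoint (fun i => Metric.ball (b i) (1 / 2)) := by
    intro i _ j _ hij
    refine Metric.ball_disjoint_ball ?_
    have h1 : ‖b i - b j‖ ^ 2 = 2 := by
      rw [@norm_sub_sq ℂ, b.orthonormal.1 i, b.orthonormal.1 j, b.orthonormal.2 hij]
      norm_num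
    rw [dist_eq_norm]
    nlinarith [norm_nonneg (b i - b j)]
  have := hd.countable_of_isOpen (fun i _ => Metric.isOpen_ball) (fun i _ => ⟨b i, by simp⟩)
  exact Set.countable_univ_iff.mp this

lemma infinite_of_hilbertBasis {w : Type*} (b : HilbertBasis w ℂ L2R) : Infinite w := by
  by_contra hw
  rw [not_infinite_iff_finite] at hw
  have := Fintype.ofFinite w
  have hfd : FiniteDimensional ℂ L2R := b.toOrthonormalBasis.toBasis.finiteDimensional_of_finite
  have hmeas : ∀ n : ℕ, MeasurableSet (Set.Ico (n : ℝ) (n + 1)) := fun n => measurableSet_Ico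
  have hfin : ∀ n : ℕ, volume (Set.Ico (n : ℝ) (n + 1)) ≠ ∞ := fun n => by simp
  let v : ℕ → L2R := fun n => indicatorConstLp 2 (hmeas n) (hfin n) (1 : ℂ)
  have hv : Orthonormal ℂ v := by
    constructor
    · intro n
      simp [v, norm_indicatorConstLp]
    · intro m n hmn
      simp only [v]
      rw [L2.inner_indicatorConstLp_indicatorConstLp (hmeas m) (hmeas n) (hfin m) (hfin n)]
      have : Set.Ico (m : ℝ) (m + 1) ∩ Set.Ico (n : ℝ) (n + 1) = ∅ := by
        ext x
        simp only [Set.mem_inter_iff, Set.mem_Ico, Set.mem_empty_iff_false, iff_false]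
        rintro ⟨⟨h1, h2⟩, h3, h4⟩
        apply hmn
        have a1 : (m : ℝ) < n + 1 := by linarith
        have a2 : (n : ℝ) < m + 1 := by linarith
        norm_cast at a1 a2
        omega
      simp [this]
  have := hv.linearIndependent.finite
  exact not_finite ℕ

lemma HilbertBasis.exists_reindex_nat {ι : Type*} (b : HilbertBasis ι ℂ L2R) :
    ∃ (c : HilbertBasis ℕ ℂ L2R) (e : ℕ → ι), ∀ n, c n = b (e n) := by
  have := countable_of_hilbertBasis b
  have := infinite_of_hilbertBasis b
  obtain ⟨e⟩ := nonempty_equiv_of_countable (α := ℕ) (β := ι)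
  refine ⟨HilbertBasis.mk (v := b ∘ e) (b.orthonormal.comp _ e.injective) ?_, e, fun n => ?_⟩
  · rw [Set.range_comp, e.surjective.range_eq, Set.image_univ, b.dense_span]
  · simp

lemma nonempty_hilbertBasis_nat : Nonempty (HilbertBasis ℕ ℂ L2R) := by
  obtain ⟨w, b, -⟩ := exists_hilbertBasis ℂ L2R
  exact ⟨b.exists_reindex_nat.choose⟩

/-- A fixed Hilbert basis of `L²(ℝ)`. -/
noncomputable def stdB : HilbertBasis ℕ ℂ L2R := Classical.choice nonempty_hilbertBasis_nat

/-! ### States and their spectral decompositions -/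

section States

lemma ContinuousLinearMap.IsPositive.exists_adjoint_comp_self {H : Type*} [NormedAddCommGroup H]
    [InnerProductSpace ℂ H] [CompleteSpace H] {T : H →L[ℂ] H} (hT : T.IsPositive) :
    ∃ A : H →L[ℂ] H, ContinuousLinearMap.adjoint A ∘L A = T := by
  have h0 : 0 ≤ T := (ContinuousLinearMap.nonneg_iff_isPositive T).mpr hT
  refine ⟨CFC.sqrt T, ?_⟩
  have h1 : IsSelfAdjoint (CFC.sqrt T) := (CFC.sqrt_nonneg T).isSelfAdjoint
  rw [ContinuousLinearMap.isSelfAdjoint_iff'] at h1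
  rw [h1]
  exact CFC.sqrt_mul_sqrt_self T h0

variable {H₁ : Type*} [NormedAddCommGroup H₁] [InnerProductSpace ℂ H₁] [CompleteSpace H₁]

lemma inner_adjoint_comp_self {H : Type*} [NormedAddCommGroup H]
    [InnerProductSpace ℂ H] [CompleteSpace H] (A : H →L[ℂ] H₁) (ψ : H) :
    ⟪ψ, (ContinuousLinearMap.adjoint A ∘L A) ψ⟫_ℂ = ((‖A ψ‖ ^ 2 : ℝ) : ℂ) := by
  rw [ContinuousLinearMap.comp_apply, ContinuousLinearMap.adjoint_inner_right,
    inner_self_eq_norm_sq_to_K]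
  simp

/-- Eigenvectors of a compact self-adjoint operator form a Hilbert basis. -/
lemma exists_hilbertBasis_eigenvectors {T : L2R →L[ℂ] L2R} (hc : IsCompactOperator T)
    (hs : (T : L2R →ₗ[ℂ] L2R).IsSymmetric) :
    ∃ (b : HilbertBasis ℕ ℂ L2R) (μ : ℕ → ℂ), ∀ n, T (b n) = μ n • b n := by
  -- The kernel is kept among the eigenspaces, so the eigenvectors form a full basis indexed by `ℕ`
  -- even if `T` has finite rank.
  let V : ℂ → Submodule ℂ L2R := fun μ => Module.End.eigenspace (T : L2R →ₗ[ℂ] L2R) μ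
  have hV : OrthogonalFamily ℂ (fun μ => V μ) fun μ => (V μ).subtypeₗᵢ :=
    hs.orthogonalFamily_eigenspaces
  have hcl : ∀ μ, IsClosed (V μ : Set L2R) := by
    intro μ
    have : (V μ : Set L2R) = {x | T x = μ • x} := by
      ext x
      simp [V]
    rw [this]
    exact isClosed_eq T.continuous (continuous_const_smul μ)
  have hcomp : ∀ μ, CompleteSpace (V μ) := fun μ => (hcl μ).completeSpace_coe
  choose w b hb using fun μ => exists_hilbertBasis ℂ (V μ)
  have hon := hV.orthonormal_sigma_orthonormal (fun μ => (b μ).orthonormal)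
  set v : (Σ μ : ℂ, w μ) → L2R := fun a => (V a.1).subtypeₗᵢ (b a.1 a.2) with hv
  -- The compact spectral theorem gives trivial orthogonal complement to the sum of the eigenspaces.
  -- A vector orthogonal to the chosen bases is orthogonal to each eigenspace, by expanding there.
  have hperp : (Submodule.span ℂ (Set.range v))ᗮ = ⊥ := by
    rw [eq_bot_iff, ← ContinuousLinearMap.orthogonalComplement_iSup_eigenspaces_eq_bot hc hs]
    intro x hx
    rw [← Submodule.iInf_orthogonal, Submodule.mem_iInf]
    intro μ
    rw [Submodule.mem_orthogonal]
    intro y hy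
    have h1 := (b μ).hasSum_repr ⟨y, hy⟩
    have h2 := (h1.mapL (V μ).subtypeL).mapL ((innerSL ℂ x))
    have h3 : ∀ i, (innerSL ℂ x) ((V μ).subtypeL ((b μ).repr ⟨y, hy⟩ i • b μ i)) = 0 := by
      intro i
      have : ⟪v ⟨μ, i⟩, x⟫_ℂ = 0 :=
        (Submodule.mem_orthogonal _ _).mp hx _ (Submodule.subset_span ⟨_, rfl⟩)
      have h4 : ⟪x, ((b μ i : V μ) : L2R)⟫_ℂ = 0 := by
        rw [← inner_conj_symm]
        have h5 : ⟪((b μ i : V μ) : L2R), x⟫_ℂ = 0 := this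
        rw [h5, map_zero]
      simp [h4]
    simp only [h3] at h2
    have h5 := h2.unique hasSum_zero
    rw [← inner_conj_symm]
    have h6 : ⟪x, y⟫_ℂ = 0 := h5
    rw [h6, map_zero]
  obtain ⟨c, e, he⟩ := (HilbertBasis.mkOfOrthogonalEqBot hon hperp).exists_reindex_nat
  refine ⟨c, fun n => (e n).1, fun n => ?_⟩
  rw [he, HilbertBasis.coe_mkOfOrthogonalEqBot]
  exact Module.End.mem_eigenspace_iff.mp (b (e n).1 (e n).2).2

/-- A positive operator `A* A` with `A` of Hilbert-Schmidt norm one is a state with a spectral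
decomposition. -/
theorem exists_isSpectralDecomposition (A : L2R →L[ℂ] H₁) (hA : hsSum stdB A = 1) :
    ∃ (lam : ℕ → ℝ) (φ : ℕ → L2R),
      IsSpectralDecomposition (ContinuousLinearMap.adjoint A ∘L A) lam φ := by
  have hc : IsCompactOperator (ContinuousLinearMap.adjoint A ∘L A) :=
    (isCompactOperator_of_hsSum stdB A (by simp [hA])).clm_comp (ContinuousLinearMap.adjoint A)
  obtain ⟨b, μ, hb⟩ := exists_hilbertBasis_eigenvectors hc
    (ContinuousLinearMap.isPositive_adjoint_comp_self A).isSymmetric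
  -- The eigenvalues are the terms of the Hilbert-Schmidt sum of `A` in the eigenbasis; by basis
  -- independence they sum to one.
  have hμ : ∀ n, μ n = ((‖A (b n)‖ ^ 2 : ℝ) : ℂ) := by
    intro n
    rw [← inner_adjoint_comp_self, hb, inner_smul_right, inner_self_eq_norm_sq_to_K,
      b.orthonormal.1 n]
    simp
  refine ⟨fun n => ‖A (b n)‖ ^ 2, b, b.orthonormal, fun n => by positivity, ?_, fun ψ => ?_⟩
  · rw [hsSum_eq stdB b] at hA
    simp only [hsSum, enorm_sq_eq_ofReal] at hA
    have hs : Summable fun n => ‖A (b n)‖ ^ 2 := by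
      have := ENNReal.summable_toReal (f := fun n => ENNReal.ofReal (‖A (b n)‖ ^ 2))
        (by rw [hA]; exact ENNReal.one_ne_top)
      simpa using this
    rw [← ENNReal.ofReal_tsum_of_nonneg (fun n => by positivity) hs] at hA
    have h1 : ∑' n, ‖A (b n)‖ ^ 2 = 1 := by simpa using hA
    exact h1 ▸ hs.hasSum
  · have h1 := (b.hasSum_repr ψ).mapL (ContinuousLinearMap.adjoint A ∘L A)
    convert h1 using 2 with n
    rw [map_smul, hb, hμ, b.repr_apply_apply, smul_smul, mul_comm]

/-- The family `λ_j ⟨E*φ_j, b_i⟩⟨b_i, φ_j⟩` is absolutely summable, by Parseval and `2xy ≤ x² + y²`.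
Summing over `j` first gives the diagonal entries in the basis `b`, over `i` first the spectral
expression. -/
lemma IsSpectralDecomposition.hasTrace_comp {T : L2R →L[ℂ] L2R} {lam : ℕ → ℝ} {φ : ℕ → L2R}
    (h : IsSpectralDecomposition T lam φ) (E : L2R →L[ℂ] L2R) :
    HasTrace (T ∘L E) (∑' j, (lam j : ℂ) * ⟪φ j, E (φ j)⟫_ℂ) := by
  intro w b
  set D := ContinuousLinearMap.adjoint E with hD
  have hdbl : ∀ i, HasSum (fun j => (lam j : ℂ) * (⟪D (φ j), b i⟫_ℂ * ⟪b i, φ j⟫_ℂ))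
      ⟪b i, (T ∘L E) (b i)⟫_ℂ := by
    intro i
    have h1 := (h.hasSum_apply (E (b i))).mapL (innerSL ℂ (b i))
    have h2 : (fun j => (lam j : ℂ) * (⟪D (φ j), b i⟫_ℂ * ⟪b i, φ j⟫_ℂ))
        = fun j => innerSL ℂ (b i) (((lam j : ℂ) * ⟪φ j, E (b i)⟫_ℂ) • φ j) := by
      funext j
      rw [hD, ContinuousLinearMap.adjoint_inner_left, map_smul, innerSL_apply_apply, smul_eq_mul]
      ring
    rw [h2]
    exact h1
  have hterm : ∀ j, HasSum (fun i => (lam j : ℂ) * (⟪D (φ j), b i⟫_ℂ * ⟪b i, φ j⟫_ℂ))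
      ((lam j : ℂ) * ⟪φ j, E (φ j)⟫_ℂ) := by
    intro j
    have := (b.hasSum_inner_mul_inner (D (φ j)) (φ j)).mul_left (lam j : ℂ)
    rwa [hD, ContinuousLinearMap.adjoint_inner_left] at this
  have hsum : Summable fun z : ℕ × w =>
      (lam z.1 : ℂ) * (⟪D (φ z.1), b z.2⟫_ℂ * ⟪b z.2, φ z.1⟫_ℂ) := by
    have hbd : Summable fun z : ℕ × w =>
        lam z.1 * (‖⟪b z.2, D (φ z.1)⟫_ℂ‖ ^ 2 + ‖⟪b z.2, φ z.1⟫_ℂ‖ ^ 2) := by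
      have hn : ∀ z : ℕ × w,
          0 ≤ lam z.1 * (‖⟪b z.2, D (φ z.1)⟫_ℂ‖ ^ 2 + ‖⟪b z.2, φ z.1⟫_ℂ‖ ^ 2) := fun z =>
        mul_nonneg (h.nonneg _) (by positivity)
      have hin : ∀ j, HasSum (fun i => lam j * (‖⟪b i, D (φ j)⟫_ℂ‖ ^ 2 + ‖⟪b i, φ j⟫_ℂ‖ ^ 2))
          (lam j * (‖D (φ j)‖ ^ 2 + ‖φ j‖ ^ 2)) := fun j =>
        ((b.hasSum_norm_inner_sq _).add (b.hasSum_norm_inner_sq _)).mul_left _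
      rw [summable_prod_of_nonneg hn]
      refine ⟨fun j => (hin j).summable, ?_⟩
      simp_rw [fun j => (hin j).tsum_eq]
      refine Summable.of_nonneg_of_le (fun j => mul_nonneg (h.nonneg j) (by positivity)) (fun j => ?_)
        (h.sum_one.summable.mul_right (‖D‖ ^ 2 + 1))
      refine mul_le_mul_of_nonneg_left ?_ (h.nonneg j)
      have h1 := D.le_opNorm (φ j)
      rw [h.orthonormal.1 j, mul_one] at h1
      rw [h.orthonormal.1 j]
      gcongr
      norm_num
    refine Summable.of_norm_bounded hbd fun z => ?_
    rw [norm_mul, norm_mul, Complex.norm_real, Real.norm_of_nonneg (h.nonneg _)]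
    refine mul_le_mul_of_nonneg_left ?_ (h.nonneg _)
    rw [norm_inner_symm (D _)]
    nlinarith [sq_nonneg (‖⟪b z.2, D (φ z.1)⟫_ℂ‖ - ‖⟪b z.2, φ z.1⟫_ℂ‖),
      norm_nonneg ⟪b z.2, D (φ z.1)⟫_ℂ, norm_nonneg ⟪b z.2, φ z.1⟫_ℂ]
  have hA := hsum.hasSum.prod_fiberwise hterm
  have hB := hsum.prod_symm.hasSum.prod_fiberwise (fun i => hdbl i)
  rw [hA.tsum_eq]
  convert hB using 1
  exact ((Equiv.prodComm _ _).tsum_eq (fun z : ℕ × w =>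
      (lam z.1 : ℂ) * (⟪D (φ z.1), b z.2⟫_ℂ * ⟪b z.2, φ z.1⟫_ℂ))).symm

lemma IsState.exists_isSpectralDecomposition {S : L2R →L[ℂ] L2R} (hS : IsState S) :
    ∃ (lam : ℕ → ℝ) (φ : ℕ → L2R), IsSpectralDecomposition S lam φ := by
  obtain ⟨A, rfl⟩ := hS.positive.exists_adjoint_comp_self
  obtain ⟨w, b, -⟩ := exists_hilbertBasis ℂ L2R
  refine _root_.exists_isSpectralDecomposition A ?_
  have h := hS.trace_one w b
  simp_rw [inner_adjoint_comp_self] at h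
  have h2 : HasSum (fun i => ‖A (b i)‖ ^ 2) 1 := Complex.hasSum_ofReal.mp (by simpa using h)
  rw [hsSum_eq stdB b, hsSum]
  simp_rw [enorm_sq_eq_ofReal]
  rw [← ENNReal.ofReal_tsum_of_nonneg (fun i => by positivity) h2.summable, h2.tsum_eq]
  simp

lemma IsSpectralDecomposition.hasTrace_one {T : L2R →L[ℂ] L2R} {lam : ℕ → ℝ} {φ : ℕ → L2R}
    (h : IsSpectralDecomposition T lam φ) : HasTrace T 1 := by
  have h1 := h.hasTrace_comp (ContinuousLinearMap.id ℂ L2R)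
  have h2 : ∑' j, (lam j : ℂ) * ⟪φ j, ContinuousLinearMap.id ℂ L2R (φ j)⟫_ℂ = 1 := by
    simp only [ContinuousLinearMap.id_apply, inner_self_eq_norm_sq_to_K, h.orthonormal.1]
    have := (Complex.hasSum_ofReal.mpr h.sum_one).tsum_eq
    simpa using this
  rwa [h2, ContinuousLinearMap.comp_id] at h1

lemma isState_adjoint_comp_self (A : L2R →L[ℂ] H₁) (hA : hsSum stdB A = 1) :
    IsState (ContinuousLinearMap.adjoint A ∘L A) := by
  obtain ⟨lam, φ, h⟩ := exists_isSpectralDecomposition A hA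
  exact ⟨ContinuousLinearMap.isPositive_adjoint_comp_self A, h.hasTrace_one⟩

end States

/-! ### Multiplication, translation and modulation operators -/

section Operators

/-- The character `x ↦ e^(ipx)`. -/
noncomputable def expFun (p x : ℝ) : ℂ := Complex.exp (((p * x : ℝ) : ℂ) * Complex.I)

lemma continuous_expFun (p : ℝ) : Continuous (expFun p) := by
  unfold expFun; fun_prop

lemma norm_expFun (p x : ℝ) : ‖expFun p x‖ = 1 := Complex.norm_exp_ofReal_mul_I _

lemma expFun_mul (p q x : ℝ) : expFun p x * expFun q x = expFun (p + q) x := by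
  rw [expFun, expFun, expFun, ← Complex.exp_add]
  congr 1
  push_cast
  ring

lemma expFun_conj (p x : ℝ) : (starRingEnd ℂ) (expFun p x) = expFun (-p) x := by
  rw [expFun, expFun, ← Complex.exp_conj]
  congr 1
  simp

/-- `g` is measurable and bounded by one. -/
structure IsContr (g : ℝ → ℂ) : Prop where
  measurable : Measurable g
  le_one : ∀ x, ‖g x‖ ≤ 1

lemma IsContr.memLp {g : ℝ → ℂ} (h : IsContr g) : MemLp g ∞ volume :=
  memLp_top_of_bound h.measurable.aestronglyMeasurable 1 (.of_forall h.le_one)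

lemma isContr_expFun (p : ℝ) : IsContr (expFun p) :=
  ⟨(continuous_expFun p).measurable, fun x => (norm_expFun p x).le⟩

lemma isContr_indicator {X : Set ℝ} (hX : MeasurableSet X) :
    IsContr (X.indicator fun _ => (1 : ℂ)) := by
  refine ⟨measurable_const.indicator hX, fun x => ?_⟩
  by_cases hx : x ∈ X <;> simp [hx]

lemma norm_mulOp_le {g : ℝ → ℂ} (h : IsContr g) : ‖mulOp g‖ ≤ 1 := by
  refine ContinuousLinearMap.opNorm_le_bound _ zero_le_one fun ψ => ?_
  rw [one_mul]
  refine Lp.norm_le_norm_of_ae_le ?_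
  filter_upwards [mulOp_coeFn h.memLp ψ] with x hx
  rw [hx, norm_mul]
  exact mul_le_of_le_one_left (norm_nonneg _) (h.le_one x)

lemma mulOp_comp {f g : ℝ → ℂ} (hf : MemLp f ∞ volume) (hg : MemLp g ∞ volume) :
    mulOp f ∘L mulOp g = mulOp (fun x => f x * g x) := by
  ext1 ψ
  refine Lp.ext ?_
  filter_upwards [mulOp_coeFn hf (mulOp g ψ), mulOp_coeFn hg ψ,
    mulOp_coeFn (hg.mul hf (r := ∞)) ψ] with x h1 h2 h3
  rw [ContinuousLinearMap.comp_apply, h1, h2]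
  erw [h3]
  simp [mul_assoc]

lemma mulOp_one : mulOp (fun _ => (1 : ℂ)) = ContinuousLinearMap.id ℂ L2R := by
  ext1 ψ
  refine Lp.ext ?_
  filter_upwards [mulOp_coeFn (memLp_top_const (1 : ℂ)) ψ] with x h1
  rw [h1]
  simp

lemma mulOp_add {f g : ℝ → ℂ} (hf : MemLp f ∞ volume) (hg : MemLp g ∞ volume) :
    mulOp f + mulOp g = mulOp (fun x => f x + g x) := by
  ext1 ψ
  refine Lp.ext ?_
  filter_upwards [Lp.coeFn_add (mulOp f ψ) (mulOp g ψ), mulOp_coeFn hf ψ, mulOp_coeFn hg ψ,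
    mulOp_coeFn (hf.add hg) ψ] with x h0 h1 h2 h3
  rw [add_apply, h0, Pi.add_apply, h1, h2]
  erw [h3]
  simp [add_mul]

lemma memLp_top_conj {g : ℝ → ℂ} (hg : MemLp g ∞ volume) :
    MemLp (fun x => (starRingEnd ℂ) (g x)) ∞ volume := hg.star

lemma inner_mulOp_left {g : ℝ → ℂ} (hg : MemLp g ∞ volume) (φ ψ : L2R) :
    ⟪mulOp g φ, ψ⟫_ℂ = ⟪φ, mulOp (fun x => (starRingEnd ℂ) (g x)) ψ⟫_ℂ := by
  rw [L2.inner_def, L2.inner_def]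
  refine integral_congr_ae ?_
  filter_upwards [mulOp_coeFn hg φ, mulOp_coeFn (memLp_top_conj hg) ψ] with x h1 h2
  rw [h1, h2]
  simp only [RCLike.inner_apply, map_mul]
  ring

lemma adjoint_mulOp {g : ℝ → ℂ} (hg : MemLp g ∞ volume) :
    ContinuousLinearMap.adjoint (mulOp g) = mulOp (fun x => (starRingEnd ℂ) (g x)) := by
  symm
  rw [ContinuousLinearMap.eq_adjoint_iff]
  intro φ ψ
  rw [inner_mulOp_left (memLp_top_conj hg)]
  simp

lemma enorm_sq_eq_lintegral (ψ : L2R) : ‖ψ‖ₑ ^ 2 = ∫⁻ x, ‖ψ x‖ₑ ^ 2 := by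
  have h := eLpNorm_nnreal_pow_eq_lintegral (f := ψ) (μ := volume) (p := 2) (by norm_num)
  rw [Lp.enorm_def]
  simpa using h

lemma enorm_mulOp_sq {g : ℝ → ℂ} (hg : MemLp g ∞ volume) (ψ : L2R) :
    ‖mulOp g ψ‖ₑ ^ 2 = ∫⁻ x, ‖g x‖ₑ ^ 2 * ‖ψ x‖ₑ ^ 2 := by
  rw [enorm_sq_eq_lintegral]
  refine lintegral_congr_ae ?_
  filter_upwards [mulOp_coeFn hg ψ] with x h1
  rw [h1, enorm_mul, mul_pow]

/-- The translation `(T_q ψ)(x) = ψ(x - q)`. -/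
noncomputable def transl (q : ℝ) : L2R →L[ℂ] L2R :=
  (Lp.compMeasurePreservingₗᵢ ℂ (fun x : ℝ => x - q)
    (measurePreserving_sub_right volume q)).toContinuousLinearMap

lemma transl_coeFn (q : ℝ) (ψ : L2R) : transl q ψ =ᵐ[volume] fun x => ψ (x - q) :=
  Lp.coeFn_compMeasurePreserving ψ (measurePreserving_sub_right volume q)

lemma norm_transl_le (q : ℝ) : ‖transl q‖ ≤ 1 := LinearIsometry.norm_toContinuousLinearMap_le _

lemma ae_sub_right (q : ℝ) {P : ℝ → Prop} (h : ∀ᵐ x, P x) : ∀ᵐ x : ℝ, P (x - q) :=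
  (measurePreserving_sub_right volume q).quasiMeasurePreserving.ae h

lemma transl_comp (p q : ℝ) : transl p ∘L transl q = transl (p + q) := by
  ext1 ψ
  refine Lp.ext ?_
  filter_upwards [transl_coeFn p (transl q ψ), ae_sub_right p (transl_coeFn q ψ),
    transl_coeFn (p + q) ψ] with x h1 h2 h3
  rw [ContinuousLinearMap.comp_apply, h1, h2, h3, sub_sub]

lemma transl_zero : transl 0 = ContinuousLinearMap.id ℂ L2R := by
  ext1 ψ
  refine Lp.ext ?_
  filter_upwards [transl_coeFn 0 ψ] with x h1
  simp [h1]

lemma memLp_top_sub_right {g : ℝ → ℂ} (hg : MemLp g ∞ volume) (q : ℝ) :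
    MemLp (fun x => g (x - q)) ∞ volume :=
  hg.comp_measurePreserving (measurePreserving_sub_right volume q)

lemma transl_comp_mulOp {g : ℝ → ℂ} (hg : MemLp g ∞ volume) (q : ℝ) :
    transl q ∘L mulOp g = mulOp (fun x => g (x - q)) ∘L transl q := by
  ext1 ψ
  refine Lp.ext ?_
  filter_upwards [transl_coeFn q (mulOp g ψ), ae_sub_right q (mulOp_coeFn hg ψ),
    mulOp_coeFn (memLp_top_sub_right hg q) (transl q ψ), transl_coeFn q ψ] with x h1 h2 h3 h4
  rw [ContinuousLinearMap.comp_apply, ContinuousLinearMap.comp_apply, h1, h2, h3, h4]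

/-- The modulation `(M_p ψ)(x) = e^(ipx) ψ(x)`. -/
noncomputable def modul (p : ℝ) : L2R →L[ℂ] L2R := mulOp (expFun p)

lemma norm_modul_le (p : ℝ) : ‖modul p‖ ≤ 1 := norm_mulOp_le (isContr_expFun p)

lemma modul_comp (p q : ℝ) : modul p ∘L modul q = modul (p + q) := by
  rw [modul, modul, mulOp_comp (isContr_expFun p).memLp (isContr_expFun q).memLp, modul]
  congr 1
  funext x
  exact expFun_mul p q x

lemma modul_zero : modul 0 = ContinuousLinearMap.id ℂ L2R := by
  rw [modul, ← mulOp_one]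
  congr 1
  funext x
  simp [expFun]

lemma modul_comp_mulOp {g : ℝ → ℂ} (hg : MemLp g ∞ volume) (p : ℝ) :
    modul p ∘L mulOp g = mulOp g ∘L modul p := by
  rw [modul, mulOp_comp (isContr_expFun p).memLp hg, mulOp_comp hg (isContr_expFun p).memLp]
  congr 1
  funext x
  ring

lemma ext_of_integrable {A D : L2R →L[ℂ] L2R}
    (h : ∀ (g : ℝ → ℂ) (_ : Integrable g) (h2 : MemLp g 2), A (h2.toLp g) = D (h2.toLp g)) :
    A = D := by
  have hd := SchwartzMap.denseRange_toLpCLM (E := ℝ) (F := ℂ) (p := 2) (μ := volume)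
    ENNReal.ofNat_ne_top
  refine ContinuousLinearMap.ext fun ψ => congrFun (hd.equalizer A.continuous D.continuous ?_) ψ
  funext f
  exact h f f.integrable (f.memLp 2 volume)

/-- On `L¹ ∩ L²` modulation shifts the argument of the Fourier integral: `σkx + px = σ(k + σp)x`
because `σ² = 1`. Density does the rest. -/
lemma IsPlancherel.comp_modul {σ : ℝ} {U : L2R ≃ₗᵢ[ℂ] L2R} (hU : IsPlancherel σ U)
    (hσ : σ * σ = 1) (p : ℝ) (ψ : L2R) : U (modul p ψ) = transl (-(σ * p)) (U ψ) := by
  suffices h : (U.toContinuousLinearEquiv : L2R →L[ℂ] L2R) ∘L modul p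
      = transl (-(σ * p)) ∘L (U.toContinuousLinearEquiv : L2R →L[ℂ] L2R) from
    congrArg (fun A : L2R →L[ℂ] L2R => A ψ) h
  refine ext_of_integrable fun g h1 h2 => ?_
  have hm1 : Integrable (fun x => expFun p x * g x) :=
    h1.bdd_mul (c := 1) (continuous_expFun p).aestronglyMeasurable
      (.of_forall fun x => (norm_expFun p x).le)
  have hm2 : MemLp (fun x => expFun p x * g x) 2 :=
    MemLp.of_le h2 ((continuous_expFun p).aestronglyMeasurable.mul h2.1)
      (.of_forall fun x => by rw [norm_mul, norm_expFun, one_mul])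
  have he : modul p (h2.toLp g) = hm2.toLp _ := by
    refine Lp.ext ?_
    filter_upwards [mulOp_coeFn (isContr_expFun p).memLp (h2.toLp g), h2.coeFn_toLp,
      hm2.coeFn_toLp] with x a b c
    rw [modul, a, b, c]
  change U (modul p (h2.toLp g)) = transl (-(σ * p)) (U (h2.toLp g))
  rw [he]
  refine Lp.ext ?_
  filter_upwards [hU _ hm1 hm2, transl_coeFn (-(σ * p)) (U (h2.toLp g)),
    ae_sub_right (-(σ * p)) (hU g h1 h2)] with k a b c
  rw [a, b, c, fourierInt, fourierInt]
  congr 1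
  refine integral_congr_ae (.of_forall fun x => ?_)
  simp only [expFun]
  rw [← mul_assoc, ← Complex.exp_add]
  congr 2
  rw [← add_mul, ← Complex.ofReal_add]
  congr 2
  linear_combination (-(p * x)) * hσ

/-- This is the modulation law of `U⁻¹`, which has sign `-σ`, read backwards. -/
lemma IsPlancherel.comp_transl {σ : ℝ} {U : L2R ≃ₗᵢ[ℂ] L2R} (hU : IsPlancherel σ U)
    (hσ : σ * σ = 1) (q : ℝ) (ψ : L2R) : U (transl q ψ) = modul (σ * q) (U ψ) := by
  have h := hU.symm.comp_modul (by linarith) (σ * q) (U ψ)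
  rw [U.symm_apply_apply] at h
  have h2 : -(-σ * (σ * q)) = q := by linear_combination q * hσ
  rw [h2] at h
  rw [← h, U.apply_symm_apply]

/-- The operator `U⁻¹ n(Q) U` acts by convolution with `U⁻¹ n`. -/
lemma IsPlancherel.conj_mulOp_ae {σ : ℝ} {U : L2R ≃ₗᵢ[ℂ] L2R} (hU : IsPlancherel σ U)
    (hσ : σ * σ = 1) {n : ℝ → ℂ} (hn : MemLp n ∞ volume) {η : L2R}
    (hη : U η =ᵐ[volume] fun x => (starRingEnd ℂ) (n x)) (ψ : L2R) :
    U.symm (mulOp n (U ψ)) =ᵐ[volume]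
      fun y => ((√(2 * Real.pi))⁻¹ : ℝ) * ⟪transl y η, ψ⟫_ℂ := by
  have hm := mulOp_coeFn hn (U ψ)
  have h2 : MemLp (fun x => n x * U ψ x) 2 := (memLp_congr_ae hm).mp (Lp.memLp _)
  -- Since `n` is the conjugate of `U η`, this is a product of two `L²` functions, and the Fourier
  -- integral of `U⁻¹` applies to it.
  have h1 : Integrable (fun x => n x * U ψ x) := by
    have := L2.integrable_inner (𝕜 := ℂ) (U η) (U ψ)
    refine this.congr ?_
    filter_upwards [hη] with x hx
    rw [hx]
    simp [mul_comm]
  have he : mulOp n (U ψ) = h2.toLp _ := by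
    refine Lp.ext ?_
    filter_upwards [hm, h2.coeFn_toLp] with x a b
    rw [a, b]
  rw [he]
  filter_upwards [hU.symm _ h1 h2] with y hy
  rw [hy, fourierInt]
  congr 1
  -- `U` turns the translation by `y` into the character `e^(iσyx)`, which is the kernel of the
  -- inverse integral after conjugation.
  have e1 : ⟪transl y η, ψ⟫_ℂ = ⟪modul (σ * y) (U η), U ψ⟫_ℂ := by
    rw [← U.inner_map_map, hU.comp_transl hσ]
  rw [e1, L2.inner_def]
  refine integral_congr_ae ?_
  filter_upwards [hη, mulOp_coeFn (isContr_expFun (σ * y)).memLp (U η)] with x a b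
  rw [modul, b, a]
  rw [RCLike.inner_apply, map_mul, expFun_conj, Complex.conj_conj, expFun, neg_mul σ y]
  ring

lemma aemeasurable_enorm_sq (ψ : L2R) : AEMeasurable (fun y => ‖ψ y‖ₑ ^ 2) volume :=
  (Lp.aestronglyMeasurable ψ).enorm.pow_const 2

/-- The Hilbert-Schmidt kernel of `U⁻¹ n(Q) U D`. -/
lemma IsPlancherel.tsum_lintegral_conj_mulOp {σ : ℝ} {U : L2R ≃ₗᵢ[ℂ] L2R} (hU : IsPlancherel σ U)
    (hσ : σ * σ = 1) {n : ℝ → ℂ} (hn : MemLp n ∞ volume) {η : L2R}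
    (hη : U η =ᵐ[volume] fun x => (starRingEnd ℂ) (n x)) {w : ℝ → ℝ≥0∞} (hw : AEMeasurable w volume)
    {d : ℝ → ℂ} (hd : MemLp d ∞ volume) :
    ∑' j, ∫⁻ y, w y * ‖(U.symm (mulOp n (U (mulOp d (stdB j)))) : L2R) y‖ₑ ^ 2
      = ∫⁻ y, w y * (ENNReal.ofReal (2 * Real.pi)⁻¹ * ∫⁻ x, ‖d x‖ₑ ^ 2 * ‖η (x - y)‖ₑ ^ 2) := by
  have hmeas : ∀ j, AEMeasurable (fun y =>
      w y * ‖(U.symm (mulOp n (U (mulOp d (stdB j)))) : L2R) y‖ₑ ^ 2) volume :=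
    fun j => hw.mul (aemeasurable_enorm_sq _)
  rw [← lintegral_tsum hmeas]
  refine lintegral_congr_ae ?_
  -- The exceptional null set depends on the basis vector; countability of the basis gives a single
  -- one.
  have hall : ∀ᵐ y, ∀ j, (U.symm (mulOp n (U (mulOp d (stdB j)))) : L2R) y
      = ((√(2 * Real.pi))⁻¹ : ℝ) * ⟪transl y η, mulOp d (stdB j)⟫_ℂ :=
    ae_all_iff.mpr fun j => hU.conj_mulOp_ae hσ hn hη _
  filter_upwards [hall] with y hy
  simp_rw [hy, ENNReal.tsum_mul_left]
  congr 1
  simp_rw [enorm_mul, mul_pow, ENNReal.tsum_mul_left]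
  congr 1
  · rw [enorm_sq_eq_ofReal, Complex.norm_real, Real.norm_eq_abs, sq_abs, inv_pow,
      Real.sq_sqrt Real.two_pi_pos.le]
  -- With `d` moved to the left of the inner product, Parseval collapses the sum over `j` to the
  -- squared norm of `d̄ · T_y η`.
  · have : ∀ j, ⟪transl y η, mulOp d (stdB j)⟫_ℂ
        = ⟪mulOp (fun x => (starRingEnd ℂ) (d x)) (transl y η), stdB j⟫_ℂ := fun j => by
      rw [inner_mulOp_left (memLp_top_conj hd)]
      simp
    simp_rw [this]
    rw [stdB.tsum_enorm_inner_sq', enorm_mulOp_sq (memLp_top_conj hd)]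
    refine lintegral_congr_ae ?_
    filter_upwards [transl_coeFn y η] with x hx
    rw [hx, RCLike.enorm_conj]

end Operators

/-! ### Observables and their quadratic forms -/

section Quad

variable {Ω Ω' : Type*} [MeasurableSpace Ω] [MeasurableSpace Ω']
  {H : Type*} [NormedAddCommGroup H] [InnerProductSpace ℂ H]

lemma Observable.inner_empty (E : Observable Ω H) (φ ψ : H) : ⟪φ, E ∅ ψ⟫_ℂ = 0 := by
  have h := E.additive (fun _ => ∅) (fun _ => MeasurableSet.empty)
    (fun i j _ => Set.disjoint_empty _) φ ψ
  rw [Set.iUnion_empty] at h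
  -- Additivity along the constant sequence of empty sets gives a convergent constant series.
  exact (summable_const_iff _).mp h.summable

/-- The measure `X ↦ ⟨ψ, E(X) ψ⟩`. -/
noncomputable def Observable.quad (E : Observable Ω H) (ψ : H) : Measure Ω :=
  Measure.ofMeasurable (fun X _ => ENNReal.ofReal (⟪ψ, E X ψ⟫_ℂ).re)
    (by simp [E.inner_empty])
    (fun X hX hd => by
      have h := Complex.hasSum_re (E.additive X hX hd ψ ψ)
      rw [← h.tsum_eq, ENNReal.ofReal_tsum_of_nonneg (fun n => ?_) h.summable]
      exact (E.positive _ (hX n)).re_inner_nonneg_right ψ)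

lemma Observable.quad_apply (E : Observable Ω H) (ψ : H) {X : Set Ω} (hX : MeasurableSet X) :
    E.quad ψ X = ENNReal.ofReal (⟪ψ, E X ψ⟫_ℂ).re :=
  Measure.ofMeasurable_apply X hX

lemma ContinuousLinearMap.IsPositive.inner_eq_re {T : H →L[ℂ] H} (hT : T.IsPositive) (ψ : H) :
    ⟪ψ, T ψ⟫_ℂ = (((⟪ψ, T ψ⟫_ℂ).re : ℝ) : ℂ) := by
  have h := ((ContinuousLinearMap.isPositive_iff_complex T).mp hT ψ).1
  have h2 : ⟪ψ, T ψ⟫_ℂ = ⟪T ψ, ψ⟫_ℂ := (hT.inner_left_eq_inner_right ψ ψ).symm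
  rw [h2]
  exact h.symm

/-- By complex polarization an operator is determined by its quadratic form. Equality of observables
thus reduces to equality of the measures `Observable.quad`. -/
lemma ContinuousLinearMap.IsPositive.ext_of_ofReal {T S : H →L[ℂ] H} (hT : T.IsPositive)
    (hS : S.IsPositive)
    (h : ∀ ψ, ENNReal.ofReal (⟪ψ, T ψ⟫_ℂ).re = ENNReal.ofReal (⟪ψ, S ψ⟫_ℂ).re) : T = S := by
  have h2 : (T : H →ₗ[ℂ] H) = S := by
    rw [← ext_inner_map]
    intro ψ
    have h3 : (⟪ψ, T ψ⟫_ℂ).re = (⟪ψ, S ψ⟫_ℂ).re := (ENNReal.ofReal_eq_ofReal_iff (hT.re_inner_nonneg_right ψ)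
      (hS.re_inner_nonneg_right ψ)).mp (h ψ)
    change ⟪T ψ, ψ⟫_ℂ = ⟪S ψ, ψ⟫_ℂ
    rw [hT.inner_left_eq_inner_right, hS.inner_left_eq_inner_right, hT.inner_eq_re,
      hS.inner_eq_re, h3]
  exact_mod_cast h2

/-- The image of an observable under a measurable map. -/
noncomputable def Observable.map (G : Observable Ω H) (f : Ω → Ω') (hf : Measurable f) :
    Observable Ω' H where
  toFun X := G (f ⁻¹' X)
  positive X hX := G.positive _ (hf hX)
  normalized := by rw [Set.preimage_univ, G.normalized]
  additive X hX hd φ ψ := by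
    rw [Set.preimage_iUnion]
    exact G.additive _ (fun n => hf (hX n)) (fun i j hij => (hd hij).preimage f) φ ψ

lemma FunctionallyCoexistent.haveJointObservable {E F : Observable ℝ H}
    (h : FunctionallyCoexistent.{u} E F) : HaveJointObservable E F := by
  obtain ⟨Ω, mΩ, G, f₁, f₂, h1, h2, hE, hF⟩ := h
  refine ⟨G.map (fun x => (f₁ x, f₂ x)) (h1.prodMk h2), fun X hX => ?_, fun Y hY => ?_⟩
  · rw [hE X hX]
    change G _ = G _
    congr 1
    ext x
    simp
  · rw [hF Y hY]
    change G _ = G _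
    congr 1
    ext x
    simp

/-- The two coordinates serve as the functions; `ULift` only puts the plane into the required
universe. -/
lemma HaveJointObservable.functionallyCoexistent {E F : Observable ℝ H}
    (h : HaveJointObservable E F) : FunctionallyCoexistent.{u} E F := by
  obtain ⟨G, hE, hF⟩ := h
  refine ⟨ULift.{u} (ℝ × ℝ), inferInstance, G.map ULift.up measurable_up,
    fun z => z.down.1, fun z => z.down.2, measurable_fst.comp measurable_down,
    measurable_snd.comp measurable_down, fun X hX => ?_, fun Y hY => ?_⟩
  · rw [hE X hX]
    change G _ = G _
    congr 1
    ext x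
    simp
  · rw [hF Y hY]
    change G _ = G _
    congr 1
    ext x
    simp

variable (ρ : Measure ℝ) [IsProbabilityMeasure ρ]

lemma quad_positionObservable (ψ : L2R) {X : Set ℝ} (hX : MeasurableSet X) :
    (positionObservable ρ).quad ψ X = ∫⁻ y, ρ ((fun r => r + y) ⁻¹' X) * ‖ψ y‖ₑ ^ 2 := by
  rw [Observable.quad_apply _ _ hX]
  have h0 : ⟪ψ, (positionObservable ρ) X ψ⟫_ℂ
      = ((∫ q, smear ρ X q * ‖ψ q‖ ^ 2 : ℝ) : ℂ) := by
    change ⟪ψ, mulOp (fun q => (smear ρ X q : ℂ)) ψ⟫_ℂ = _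
    rw [inner_mulOp_smear ρ hX, ← integral_complex_ofReal]
    refine integral_congr_ae (.of_forall fun q => ?_)
    simp [inner_self_eq_norm_sq_to_K]
  have hi : Integrable (fun q => smear ρ X q * ‖ψ q‖ ^ 2) := by
    refine (Lp.memLp ψ).integrable_norm_pow (by norm_num) |>.bdd_mul (c := 1)
      (measurable_smear ρ hX).aestronglyMeasurable (.of_forall fun q => ?_)
    rw [Real.norm_of_nonneg (smear_nonneg ρ _ q)]
    exact measureReal_le_one
  rw [h0, Complex.ofReal_re, ofReal_integral_eq_lintegral_ofReal hi
    (.of_forall fun q => mul_nonneg (smear_nonneg ρ X q) (by positivity))]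
  refine lintegral_congr fun q => ?_
  rw [ENNReal.ofReal_mul (smear_nonneg ρ X q), enorm_sq_eq_ofReal, smear_eq]
  congr 1
  exact ofReal_measureReal

lemma quad_conj (E : Observable Ω L2R) (W : L2R ≃ₗᵢ[ℂ] L2R) (ψ : L2R) {X : Set Ω}
    (hX : MeasurableSet X) : (E.conj W).quad ψ X = E.quad (W ψ) X := by
  rw [Observable.quad_apply _ _ hX, Observable.quad_apply _ _ hX]
  congr 2
  change ⟪ψ, W.symm (E X (W ψ))⟫_ℂ = _
  rw [← W.inner_map_map, W.apply_symm_apply]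

lemma quad_momentumObservable (ψ : L2R) {X : Set ℝ} (hX : MeasurableSet X) :
    (momentumObservable ρ).quad ψ X
      = ∫⁻ y, ρ ((fun r => r + y) ⁻¹' X) * ‖fourierPlancherel ψ y‖ₑ ^ 2 := by
  rw [momentumObservable, quad_conj _ _ _ hX, quad_positionObservable _ _ hX]

end Quad

/-! ### Covariant discretization of a joint observable -/

section Discretization

variable {ι : Type*}

/-- A family of operators with square summable Hilbert-Schmidt norms is one operator into the
`ℓ²`-sum. -/
lemma exists_lp_operator (B : ι → L2R →L[ℂ] L2R) (hB : ∑' i, hsSum stdB (B i) = 1) :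
    ∃ D : L2R →L[ℂ] lp (fun _ : ι => L2R) 2, ∀ ψ, ‖D ψ‖ₑ ^ 2 = ∑' i, ‖B i ψ‖ₑ ^ 2 := by
  have hle : ∀ ψ, ∑' i, ‖B i ψ‖ₑ ^ 2 ≤ ‖ψ‖ₑ ^ 2 := by
    intro ψ
    refine (ENNReal.tsum_le_tsum fun i => enorm_apply_sq_le_hsSum stdB (B i) ψ).trans ?_
    rw [ENNReal.tsum_mul_right, hB, one_mul]
  have hsum : ∀ ψ, Summable fun i => ‖B i ψ‖ ^ 2 := by
    intro ψ
    have h1 : ∑' i, ‖B i ψ‖ₑ ^ 2 ≠ ∞ := ne_top_of_le_ne_top (by simp) (hle ψ)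
    simpa using ENNReal.summable_toReal h1
  have hmem : ∀ ψ, Memℓp (fun i => B i ψ) 2 := by
    intro ψ
    rw [memℓp_gen_iff (by norm_num)]
    simpa using hsum ψ
  let L : L2R →ₗ[ℂ] lp (fun _ : ι => L2R) 2 :=
    { toFun := fun ψ => ⟨fun i => B i ψ, hmem ψ⟩
      map_add' := fun φ ψ => by
        ext1
        funext i
        exact (B i).map_add φ ψ
      map_smul' := fun c ψ => by
        ext1
        funext i
        exact (B i).map_smul c ψ }
  have hL : ∀ ψ, ‖L ψ‖ₑ ^ 2 = ∑' i, ‖B i ψ‖ₑ ^ 2 := by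
    intro ψ
    have h1 := lp.norm_rpow_eq_tsum (p := 2) (by norm_num) (L ψ)
    have h2 : ‖L ψ‖ ^ 2 = ∑' i, ‖B i ψ‖ ^ 2 := by simpa [L] using h1
    simp_rw [enorm_sq_eq_ofReal]
    rw [h2, ENNReal.ofReal_tsum_of_nonneg (fun i => by positivity) (hsum ψ)]
  refine ⟨L.mkContinuous 1 fun ψ => ?_, hL⟩
  have h := (hL ψ).trans_le (hle ψ)
  simp_rw [enorm_sq_eq_ofReal] at h
  rw [ENNReal.ofReal_le_ofReal_iff (by positivity)] at h
  rw [one_mul]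
  exact (sq_le_sq₀ (norm_nonneg _) (norm_nonneg _)).mp h

/-- `κ` is the squared modulus of the integral kernel of `K`. -/
def HasKernel (K : L2R →L[ℂ] L2R) (κ : ℝ → ℝ → ℝ≥0∞) : Prop :=
  ∀ X, MeasurableSet X → ∀ w : ℝ → ℝ≥0∞, Measurable w →
    ∑' j, ∫⁻ y, w y * ‖(K (mulOp (X.indicator fun _ => 1) (stdB j)) : L2R) y‖ₑ ^ 2
      = ∫⁻ y, w y * ∫⁻ x, X.indicator 1 x * κ y x

/-- The cell `[aε, (a+1)ε)`. -/
def cell (ε : ℝ) (a : ℤ) : Set ℝ := Set.Ico (a * ε) ((a + 1) * ε)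

lemma measurableSet_cell (ε : ℝ) (a : ℤ) : MeasurableSet (cell ε a) := measurableSet_Ico

lemma mem_cell_iff {ε : ℝ} (hε : 0 < ε) (a : ℤ) (x : ℝ) : x ∈ cell ε a ↔ ⌊x / ε⌋ = a := by
  rw [cell, Set.mem_Ico, Int.floor_eq_iff, le_div_iff₀ hε, div_lt_iff₀ hε]

lemma pairwise_disjoint_cell {ε : ℝ} (hε : 0 < ε) :
    Pairwise (Function.onFun Disjoint (cell ε)) := by
  intro a b hab
  rw [Function.onFun, Set.disjoint_left]
  intro x hx hx'
  rw [mem_cell_iff hε] at hx hx'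
  exact hab (hx.symm.trans hx')

lemma iUnion_cell {ε : ℝ} (hε : 0 < ε) : ⋃ a, cell ε a = Set.univ := by
  ext x
  simp [mem_cell_iff hε]

lemma tsum_measure_cell {Ω : Type*} [MeasurableSpace Ω] (μ : Measure Ω) {ε : ℝ} (hε : 0 < ε)
    {f : Ω → ℝ} (hf : Measurable f) {S : Set Ω} (hS : MeasurableSet S) :
    ∑' a : ℤ, μ (S ∩ f ⁻¹' (cell ε a)) = μ S := by
  rw [← measure_iUnion]
  · rw [← Set.inter_iUnion, ← Set.preimage_iUnion, iUnion_cell hε, Set.preimage_univ,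
      Set.inter_univ]
  · intro a b hab
    exact (((pairwise_disjoint_cell hε) hab).preimage f).mono Set.inter_subset_right
      Set.inter_subset_right
  · exact fun a => hS.inter (hf (measurableSet_cell ε a))

/-- Here `r` is the noise and `y`, `x` are the positions linked by the kernel. In the `a`-th term `r
+ y` is in the `a`-th cell, `x - y ∈ [0, ε]` and `x - aε ∈ X`, which confines `-r` to the
`2ε`-thickening of `X`. Once `r` is confined independently of `a` and `x`, the cells add up to the
whole line and the kernel integrates to one. -/
lemma tsum_lintegral_cell_le (ρ : Measure ℝ) [IsProbabilityMeasure ρ] {ε : ℝ} (hε : 0 < ε)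
    {κ : ℝ → ℝ → ℝ≥0∞} (hκ : Measurable (Function.uncurry κ))
    (hsupp : ∀ y x, κ y x ≠ 0 → x - y ∈ Set.Icc 0 ε) (h1 : ∫⁻ y, ∫⁻ x, κ y x = 1)
    (X : Set ℝ) (hX : MeasurableSet X) :
    ∑' a : ℤ, ∫⁻ y, ρ ((fun r => r + y) ⁻¹' (cell ε a)) *
        ∫⁻ x, ((fun x => x - a * ε) ⁻¹' X).indicator 1 x * κ y x
      ≤ ρ ((fun r => -r) ⁻¹' (Metric.cthickening (2 * ε) X)) := by
  set S := (fun r : ℝ => -r) ⁻¹' (Metric.cthickening (2 * ε) X) with hS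
  have hSm : MeasurableSet S := measurable_neg Metric.isClosed_cthickening.measurableSet
  have hpt : ∀ (a : ℤ) (y x : ℝ), ρ ((fun r => r + y) ⁻¹' (cell ε a)) *
      (((fun x => x - a * ε) ⁻¹' X).indicator 1 x * κ y x)
      ≤ ρ (S ∩ (fun r => r + y) ⁻¹' (cell ε a)) * κ y x := by
    intro a y x
    by_cases hx : x - a * ε ∈ X
    · by_cases hk : κ y x = 0
      · simp [hk]
      have hxy := hsupp y x hk
      have hsub : (fun r => r + y) ⁻¹' (cell ε a) ⊆ S := by
        intro r hr
        simp only [Set.mem_preimage, cell, Set.mem_Ico] at hr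
        refine Metric.mem_cthickening_of_dist_le (-r) (x - a * ε) _ _ hx ?_
        -- `-r - (x - aε) = -(x - y) - ((r + y) - aε)`, and both brackets lie in `[0, ε]`.
        rw [Real.dist_eq, abs_le]
        constructor <;> nlinarith [hxy.1, hxy.2]
      rw [Set.inter_eq_right.mpr hsub]
      gcongr
      refine mul_le_of_le_one_left zero_le ?_
      exact Set.indicator_le_self' (fun _ _ => zero_le) _
    · have : ((fun x => x - a * ε) ⁻¹' X).indicator (1 : ℝ → ℝ≥0∞) x = 0 :=
        Set.indicator_of_notMem (by simpa using hx) _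
      rw [this]
      simp
  have hstep : ∀ a : ℤ, ∫⁻ y, ρ ((fun r => r + y) ⁻¹' (cell ε a)) *
        ∫⁻ x, ((fun x => x - a * ε) ⁻¹' X).indicator 1 x * κ y x
      ≤ ∫⁻ y, ρ (S ∩ (fun r => r + y) ⁻¹' (cell ε a)) * ∫⁻ x, κ y x := by
    intro a
    refine lintegral_mono fun y => ?_
    have hκy : Measurable (κ y) := hκ.comp measurable_prodMk_left
    simp only []
    rw [← lintegral_const_mul _ hκy, ← lintegral_const_mul]
    · exact lintegral_mono fun x => hpt a y x
    · exact (measurable_one.indicator ((measurable_id.sub_const _) hX)).mul hκy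
  refine (ENNReal.tsum_le_tsum hstep).trans ?_
  have hmeas : ∀ a : ℤ, Measurable fun y => ρ (S ∩ (fun r => r + y) ⁻¹' (cell ε a)) := by
    intro a
    have h : MeasurableSet {z : ℝ × ℝ | z.2 ∈ S ∧ z.2 + z.1 ∈ cell ε a} :=
      (measurable_snd hSm).inter ((measurable_snd.add measurable_fst) (measurableSet_cell ε a))
    exact measurable_measure_prodMk_left (ν := ρ) h
  have hI : Measurable fun y => ∫⁻ x, κ y x := hκ.lintegral_prod_right'
  have hprod : ∀ a : ℤ, AEMeasurable (fun y => ρ (S ∩ (fun r => r + y) ⁻¹' (cell ε a)) * ∫⁻ x, κ y x)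
      volume := fun a => ((hmeas a).mul hI).aemeasurable
  rw [← lintegral_tsum hprod]
  simp_rw [ENNReal.tsum_mul_right]
  have : ∀ y : ℝ, ∑' a : ℤ, ρ (S ∩ (fun r => r + y) ⁻¹' (cell ε a)) = ρ S := fun y =>
    tsum_measure_cell ρ hε (measurable_id.add_const y) hSm
  simp_rw [this]
  rw [lintegral_const_mul _ hI, h1, mul_one]

lemma tsum_lintegral_cell_univ (ρ : Measure ℝ) [IsProbabilityMeasure ρ] {ε : ℝ} (hε : 0 < ε)
    {κ : ℝ → ℝ → ℝ≥0∞} (hκ : Measurable (Function.uncurry κ)) (h1 : ∫⁻ y, ∫⁻ x, κ y x = 1) :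
    ∑' a : ℤ, ∫⁻ y, ρ ((fun r => r + y) ⁻¹' (cell ε a)) *
        ∫⁻ x, ((fun x => x - a * ε) ⁻¹' Set.univ).indicator 1 x * κ y x = 1 := by
  simp only [Set.preimage_univ, Set.indicator_univ, Pi.one_apply, one_mul]
  have hmeas : ∀ a : ℤ, Measurable fun y => ρ ((fun r => r + y) ⁻¹' (cell ε a)) := by
    intro a
    have h : MeasurableSet {z : ℝ × ℝ | z.2 + z.1 ∈ cell ε a} :=
      (measurable_snd.add measurable_fst) (measurableSet_cell ε a)
    exact measurable_measure_prodMk_left (ν := ρ) h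
  have hI : Measurable fun y => ∫⁻ x, κ y x := hκ.lintegral_prod_right'
  have hprod : ∀ a : ℤ, AEMeasurable (fun y => ρ ((fun r => r + y) ⁻¹' (cell ε a)) * ∫⁻ x, κ y x)
      volume := fun a => ((hmeas a).mul hI).aemeasurable
  rw [← lintegral_tsum hprod]
  simp_rw [ENNReal.tsum_mul_right]
  have : ∀ y : ℝ, ∑' a : ℤ, ρ ((fun r => r + y) ⁻¹' (cell ε a)) = 1 := fun y => by
    have := tsum_measure_cell ρ hε (measurable_id.add_const y) MeasurableSet.univ
    simpa using this
  simp_rw [this]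
  simpa using h1

/-- The Weyl operator `M_p T_q`. -/
noncomputable def weyl (q p : ℝ) : L2R →L[ℂ] L2R := modul p ∘L transl q

lemma hsSum_comp_weyl {H₁ : Type*} [NormedAddCommGroup H₁] [InnerProductSpace ℂ H₁]
    [CompleteSpace H₁] (A : L2R →L[ℂ] H₁) (q p : ℝ) : hsSum stdB (A ∘L weyl q p) = hsSum stdB A := by
  rw [weyl, ← ContinuousLinearMap.comp_assoc,
    hsSum_comp_of_inverse stdB _ (norm_transl_le q) (norm_transl_le (-q))
      (by rw [transl_comp, add_neg_cancel, transl_zero]),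
    hsSum_comp_of_inverse stdB _ (norm_modul_le p) (norm_modul_le (-p))
      (by rw [modul_comp, add_neg_cancel, modul_zero])]

lemma weyl_comp_indicator {X : Set ℝ} (hX : MeasurableSet X) (q p : ℝ) :
    weyl q p ∘L mulOp (X.indicator fun _ => 1)
      = mulOp (((fun x => x - q) ⁻¹' X).indicator fun _ => 1) ∘L weyl q p := by
  have hX' : MeasurableSet ((fun x => x - q) ⁻¹' X) := (measurable_id.sub_const q) hX
  rw [weyl, ContinuousLinearMap.comp_assoc, transl_comp_mulOp (isContr_indicator hX).memLp,
    ← ContinuousLinearMap.comp_assoc, ← ContinuousLinearMap.comp_assoc]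
  have : (fun x => X.indicator (fun _ => (1 : ℂ)) (x - q))
      = ((fun x => x - q) ⁻¹' X).indicator fun _ => 1 := by
    funext x
    simp only [Set.indicator]
    rfl
  rw [this, modul_comp_mulOp (isContr_indicator hX').memLp]

/-- The projection `F⁻¹ 1_Y(Q) F`. -/
noncomputable def momProj (Y : Set ℝ) : L2R →L[ℂ] L2R :=
  (fourierPlancherel.symm.toContinuousLinearEquiv : L2R →L[ℂ] L2R) ∘L
    mulOp (Y.indicator fun _ => 1) ∘L
    (fourierPlancherel.toContinuousLinearEquiv : L2R →L[ℂ] L2R)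

lemma momProj_apply (Y : Set ℝ) (ψ : L2R) : momProj Y ψ
    = fourierPlancherel.symm (mulOp (Y.indicator fun _ => 1) (fourierPlancherel ψ)) := rfl

lemma fourierPlancherel_weyl (q p : ℝ) (ψ : L2R) :
    fourierPlancherel (weyl q p ψ) = transl p (modul (-q) (fourierPlancherel ψ)) := by
  rw [weyl, ContinuousLinearMap.comp_apply,
    isPlancherel_fourierPlancherel.comp_modul (by norm_num),
    isPlancherel_fourierPlancherel.comp_transl (by norm_num)]
  simp

/-- On the Fourier side the Weyl operator is a translation by `p` after a modulation, and only the
translation moves the set. -/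
lemma weyl_comp_momProj {Y : Set ℝ} (hY : MeasurableSet Y) (q p : ℝ) :
    weyl q p ∘L momProj Y = momProj ((fun x => x - p) ⁻¹' Y) ∘L weyl q p := by
  ext1 ψ
  apply fourierPlancherel.injective
  have h1 : (transl p ∘L modul (-q)) ∘L mulOp (Y.indicator fun _ => 1)
      = mulOp (((fun x => x - p) ⁻¹' Y).indicator fun _ => 1) ∘L (transl p ∘L modul (-q)) := by
    rw [ContinuousLinearMap.comp_assoc, modul_comp_mulOp (isContr_indicator hY).memLp,
      ← ContinuousLinearMap.comp_assoc, transl_comp_mulOp (isContr_indicator hY).memLp]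
    rfl
  rw [ContinuousLinearMap.comp_apply, ContinuousLinearMap.comp_apply, fourierPlancherel_weyl,
    momProj_apply, momProj_apply, LinearIsometryEquiv.apply_symm_apply,
    LinearIsometryEquiv.apply_symm_apply, fourierPlancherel_weyl]
  exact congrArg (fun A : L2R →L[ℂ] L2R => A (fourierPlancherel ψ)) h1

lemma norm_toCLM_le (U : L2R ≃ₗᵢ[ℂ] L2R) :
    ‖(U.toContinuousLinearEquiv : L2R →L[ℂ] L2R)‖ ≤ 1 :=
  U.toLinearIsometry.norm_toContinuousLinearMap_le

lemma norm_momProj_le {Y : Set ℝ} (hY : MeasurableSet Y) : ‖momProj Y‖ ≤ 1 := by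
  refine ContinuousLinearMap.opNorm_le_bound _ zero_le_one fun ψ => ?_
  rw [momProj_apply, LinearIsometryEquiv.norm_map]
  refine ((mulOp _).le_of_opNorm_le (norm_mulOp_le (isContr_indicator hY)) _).trans_eq ?_
  rw [LinearIsometryEquiv.norm_map]

/-- The product of two cells. -/
def cellProd (ε : ℝ) (i : ℤ × ℤ) : Set (ℝ × ℝ) :=
  Prod.fst ⁻¹' cell ε i.1 ∩ Prod.snd ⁻¹' cell ε i.2

lemma measurableSet_cellProd (ε : ℝ) (i : ℤ × ℤ) : MeasurableSet (cellProd ε i) :=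
  (measurable_fst (measurableSet_cell ε i.1)).inter (measurable_snd (measurableSet_cell ε i.2))

/-- The cells with first index `a` partition a vertical strip, so only the first margin of `G`
remains. -/
lemma tsum_quad_position {ρ : Measure ℝ} [IsProbabilityMeasure ρ] {G : Observable (ℝ × ℝ) L2R}
    (hG : ∀ X, MeasurableSet X → positionObservable ρ X = G (X ×ˢ Set.univ))
    {ε : ℝ} (hε : 0 < ε) (a : ℤ) (ψ : L2R) :
    ∑' b : ℤ, G.quad ψ (cellProd ε (a, b))
      = ∫⁻ y, ρ ((fun r => r + y) ⁻¹' cell ε a) * ‖ψ y‖ₑ ^ 2 := by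
  have hm := measurableSet_cell ε a
  refine (tsum_measure_cell (G.quad ψ) hε measurable_snd (measurable_fst hm)).trans ?_
  rw [← quad_positionObservable ρ ψ hm, Observable.quad_apply _ _ hm, hG _ hm,
    Observable.quad_apply _ _ (measurable_fst hm), Set.prod_univ]

lemma tsum_quad_momentum {ν : Measure ℝ} [IsProbabilityMeasure ν] {G : Observable (ℝ × ℝ) L2R}
    (hG : ∀ Y, MeasurableSet Y → momentumObservable ν Y = G (Set.univ ×ˢ Y))
    {ε : ℝ} (hε : 0 < ε) (b : ℤ) (ψ : L2R) :
    ∑' a : ℤ, G.quad ψ (cellProd ε (a, b))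
      = ∫⁻ y, ν ((fun r => r + y) ⁻¹' cell ε b) * ‖fourierPlancherel ψ y‖ₑ ^ 2 := by
  have hm := measurableSet_cell ε b
  have h : ∀ a, cellProd ε (a, b) = Prod.snd ⁻¹' cell ε b ∩ Prod.fst ⁻¹' cell ε a :=
    fun a => Set.inter_comm _ _
  simp_rw [h]
  refine (tsum_measure_cell (G.quad ψ) hε measurable_fst (measurable_snd hm)).trans ?_
  rw [← quad_momentumObservable ν ψ hm, Observable.quad_apply _ _ hm, hG _ hm,
    Observable.quad_apply _ _ (measurable_snd hm), Set.univ_prod]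

lemma measurable_measure_add_preimage (ρ : Measure ℝ) [IsProbabilityMeasure ρ] {X : Set ℝ}
    (hX : MeasurableSet X) : Measurable fun y => ρ ((fun r => r + y) ⁻¹' X) :=
  measurable_measure_prodMk_left (ν := ρ) ((measurable_snd.add measurable_fst) hX)

lemma enorm_sq_eq_quad {G : Observable (ℝ × ℝ) L2R} {Z : Set (ℝ × ℝ)} (hZ : MeasurableSet Z)
    {A : L2R →L[ℂ] L2R} (hA : ContinuousLinearMap.adjoint A ∘L A = G Z) (ψ : L2R) :
    ‖A ψ‖ₑ ^ 2 = G.quad ψ Z := by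
  rw [Observable.quad_apply _ _ hZ, ← hA, inner_adjoint_comp_self, Complex.ofReal_re,
    enorm_sq_eq_ofReal]

/-- Covariance carries `1_X` past the Weyl operator as the indicator of `X + aε`, after which the
unitary drops out. The set no longer involves `b`, so the sum over `b` replaces `G` by its margin
`E_ρ`, a multiplication operator to which the kernel of `K` applies. -/
lemma tsum_hsSum_position {ρ : Measure ℝ} [IsProbabilityMeasure ρ] {G : Observable (ℝ × ℝ) L2R}
    (hG : ∀ X, MeasurableSet X → positionObservable ρ X = G (X ×ˢ Set.univ))
    {ε : ℝ} (hε : 0 < ε) {A : ℤ × ℤ → L2R →L[ℂ] L2R}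
    (hA : ∀ i, ContinuousLinearMap.adjoint (A i) ∘L A i = G (cellProd ε i))
    {K : L2R →L[ℂ] L2R} {κ : ℝ → ℝ → ℝ≥0∞} (hK : HasKernel K κ) {X : Set ℝ}
    (hX : MeasurableSet X) :
    ∑' i : ℤ × ℤ, hsSum stdB
        (((A i ∘L K) ∘L weyl (i.1 * ε) (i.2 * ε)) ∘L mulOp (X.indicator fun _ => 1))
      = ∑' a : ℤ, ∫⁻ y, ρ ((fun r => r + y) ⁻¹' cell ε a) *
          ∫⁻ x, ((fun x => x - a * ε) ⁻¹' X).indicator 1 x * κ y x := by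
  have h1 : ∀ i : ℤ × ℤ, hsSum stdB
        (((A i ∘L K) ∘L weyl (i.1 * ε) (i.2 * ε)) ∘L mulOp (X.indicator fun _ => 1))
      = ∑' j, G.quad (K (mulOp (((fun x => x - i.1 * ε) ⁻¹' X).indicator fun _ => 1) (stdB j)))
          (cellProd ε i) := by
    intro i
    rw [ContinuousLinearMap.comp_assoc, weyl_comp_indicator hX, ← ContinuousLinearMap.comp_assoc,
      hsSum_comp_weyl, hsSum]
    exact tsum_congr fun j => enorm_sq_eq_quad (measurableSet_cellProd ε i) (hA i) _
  simp_rw [h1]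
  rw [ENNReal.tsum_prod']
  refine tsum_congr fun a => ?_
  rw [ENNReal.tsum_comm]
  simp_rw [tsum_quad_position hG hε]
  exact hK _ ((measurable_id.sub_const _) hX) _
    (measurable_measure_add_preimage ρ (measurableSet_cell ε a))

/-- The position argument with the indices exchanged. The Fourier operator left on the right is
unitary and drops out, which is why the kernel of `F K F⁻¹` enters. -/
lemma tsum_hsSum_momentum {ν : Measure ℝ} [IsProbabilityMeasure ν] {G : Observable (ℝ × ℝ) L2R}
    (hG : ∀ Y, MeasurableSet Y → momentumObservable ν Y = G (Set.univ ×ˢ Y))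
    {ε : ℝ} (hε : 0 < ε) {A : ℤ × ℤ → L2R →L[ℂ] L2R}
    (hA : ∀ i, ContinuousLinearMap.adjoint (A i) ∘L A i = G (cellProd ε i))
    {K : L2R →L[ℂ] L2R} {κ : ℝ → ℝ → ℝ≥0∞}
    (hK : HasKernel ((fourierPlancherel.toContinuousLinearEquiv : L2R →L[ℂ] L2R) ∘L K ∘L
      (fourierPlancherel.symm.toContinuousLinearEquiv : L2R →L[ℂ] L2R)) κ) {Y : Set ℝ}
    (hY : MeasurableSet Y) :
    ∑' i : ℤ × ℤ, hsSum stdB (((A i ∘L K) ∘L weyl (i.1 * ε) (i.2 * ε)) ∘L momProj Y)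
      = ∑' b : ℤ, ∫⁻ y, ν ((fun r => r + y) ⁻¹' cell ε b) *
          ∫⁻ x, ((fun x => x - b * ε) ⁻¹' Y).indicator 1 x * κ y x := by
  have h1 : ∀ i : ℤ × ℤ, hsSum stdB (((A i ∘L K) ∘L weyl (i.1 * ε) (i.2 * ε)) ∘L momProj Y)
      = ∑' j, G.quad (K (fourierPlancherel.symm
          (mulOp (((fun x => x - i.2 * ε) ⁻¹' Y).indicator fun _ => 1) (stdB j))))
          (cellProd ε i) := by
    intro i
    rw [ContinuousLinearMap.comp_assoc, weyl_comp_momProj hY, ← ContinuousLinearMap.comp_assoc,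
      hsSum_comp_weyl, momProj, ← ContinuousLinearMap.comp_assoc, ← ContinuousLinearMap.comp_assoc,
      hsSum_comp_of_inverse stdB _ (norm_toCLM_le fourierPlancherel)
        (norm_toCLM_le fourierPlancherel.symm) (by ext1 ψ; simp), hsSum]
    exact tsum_congr fun j => enorm_sq_eq_quad (measurableSet_cellProd ε i) (hA i) _
  simp_rw [h1]
  rw [ENNReal.tsum_prod', ENNReal.tsum_comm]
  refine tsum_congr fun b => ?_
  rw [ENNReal.tsum_comm]
  simp_rw [tsum_quad_momentum hG hε]
  exact hK _ ((measurable_id.sub_const _) hY) _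
    (measurable_measure_add_preimage ν (measurableSet_cell ε b))

end Discretization

/-! ### A Hilbert-Schmidt operator concentrated near the diagonal in position and momentum -/

section Kernel

lemma norm_fourierInt_le (σ : ℝ) (g : ℝ → ℂ) (p : ℝ) :
    ‖fourierInt σ g p‖ ≤ (√(2 * Real.pi))⁻¹ * ∫ x, ‖g x‖ := by
  rw [fourierInt, norm_mul, Complex.norm_real, Real.norm_of_nonneg (by positivity)]
  gcongr
  refine (norm_integral_le_integral_norm _).trans_eq ?_
  refine integral_congr_ae (.of_forall fun x => ?_)
  simp only []
  rw [norm_mul, Complex.norm_exp_ofReal_mul_I, one_mul]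

lemma memLp_top_fourierInt (σ : ℝ) {g : ℝ → ℂ} (hg : Integrable g) :
    MemLp (fourierInt σ g) ∞ volume :=
  memLp_top_of_bound (fourierInt_continuous σ hg).aestronglyMeasurable _
    (.of_forall (norm_fourierInt_le σ g))

/-- A multiple of the characteristic function of `[0, ε]`. -/
noncomputable def box (ε : ℝ) : ℝ → ℂ :=
  (Set.Icc 0 ε).indicator fun _ => ((√(√(2 * Real.pi) / ε) : ℝ) : ℂ)

lemma measurable_box (ε : ℝ) : Measurable (box ε) := measurable_const.indicator measurableSet_Icc

lemma integrable_box (ε : ℝ) : Integrable (box ε) :=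
  (integrable_indicator_iff measurableSet_Icc).mpr (by simp)

lemma memLp_box (ε : ℝ) : MemLp (box ε) 2 :=
  memLp_indicator_const 2 measurableSet_Icc _ (Or.inr (by simp))

/-- The height of the box is chosen for this value, free of `ε`: the kernels below carry two such
factors and one `(2π)⁻¹`, and so have total mass one. -/
lemma lintegral_box {ε : ℝ} (hε : 0 < ε) :
    ∫⁻ x, ‖box ε x‖ₑ ^ 2 = ENNReal.ofReal √(2 * Real.pi) := by
  have h : ∀ x, ‖box ε x‖ₑ ^ 2
      = (Set.Icc 0 ε).indicator (fun _ => ENNReal.ofReal (√(2 * Real.pi) / ε)) x := by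
    intro x
    by_cases hx : x ∈ Set.Icc 0 ε
    · rw [box, Set.indicator_of_mem hx, Set.indicator_of_mem hx, enorm_sq_eq_ofReal,
        Complex.norm_real, Real.norm_of_nonneg (Real.sqrt_nonneg _), Real.sq_sqrt (by positivity)]
    · simp [box, hx]
  simp_rw [h]
  rw [lintegral_indicator measurableSet_Icc, lintegral_const, Measure.restrict_apply_univ,
    Real.volume_Icc, ← ENNReal.ofReal_mul (by positivity), sub_zero, div_mul_cancel₀ _ hε.ne']

/-- The function `box ε` as an element of `L²(ℝ)`. -/
noncomputable def boxLp (ε : ℝ) : L2R := (memLp_box ε).toLp _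

/-- The conjugate of the Fourier integral of `box ε`. -/
noncomputable def boxHat (σ ε : ℝ) (x : ℝ) : ℂ := (starRingEnd ℂ) (fourierInt σ (box ε) x)

lemma memLp_boxHat (σ ε : ℝ) : MemLp (boxHat σ ε) ∞ volume :=
  memLp_top_conj (memLp_top_fourierInt σ (integrable_box ε))

lemma measurable_boxHat (σ ε : ℝ) : Measurable (boxHat σ ε) :=
  (Complex.continuous_conj.comp (fourierInt_continuous σ (integrable_box ε))).measurable

lemma IsPlancherel.boxLp_ae {σ : ℝ} {U : L2R ≃ₗᵢ[ℂ] L2R} (hU : IsPlancherel σ U) (ε : ℝ) :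
    U (boxLp ε) =ᵐ[volume] fun x => (starRingEnd ℂ) (boxHat σ ε x) := by
  filter_upwards [hU _ (integrable_box ε) (memLp_box ε)] with x hx
  rw [boxHat, Complex.conj_conj]
  exact hx

lemma IsPlancherel.lintegral_boxHat {σ : ℝ} {U : L2R ≃ₗᵢ[ℂ] L2R} (hU : IsPlancherel σ U) {ε : ℝ}
    (hε : 0 < ε) : ∫⁻ x, ‖boxHat σ ε x‖ₑ ^ 2 = ENNReal.ofReal √(2 * Real.pi) := by
  have h1 : ∫⁻ x, ‖boxHat σ ε x‖ₑ ^ 2 = ‖U (boxLp ε)‖ₑ ^ 2 := by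
    rw [enorm_sq_eq_lintegral]
    refine lintegral_congr_ae ?_
    filter_upwards [hU.boxLp_ae ε] with x hx
    rw [hx, RCLike.enorm_conj]
  have h2 : ‖U (boxLp ε)‖ₑ = ‖boxLp ε‖ₑ := by
    rw [← ofReal_norm, ← ofReal_norm, U.norm_map]
  rw [h1, h2, enorm_sq_eq_lintegral, ← lintegral_box hε]
  refine lintegral_congr_ae ?_
  filter_upwards [(memLp_box ε).coeFn_toLp] with x hx
  rw [boxLp, hx]

lemma lintegral_boxLp_sub (ε y : ℝ) (f : ℝ → ℝ≥0∞) :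
    ∫⁻ x, f x * ‖boxLp ε (x - y)‖ₑ ^ 2 = ∫⁻ x, f x * ‖box ε (x - y)‖ₑ ^ 2 := by
  refine lintegral_congr_ae ?_
  filter_upwards [ae_sub_right y (memLp_box ε).coeFn_toLp] with x hx
  rw [boxLp, hx]

/-- The operator `m(Q) F⁻¹ n(Q) F`. -/
noncomputable def diagOp (ε : ℝ) : L2R →L[ℂ] L2R :=
  mulOp (boxHat 1 ε) ∘L (fourierPlancherel.symm.toContinuousLinearEquiv : L2R →L[ℂ] L2R) ∘L
    mulOp (boxHat (-1) ε) ∘L (fourierPlancherel.toContinuousLinearEquiv : L2R →L[ℂ] L2R)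

lemma diagOp_apply (ε : ℝ) (ψ : L2R) : diagOp ε ψ = mulOp (boxHat 1 ε)
    (fourierPlancherel.symm (mulOp (boxHat (-1) ε) (fourierPlancherel ψ))) := rfl

/-- The squared kernel of `diagOp ε` in the position representation. -/
noncomputable def posKernel (ε y x : ℝ) : ℝ≥0∞ :=
  ‖boxHat 1 ε y‖ₑ ^ 2 * ENNReal.ofReal (2 * Real.pi)⁻¹ * ‖box ε (x - y)‖ₑ ^ 2

/-- The squared kernel of `diagOp ε` in the momentum representation. -/
noncomputable def momKernel (ε y x : ℝ) : ℝ≥0∞ :=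
  ENNReal.ofReal (2 * Real.pi)⁻¹ * (‖boxHat (-1) ε x‖ₑ ^ 2 * ‖box ε (x - y)‖ₑ ^ 2)

lemma enorm_indicator_one_sq (X : Set ℝ) (x : ℝ) :
    ‖X.indicator (fun _ => (1 : ℂ)) x‖ₑ ^ 2 = X.indicator 1 x := by
  by_cases hx : x ∈ X <;> simp [hx]

lemma isPlancherel_symm : IsPlancherel 1 fourierPlancherel.symm := by
  simpa using isPlancherel_fourierPlancherel.symm

/-- The factor `F⁻¹ n(Q) F` has kernel `(2π)^(-1/2)` times the conjugate of `box ε (x - y)`, and the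
multiplication applied after it contributes its value at `y`. -/
lemma hasKernel_diagOp (ε : ℝ) : HasKernel (diagOp ε) (posKernel ε) := by
  intro X hX w hw
  have h := isPlancherel_fourierPlancherel.tsum_lintegral_conj_mulOp (by norm_num)
    (memLp_boxHat (-1) ε) (isPlancherel_fourierPlancherel.boxLp_ae ε)
    (w := fun y => w y * ‖boxHat 1 ε y‖ₑ ^ 2)
    (hw.mul ((measurable_boxHat 1 ε).enorm.pow_const 2)).aemeasurable
    (isContr_indicator hX).memLp
  have h2 : ∀ j, ∫⁻ y, w y * ‖(diagOp ε (mulOp (X.indicator fun _ => 1) (stdB j)) : L2R) y‖ₑ ^ 2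
      = ∫⁻ y, w y * ‖boxHat 1 ε y‖ₑ ^ 2 * ‖(fourierPlancherel.symm (mulOp (boxHat (-1) ε)
        (fourierPlancherel (mulOp (X.indicator fun _ => 1) (stdB j)))) : L2R) y‖ₑ ^ 2 := by
    intro j
    refine lintegral_congr_ae ?_
    filter_upwards [mulOp_coeFn (memLp_boxHat 1 ε) (fourierPlancherel.symm (mulOp (boxHat (-1) ε)
        (fourierPlancherel (mulOp (X.indicator fun _ => 1) (stdB j)))))] with y hy
    rw [diagOp_apply, hy, enorm_mul, mul_pow, mul_assoc]
  simp_rw [h2]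
  rw [h]
  refine lintegral_congr fun y => ?_
  rw [lintegral_boxLp_sub, mul_assoc, ← mul_assoc (‖_‖ₑ ^ 2),
    ← lintegral_const_mul' _ _ (ENNReal.mul_ne_top (by simp) ENNReal.ofReal_ne_top)]
  congr 1
  refine lintegral_congr fun x => ?_
  rw [enorm_indicator_one_sq, posKernel]
  ring

/-- In the momentum representation the two factors swap roles: `m(Q)` becomes the convolution, again
with the box, and `n` multiplies first, hence is evaluated at `x`. -/
lemma hasKernel_conj_diagOp (ε : ℝ) : HasKernel
    ((fourierPlancherel.toContinuousLinearEquiv : L2R →L[ℂ] L2R) ∘L diagOp ε ∘L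
      (fourierPlancherel.symm.toContinuousLinearEquiv : L2R →L[ℂ] L2R)) (momKernel ε) := by
  intro X hX w hw
  have hd := (memLp_boxHat (-1) ε)
  have hi := (isContr_indicator hX).memLp
  have h := isPlancherel_symm.tsum_lintegral_conj_mulOp (by norm_num)
    (memLp_boxHat 1 ε) (isPlancherel_symm.boxLp_ae ε) (w := w) hw.aemeasurable
    (d := fun x => boxHat (-1) ε x * X.indicator (fun _ => 1) x) (hi.mul hd)
  have h2 : ∀ ψ : L2R, ((fourierPlancherel.toContinuousLinearEquiv : L2R →L[ℂ] L2R) ∘L diagOp ε ∘L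
      (fourierPlancherel.symm.toContinuousLinearEquiv : L2R →L[ℂ] L2R))
        (mulOp (X.indicator fun _ => 1) ψ)
      = fourierPlancherel.symm.symm (mulOp (boxHat 1 ε) (fourierPlancherel.symm
        (mulOp (fun x => boxHat (-1) ε x * X.indicator (fun _ => 1) x) ψ))) := by
    intro ψ
    rw [← mulOp_comp hd hi]
    change fourierPlancherel (diagOp ε (fourierPlancherel.symm _)) = _
    rw [diagOp_apply, fourierPlancherel.apply_symm_apply]
    rfl
  simp_rw [h2]
  rw [h]
  refine lintegral_congr fun y => ?_
  rw [lintegral_boxLp_sub, ← lintegral_const_mul' _ _ ENNReal.ofReal_ne_top]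
  congr 1
  refine lintegral_congr fun x => ?_
  rw [enorm_mul, mul_pow, enorm_indicator_one_sq, momKernel]
  ring

lemma box_support {ε y x : ℝ} (h : box ε (x - y) ≠ 0) : x - y ∈ Set.Icc 0 ε :=
  Set.mem_of_indicator_ne_zero h

lemma measurable_box_sub (ε : ℝ) :
    Measurable fun z : ℝ × ℝ => ‖box ε (z.2 - z.1)‖ₑ ^ 2 :=
  ((measurable_box ε).comp (measurable_snd.sub measurable_fst)).enorm.pow_const 2

lemma measurable_posKernel (ε : ℝ) : Measurable (Function.uncurry (posKernel ε)) :=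
  ((((measurable_boxHat 1 ε).comp measurable_fst).enorm.pow_const 2).mul_const _).mul
    (measurable_box_sub ε)

lemma measurable_momKernel (ε : ℝ) : Measurable (Function.uncurry (momKernel ε)) :=
  ((((measurable_boxHat (-1) ε).comp measurable_snd).enorm.pow_const 2).mul
    (measurable_box_sub ε)).const_mul _

lemma ofReal_sqrt_two_pi_mul :
    ENNReal.ofReal √(2 * Real.pi) * ENNReal.ofReal (2 * Real.pi)⁻¹
      * ENNReal.ofReal √(2 * Real.pi) = 1 := by
  rw [← ENNReal.ofReal_mul (by positivity), ← ENNReal.ofReal_mul (by positivity),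
    mul_right_comm, Real.mul_self_sqrt Real.two_pi_pos.le, mul_inv_cancel₀ Real.two_pi_pos.ne',
    ENNReal.ofReal_one]

lemma lintegral_posKernel {ε : ℝ} (hε : 0 < ε) : ∫⁻ y, ∫⁻ x, posKernel ε y x = 1 := by
  have h : ∀ y, ∫⁻ x, posKernel ε y x
      = ‖boxHat 1 ε y‖ₑ ^ 2 * (ENNReal.ofReal (2 * Real.pi)⁻¹ * ENNReal.ofReal √(2 * Real.pi)) := by
    intro y
    simp only [posKernel]
    rw [lintegral_const_mul' _ _ (ENNReal.mul_ne_top (by simp) ENNReal.ofReal_ne_top),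
      lintegral_sub_right_eq_self (fun x => ‖box ε x‖ₑ ^ 2) y, lintegral_box hε, mul_assoc]
  simp_rw [h]
  rw [lintegral_mul_const' _ _ (ENNReal.mul_ne_top ENNReal.ofReal_ne_top ENNReal.ofReal_ne_top),
    isPlancherel_symm.lintegral_boxHat hε, ← mul_assoc, ofReal_sqrt_two_pi_mul]

lemma lintegral_momKernel {ε : ℝ} (hε : 0 < ε) : ∫⁻ y, ∫⁻ x, momKernel ε y x = 1 := by
  rw [lintegral_lintegral_swap (measurable_momKernel ε).aemeasurable]
  have h : ∀ x, ∫⁻ y, momKernel ε y x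
      = ‖boxHat (-1) ε x‖ₑ ^ 2 * (ENNReal.ofReal (2 * Real.pi)⁻¹ * ENNReal.ofReal √(2 * Real.pi)) := by
    intro x
    simp only [momKernel]
    rw [lintegral_const_mul' _ _ ENNReal.ofReal_ne_top, lintegral_const_mul' _ _ (by simp),
      lintegral_sub_left_eq_self (fun x => ‖box ε x‖ₑ ^ 2) x, lintegral_box hε, mul_left_comm]
  simp_rw [h]
  rw [lintegral_mul_const' _ _ (ENNReal.mul_ne_top ENNReal.ofReal_ne_top ENNReal.ofReal_ne_top),
    isPlancherel_fourierPlancherel.lintegral_boxHat hε, ← mul_assoc, ofReal_sqrt_two_pi_mul]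

/-- Approximate states: the squares of the operators `D` are states whose position and momentum
distributions are those of `-ρ` and `-ν` up to `2ε`. -/
theorem exists_approx {ρ ν : Measure ℝ} [IsProbabilityMeasure ρ] [IsProbabilityMeasure ν]
    (h : HaveJointObservable (positionObservable ρ) (momentumObservable ν)) {ε : ℝ} (hε : 0 < ε) :
    ∃ D : L2R →L[ℂ] lp (fun _ : ℤ × ℤ => L2R) 2, hsSum stdB D = 1 ∧
      (∀ X, MeasurableSet X → hsSum stdB (D ∘L mulOp (X.indicator fun _ => 1))
        ≤ ρ ((fun r => -r) ⁻¹' Metric.cthickening (2 * ε) X)) ∧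
      (∀ Y, MeasurableSet Y → hsSum stdB (D ∘L momProj Y)
        ≤ ν ((fun r => -r) ⁻¹' Metric.cthickening (2 * ε) Y)) := by
  obtain ⟨G, hρ, hν⟩ := h
  choose A hA using fun i =>
    (G.positive (cellProd ε i) (measurableSet_cellProd ε i)).exists_adjoint_comp_self
  have hpos := fun X hX => tsum_hsSum_position (X := X) hρ hε hA (hasKernel_diagOp ε) hX
  have hmom := fun Y hY => tsum_hsSum_momentum (Y := Y) hν hε hA (hasKernel_conj_diagOp ε) hY
  -- The sum of `B i* B i` is the approximate state `∑ W* K* G(C_i) K W`; collecting the `B i` in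
  -- one operator `D` writes it as `D* D`.
  set B := fun i : ℤ × ℤ => (A i ∘L diagOp ε) ∘L weyl (i.1 * ε) (i.2 * ε) with hBdef
  have hB : ∑' i, hsSum stdB (B i) = 1 := by
    have := hpos Set.univ MeasurableSet.univ
    rw [tsum_lintegral_cell_univ ρ hε (measurable_posKernel ε) (lintegral_posKernel hε)] at this
    simpa [mulOp_one, hBdef] using this
  obtain ⟨D, hD⟩ := exists_lp_operator B hB
  have hDM : ∀ M : L2R →L[ℂ] L2R, hsSum stdB (D ∘L M) = ∑' i, hsSum stdB (B i ∘L M) := by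
    intro M
    simp only [hsSum, ContinuousLinearMap.comp_apply, hD]
    exact ENNReal.tsum_comm
  refine ⟨D, ?_, fun X hX => ?_, fun Y hY => ?_⟩
  · have := hDM (ContinuousLinearMap.id ℂ L2R)
    simpa [hB] using this
  · rw [hDM, hpos X hX]
    refine tsum_lintegral_cell_le ρ hε (measurable_posKernel ε) (fun y x hk => ?_)
      (lintegral_posKernel hε) X hX
    exact box_support fun h0 => hk (by simp [posKernel, h0])
  · rw [hDM, hmom Y hY]
    refine tsum_lintegral_cell_le ν hε (measurable_momKernel ε) (fun y x hk => ?_)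
      (lintegral_momKernel hε) Y hY
    exact box_support fun h0 => hk (by simp [momKernel, h0])

end Kernel

/-! ### Passing to the limit -/

section Limit

set_option linter.unusedSectionVars false

open Filter Topology

variable {H₁ : Type*} [NormedAddCommGroup H₁] [InnerProductSpace ℂ H₁] [CompleteSpace H₁]

/-- Contractions `D n` have a limit of `D n* D n` along an ultrafilter in the weak topology. -/
lemma exists_weak_limit (D : ℕ → L2R →L[ℂ] H₁) (hD : ∀ n ψ, ‖D n ψ‖ ≤ ‖ψ‖) (l : Ultrafilter ℕ) :
    ∃ A : L2R →L[ℂ] L2R, ∀ ψ, Tendsto (fun n => ‖D n ψ‖ ^ 2) l (𝓝 (‖A ψ‖ ^ 2)) := by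
  have hbd : ∀ φ ψ n, ⟪D n φ, D n ψ⟫_ℂ ∈ Metric.closedBall (0 : ℂ) (‖φ‖ * ‖ψ‖) := by
    intro φ ψ n
    rw [mem_closedBall_zero_iff]
    refine (norm_inner_le_norm _ _).trans ?_
    gcongr <;> exact hD n _
  -- The forms `⟨D n φ, D n ψ⟩` stay in a compact disc, so they converge along the ultrafilter to a
  -- bounded sesquilinear form, which defines an operator.
  have hlim : ∀ φ ψ, ∃ c ∈ Metric.closedBall (0 : ℂ) (‖φ‖ * ‖ψ‖),
      Tendsto (fun n => ⟪D n φ, D n ψ⟫_ℂ) l (𝓝 c) := by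
    intro φ ψ
    obtain ⟨c, hc, h⟩ := (isCompact_closedBall (0 : ℂ) (‖φ‖ * ‖ψ‖)).ultrafilter_le_nhds
      (l.map fun n => ⟪D n φ, D n ψ⟫_ℂ) (le_principal_iff.mpr
        (Filter.mem_map.mpr (univ_mem' fun n => hbd φ ψ n)))
    exact ⟨c, hc, h⟩
  choose t htb ht using hlim
  have hadd₁ : ∀ φ φ' ψ, t (φ + φ') ψ = t φ ψ + t φ' ψ := fun φ φ' ψ =>
    tendsto_nhds_unique (ht (φ + φ') ψ)
      (((ht φ ψ).add (ht φ' ψ)).congr fun n => by rw [map_add, inner_add_left])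
  have hadd₂ : ∀ φ ψ ψ', t φ (ψ + ψ') = t φ ψ + t φ ψ' := fun φ ψ ψ' =>
    tendsto_nhds_unique (ht φ (ψ + ψ'))
      (((ht φ ψ).add (ht φ ψ')).congr fun n => by rw [map_add, inner_add_right])
  have hsmul₁ : ∀ (c : ℂ) φ ψ, t (c • φ) ψ = (starRingEnd ℂ) c * t φ ψ := fun c φ ψ =>
    tendsto_nhds_unique (ht (c • φ) ψ)
      (((ht φ ψ).const_mul ((starRingEnd ℂ) c)).congr fun n => by rw [map_smul, inner_smul_left])
  have hsmul₂ : ∀ (c : ℂ) φ ψ, t φ (c • ψ) = c * t φ ψ := fun c φ ψ =>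
    tendsto_nhds_unique (ht φ (c • ψ))
      (((ht φ ψ).const_mul c).congr fun n => by rw [map_smul, inner_smul_right])
  let f : L2R →L⋆[ℂ] L2R →L[ℂ] ℂ := LinearMap.mkContinuous₂
    (LinearMap.mk₂'ₛₗ (starRingEnd ℂ) (RingHom.id ℂ) t hadd₁ hsmul₁ hadd₂ hsmul₂) 1
    (fun φ ψ => by simpa using htb φ ψ)
  -- The representing operator of a form acts in the first slot of the inner product; the adjoint
  -- moves it to the second.
  let T : L2R →L[ℂ] L2R := ContinuousLinearMap.adjoint (InnerProductSpace.continuousLinearMapOfBilin f)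
  have hT : ∀ φ ψ, ⟪φ, T ψ⟫_ℂ = t φ ψ := by
    intro φ ψ
    rw [ContinuousLinearMap.adjoint_inner_right, InnerProductSpace.continuousLinearMapOfBilin_apply]
    rfl
  have hre : ∀ ψ, Tendsto (fun n => ((‖D n ψ‖ ^ 2 : ℝ) : ℂ)) l (𝓝 ⟪ψ, T ψ⟫_ℂ) := by
    intro ψ
    rw [hT]
    refine (ht ψ ψ).congr fun n => ?_
    rw [inner_self_eq_norm_sq_to_K]
    simp
  have hre' : ∀ ψ, Tendsto (fun n => ‖D n ψ‖ ^ 2) l (𝓝 (⟪ψ, T ψ⟫_ℂ).re) := fun ψ =>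
    (Complex.continuous_re.tendsto _).comp (hre ψ)
  have him : ∀ ψ, ⟪ψ, T ψ⟫_ℂ = (((⟪ψ, T ψ⟫_ℂ).re : ℝ) : ℂ) := fun ψ =>
    tendsto_nhds_unique (hre ψ) ((Complex.continuous_ofReal.tendsto _).comp (hre' ψ))
  have hpos : T.IsPositive := by
    rw [ContinuousLinearMap.isPositive_iff_complex]
    intro ψ
    have h1 : ⟪T ψ, ψ⟫_ℂ = (((⟪ψ, T ψ⟫_ℂ).re : ℝ) : ℂ) := by
      rw [← inner_conj_symm, him ψ, Complex.conj_ofReal, Complex.ofReal_re]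
    rw [h1]
    refine ⟨by simp, ?_⟩
    simp only [RCLike.re_to_complex, Complex.ofReal_re]
    exact ge_of_tendsto' (hre' ψ) fun n => by positivity
  obtain ⟨A, hA⟩ := hpos.exists_adjoint_comp_self
  refine ⟨A, fun ψ => ?_⟩
  have := hre' ψ
  rwa [← hA, inner_adjoint_comp_self, Complex.ofReal_re] at this

variable {D : ℕ → L2R →L[ℂ] H₁} {A : L2R →L[ℂ] L2R} {l : Ultrafilter ℕ}

/-- Fatou's lemma for series: finite partial sums converge, while mass may still escape in the
limit. -/
lemma hsSum_comp_le_of_tendsto (hA : ∀ ψ, Tendsto (fun n => ‖D n ψ‖ ^ 2) l (𝓝 (‖A ψ‖ ^ 2)))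
    (M : L2R →L[ℂ] L2R) {f : ℕ → ℝ≥0∞} {c : ℝ≥0∞} (hf : Tendsto f l (𝓝 c))
    (h : ∀ n, hsSum stdB (D n ∘L M) ≤ f n) : hsSum stdB (A ∘L M) ≤ c := by
  rw [hsSum, ENNReal.tsum_eq_iSup_sum]
  refine iSup_le fun s => ?_
  have h1 : Tendsto (fun n => ∑ j ∈ s, ‖(D n ∘L M) (stdB j)‖ₑ ^ 2) l
      (𝓝 (∑ j ∈ s, ‖(A ∘L M) (stdB j)‖ₑ ^ 2)) := by
    refine tendsto_finsetSum _ fun j _ => ?_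
    simp_rw [enorm_sq_eq_ofReal]
    exact ENNReal.tendsto_ofReal (hA _)
  exact le_of_tendsto_of_tendsto' h1 hf fun n => (ENNReal.sum_le_tsum s).trans (h n)

/-- For Hilbert-Schmidt `M` the terms are dominated by the summable `‖M (stdB j)‖²`, so no mass
escapes after cutting off with `M`. -/
lemma le_hsSum_comp_of_tendsto (hA : ∀ ψ, Tendsto (fun n => ‖D n ψ‖ ^ 2) l (𝓝 (‖A ψ‖ ^ 2)))
    (hD : ∀ n ψ, ‖D n ψ‖ ≤ ‖ψ‖) {M : L2R →L[ℂ] L2R} (hM : hsSum stdB M ≠ ∞) :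
    Tendsto (fun n => hsSum stdB (D n ∘L M)) l (𝓝 (hsSum stdB (A ∘L M))) := by
  have hMs : Summable fun j => ‖M (stdB j)‖ ^ 2 := by
    simpa using ENNReal.summable_toReal hM
  have hle : ∀ n j, ‖D n (M (stdB j))‖ ^ 2 ≤ ‖M (stdB j)‖ ^ 2 := fun n j => by
    gcongr; exact hD n _
  have hle' : ∀ j, ‖A (M (stdB j))‖ ^ 2 ≤ ‖M (stdB j)‖ ^ 2 := fun j =>
    le_of_tendsto' (hA _) fun n => hle n j
  have h := tendsto_tsum_of_dominated_convergence hMs (fun j => hA (M (stdB j)))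
    (Eventually.of_forall fun n j => by
      rw [Real.norm_of_nonneg (by positivity)]; exact hle n j)
  have e1 : ∀ n, hsSum stdB (D n ∘L M) = ENNReal.ofReal (∑' j, ‖D n (M (stdB j))‖ ^ 2) := by
    intro n
    rw [hsSum, ENNReal.ofReal_tsum_of_nonneg (fun j => by positivity)
      (hMs.of_nonneg_of_le (fun j => by positivity) (hle n))]
    simp_rw [enorm_sq_eq_ofReal]
    rfl
  have e2 : hsSum stdB (A ∘L M) = ENNReal.ofReal (∑' j, ‖A (M (stdB j))‖ ^ 2) := by
    rw [hsSum, ENNReal.ofReal_tsum_of_nonneg (fun j => by positivity)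
      (hMs.of_nonneg_of_le (fun j => by positivity) hle')]
    simp_rw [enorm_sq_eq_ofReal]
    rfl
  simp_rw [e1, e2]
  exact ENNReal.tendsto_ofReal h

lemma mulOp_indicator_apply_add {X : Set ℝ} (hX : MeasurableSet X) :
    mulOp (X.indicator fun _ => 1) + mulOp (Xᶜ.indicator fun _ => 1)
      = ContinuousLinearMap.id ℂ L2R := by
  rw [mulOp_add (isContr_indicator hX).memLp (isContr_indicator hX.compl).memLp, ← mulOp_one]
  congr 1
  funext x
  by_cases hx : x ∈ X <;> simp [hx]

lemma momProj_add_compl {Y : Set ℝ} (hY : MeasurableSet Y) :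
    momProj Y + momProj Yᶜ = ContinuousLinearMap.id ℂ L2R := by
  ext1 ψ
  have h := congrArg (fun B : L2R →L[ℂ] L2R => fourierPlancherel.symm (B (fourierPlancherel ψ)))
    (mulOp_indicator_apply_add hY)
  simpa [momProj_apply] using h

/-- Bounded sets in position and momentum give a Hilbert-Schmidt operator. -/
lemma hsSum_indicator_comp_momProj_ne_top {X Y : Set ℝ} (hX : MeasurableSet X)
    (hY : MeasurableSet Y) (hXf : volume X ≠ ∞) (hYf : volume Y ≠ ∞) :
    hsSum stdB (mulOp (X.indicator fun _ => 1) ∘L momProj Y) ≠ ∞ := by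
  have hm : MemLp (Y.indicator fun _ => (1 : ℂ)) 2 :=
    memLp_indicator_const 2 hY _ (Or.inr hYf)
  set η := fourierPlancherel.symm (hm.toLp _) with hη
  have hη' : fourierPlancherel η =ᵐ[volume]
      fun x => (starRingEnd ℂ) (Y.indicator (fun _ => (1 : ℂ)) x) := by
    rw [hη, fourierPlancherel.apply_symm_apply]
    filter_upwards [hm.coeFn_toLp] with x hx
    rw [hx]
    by_cases hxY : x ∈ Y <;> simp [hxY]
  have h := isPlancherel_fourierPlancherel.tsum_lintegral_conj_mulOp (by norm_num)
    (isContr_indicator hY).memLp hη' (w := X.indicator 1)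
    (measurable_one.indicator hX).aemeasurable (d := fun _ => 1) (memLp_top_const 1)
  have h2 : hsSum stdB (mulOp (X.indicator fun _ => 1) ∘L momProj Y)
      = ∑' j, ∫⁻ y, X.indicator 1 y * ‖(fourierPlancherel.symm (mulOp (Y.indicator fun _ => 1)
        (fourierPlancherel (mulOp (fun _ => 1) (stdB j)))) : L2R) y‖ₑ ^ 2 := by
    rw [hsSum]
    refine tsum_congr fun j => ?_
    rw [ContinuousLinearMap.comp_apply, enorm_mulOp_sq (isContr_indicator hX).memLp, mulOp_one]
    simp_rw [enorm_indicator_one_sq, momProj_apply]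
    rfl
  have h3 : ∀ y, ∫⁻ x, ‖(1 : ℂ)‖ₑ ^ 2 * ‖η (x - y)‖ₑ ^ 2 = ‖η‖ₑ ^ 2 := by
    intro y
    simp only [enorm_one, one_pow, one_mul]
    rw [lintegral_sub_right_eq_self (fun x => ‖η x‖ₑ ^ 2) y, enorm_sq_eq_lintegral]
  rw [h2, h]
  simp_rw [h3]
  rw [lintegral_mul_const _ (measurable_one.indicator hX), lintegral_indicator_one hX]
  exact ENNReal.mul_ne_top hXf (ENNReal.mul_ne_top ENNReal.ofReal_ne_top (by simp))

lemma tendsto_measure_tail (μ : Measure ℝ) [IsFiniteMeasure μ] :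
    Tendsto (fun R : ℕ => μ {x | (R : ℝ) - 2 ≤ |x|}) atTop (𝓝 0) := by
  have h : (⋂ R : ℕ, {x : ℝ | (R : ℝ) - 2 ≤ |x|}) = ∅ := by
    ext x
    simp only [Set.mem_iInter, Set.mem_ofPred_eq, Set.mem_empty_iff_false, iff_false, not_forall,
      not_le]
    obtain ⟨n, hn⟩ := exists_nat_gt (|x| + 2)
    exact ⟨n, by linarith⟩
  have := tendsto_measure_iInter_atTop (μ := μ) (s := fun R : ℕ => {x : ℝ | (R : ℝ) - 2 ≤ |x|})
    (fun R => (measurableSet_le measurable_const measurable_abs).nullMeasurableSet)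
    (fun m n hmn x hx => by
      have : (m : ℝ) ≤ n := by exact_mod_cast hmn
      simp only [Set.mem_ofPred_eq] at hx ⊢
      linarith)
    ⟨0, measure_ne_top _ _⟩
  rwa [h, measure_empty] at this

/-- Since `2ε ≤ 2`, the bound does not involve `ε`; the tails are thus small uniformly along the
sequence. -/
lemma measure_cthickening_tail_le (μ : Measure ℝ) {ε : ℝ} (hε : ε ≤ 1) (R : ℕ) :
    μ ((fun r => -r) ⁻¹' Metric.cthickening (2 * ε) (Set.Icc (-(R : ℝ)) R)ᶜ)
      ≤ μ {x | (R : ℝ) - 2 ≤ |x|} := by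
  refine measure_mono ?_
  have hsub : Metric.cthickening (2 * ε) (Set.Icc (-(R : ℝ)) R)ᶜ ⊆ {x : ℝ | (R : ℝ) - 2 ≤ |x|} := by
    have hcl : IsClosed {x : ℝ | (R : ℝ) - 2 ≤ |x|} := isClosed_le continuous_const continuous_abs
    intro x hx
    by_contra hcon
    simp only [Set.mem_ofPred_eq, not_le] at hcon
    rw [Metric.mem_cthickening_iff] at hx
    have hlt : Metric.infEDist x (Set.Icc (-(R : ℝ)) R)ᶜ < ENNReal.ofReal (R - |x|) := by
      refine hx.trans_lt ((ENNReal.ofReal_lt_ofReal_iff (by linarith)).mpr (by linarith))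
    obtain ⟨z, hz, hzx⟩ := Metric.infEDist_lt_iff.mp hlt
    rw [edist_dist, ENNReal.ofReal_lt_ofReal_iff (by linarith), Real.dist_eq] at hzx
    apply hz
    rw [Set.mem_Icc, ← abs_le]
    have := abs_sub_abs_le_abs_sub z x
    rw [abs_sub_comm] at this
    linarith
  intro r hr
  have := hsub hr
  simpa using this

/-- What the double cutoff loses is `B Π_{Yᶜ} + B 1_{Xᶜ} Π_Y`: a momentum tail plus a position tail.
The factor `2` is Young's inequality at `t = 1`. -/
lemma hsSum_sub_le (B : L2R →L[ℂ] H₁) {X Y : Set ℝ} (hX : MeasurableSet X) (hY : MeasurableSet Y) :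
    hsSum stdB (B - B ∘L mulOp (X.indicator fun _ => 1) ∘L momProj Y)
      ≤ ENNReal.ofReal 2 * (hsSum stdB (B ∘L momProj Yᶜ)
        + hsSum stdB (B ∘L mulOp (Xᶜ.indicator fun _ => 1))) := by
  have h : B - B ∘L mulOp (X.indicator fun _ => 1) ∘L momProj Y
      = B ∘L momProj Yᶜ + (B ∘L mulOp (Xᶜ.indicator fun _ => 1)) ∘L momProj Y := by
    have h1 := eq_sub_of_add_eq' (momProj_add_compl hY)
    have h2 := eq_sub_of_add_eq' (mulOp_indicator_apply_add hX)
    rw [h1, h2]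
    ext1 ψ
    simp
  rw [h]
  refine (hsSum_add_le stdB _ _ one_pos).trans ?_
  rw [mul_add, inv_one, one_add_one_eq_two]
  gcongr
  exact hsSum_comp_le_of_norm_le_one stdB _ (norm_momProj_le hY)

lemma tendsto_two_mul_inv_succ :
    Tendsto (fun n : ℕ => 2 * (1 / ((n : ℝ) + 1))) atTop (𝓝 0) := by
  simpa using tendsto_one_div_add_atTop_nhds_zero_nat.const_mul (2 : ℝ)

/-- The limit state: its position and momentum distributions are dominated on closed sets. -/
theorem exists_limit_operator {ρ ν : Measure ℝ} [IsProbabilityMeasure ρ] [IsProbabilityMeasure ν]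
    (h : HaveJointObservable (positionObservable ρ) (momentumObservable ν)) :
    ∃ A : L2R →L[ℂ] L2R, hsSum stdB A = 1 ∧
      (∀ X, IsClosed X → hsSum stdB (A ∘L mulOp (X.indicator fun _ => 1))
        ≤ ρ ((fun r => -r) ⁻¹' X)) ∧
      (∀ Y, IsClosed Y → hsSum stdB (A ∘L momProj Y) ≤ ν ((fun r => -r) ⁻¹' Y)) := by
  have hε : ∀ n : ℕ, (0 : ℝ) < 1 / ((n : ℝ) + 1) := fun n => by positivity
  have hε1 : ∀ n : ℕ, 1 / ((n : ℝ) + 1) ≤ 1 := fun n => by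
    rw [div_le_one (by positivity)]
    simp
  choose D hD1 hDρ hDν using fun n => exists_approx h (hε n)
  have hDle : ∀ n ψ, ‖D n ψ‖ ≤ ‖ψ‖ := by
    intro n ψ
    have h1 := opNorm_le_sqrt_hsSum stdB (D n) (by simp [hD1])
    simp only [hD1, ENNReal.toReal_one, Real.sqrt_one] at h1
    simpa using (D n).le_of_opNorm_le h1 ψ
  obtain ⟨A, hA⟩ := exists_weak_limit D hDle (hyperfilter ℕ)
  have hl : (↑(hyperfilter ℕ) : Filter ℕ) ≤ atTop := Nat.hyperfilter_le_atTop
  have hclosed : ∀ (μ : Measure ℝ) [IsProbabilityMeasure μ] (X : Set ℝ), IsClosed X →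
      Tendsto (fun n : ℕ => μ ((fun r => -r) ⁻¹' Metric.cthickening (2 * (1 / ((n : ℝ) + 1))) X))
        (hyperfilter ℕ) (𝓝 (μ ((fun r => -r) ⁻¹' X))) := by
    intro μ _ X hX
    have h1 : ∀ S : Set ℝ, MeasurableSet S →
        μ ((fun r => -r) ⁻¹' S) = μ.map (fun r => -r) S := fun S hS =>
      (Measure.map_apply measurable_neg hS).symm
    simp_rw [fun n : ℕ => h1 _ (Metric.isClosed_cthickening
      (δ := 2 * (1 / ((n : ℝ) + 1))) (E := X)).measurableSet, h1 X hX.measurableSet]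
    have : IsFiniteMeasure (μ.map (fun r => -r)) := Measure.isFiniteMeasure_map _ _
    exact ((tendsto_measure_cthickening_of_isClosed ⟨1, one_pos, measure_ne_top _ _⟩ hX).comp
      tendsto_two_mul_inv_succ).mono_left hl
  refine ⟨A, le_antisymm ?_ ?_, fun X hX => ?_, fun Y hY => ?_⟩
  · have := hsSum_comp_le_of_tendsto hA (ContinuousLinearMap.id ℂ L2R)
      (f := fun _ => 1) tendsto_const_nhds (fun n => by simp [hD1])
    simpa using this
  -- For trace at least one, split `D n` by a phase space cutoff of size `R`; `τ R` bounds the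
  -- squared Hilbert-Schmidt norm of the discarded part for all `n`. The limits are taken in the
  -- order `n` along the ultrafilter, `R → ∞`, `t → 0`.
  · set τ : ℕ → ℝ≥0∞ := fun R => ENNReal.ofReal 2 *
      (ν {x | (R : ℝ) - 2 ≤ |x|} + ρ {x | (R : ℝ) - 2 ≤ |x|}) with hτ
    have hτ0 : Tendsto τ atTop (𝓝 0) := by
      have := ENNReal.Tendsto.const_mul (a := ENNReal.ofReal 2)
        ((tendsto_measure_tail ν).add (tendsto_measure_tail ρ)) (Or.inr ENNReal.ofReal_ne_top)
      rwa [add_zero, mul_zero] at this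
    have hI : ∀ R : ℕ, MeasurableSet (Set.Icc (-(R : ℝ)) R) := fun R => measurableSet_Icc
    have hstep : ∀ (t : ℝ), 0 < t → ∀ R : ℕ,
        1 ≤ ENNReal.ofReal (1 + t) * hsSum stdB A + ENNReal.ofReal (1 + t⁻¹) * τ R := by
      intro t ht R
      set M := mulOp ((Set.Icc (-(R : ℝ)) R).indicator fun _ => 1) ∘L
        momProj (Set.Icc (-(R : ℝ)) R) with hM
      have hMtop : hsSum stdB M ≠ ∞ :=
        hsSum_indicator_comp_momProj_ne_top (hI R) (hI R) (by simp) (by simp)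
      have hn : ∀ n, 1 ≤ ENNReal.ofReal (1 + t) * hsSum stdB (D n ∘L M)
          + ENNReal.ofReal (1 + t⁻¹) * τ R := by
        intro n
        have h1 := hsSum_add_le stdB (D n ∘L M) (D n - D n ∘L M) ht
        rw [add_sub_cancel, hD1] at h1
        refine h1.trans ?_
        gcongr
        refine (hsSum_sub_le (D n) (hI R) (hI R)).trans ?_
        change _ ≤ ENNReal.ofReal 2 * (ν _ + ρ _)
        gcongr
        · exact (hDν n _ (hI R).compl).trans (measure_cthickening_tail_le ν (hε1 n) R)
        · exact (hDρ n _ (hI R).compl).trans (measure_cthickening_tail_le ρ (hε1 n) R)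
      have hlim := (ENNReal.Tendsto.const_mul (a := ENNReal.ofReal (1 + t))
        (le_hsSum_comp_of_tendsto hA hDle hMtop) (Or.inr ENNReal.ofReal_ne_top)).add_const
        (ENNReal.ofReal (1 + t⁻¹) * τ R)
      refine (ge_of_tendsto' hlim hn).trans ?_
      gcongr
      refine hsSum_comp_le_of_norm_le_one stdB A ?_
      refine (ContinuousLinearMap.opNorm_comp_le _ _).trans ?_
      exact mul_le_one₀ (norm_mulOp_le (isContr_indicator (hI R))) (norm_nonneg _)
        (norm_momProj_le (hI R))
    have hstep2 : ∀ t : ℝ, 0 < t → 1 ≤ ENNReal.ofReal (1 + t) * hsSum stdB A := by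
      intro t ht
      have hlim := (ENNReal.Tendsto.const_mul (a := ENNReal.ofReal (1 + t⁻¹)) hτ0
        (Or.inr ENNReal.ofReal_ne_top)).const_add (ENNReal.ofReal (1 + t) * hsSum stdB A)
      rw [mul_zero, add_zero] at hlim
      exact ge_of_tendsto' hlim (hstep t ht)
    have h0 : Tendsto (fun n : ℕ => ENNReal.ofReal (1 + 1 / ((n : ℝ) + 1)) * hsSum stdB A) atTop
        (𝓝 (ENNReal.ofReal 1 * hsSum stdB A)) := by
      refine ENNReal.Tendsto.mul_const ?_ (Or.inl (by simp))
      refine ENNReal.tendsto_ofReal ?_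
      simpa using tendsto_one_div_add_atTop_nhds_zero_nat.const_add (1 : ℝ)
    rw [ENNReal.ofReal_one, one_mul] at h0
    exact ge_of_tendsto' h0 fun n => hstep2 _ (hε n)
  · exact hsSum_comp_le_of_tendsto hA _ (hclosed ρ X hX) fun n => hDρ n X hX.measurableSet
  · exact hsSum_comp_le_of_tendsto hA _ (hclosed ν Y hY) fun n => hDν n Y hY.measurableSet

/-- Both sides are the trace of `M* A* A M`; the right one expands `A* A` spectrally and sums over
the basis by Parseval. -/
lemma IsSpectralDecomposition.hsSum_comp {A : L2R →L[ℂ] H₁} {lam : ℕ → ℝ} {φ : ℕ → L2R}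
    (h : IsSpectralDecomposition (ContinuousLinearMap.adjoint A ∘L A) lam φ)
    (M : L2R →L[ℂ] L2R) : hsSum stdB (A ∘L M)
      = ∑' i, ENNReal.ofReal (lam i) * ‖ContinuousLinearMap.adjoint M (φ i)‖ₑ ^ 2 := by
  have hA : ∀ ψ, ‖A ψ‖ₑ ^ 2 = ∑' i, ENNReal.ofReal (lam i) * ‖⟪φ i, ψ⟫_ℂ‖ₑ ^ 2 := by
    intro ψ
    have h1 := (h.hasSum_apply ψ).mapL (innerSL ℂ ψ)
    have h2 : (fun i => innerSL ℂ ψ (((lam i : ℂ) * ⟪φ i, ψ⟫_ℂ) • φ i))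
        = fun i => ((lam i * ‖⟪φ i, ψ⟫_ℂ‖ ^ 2 : ℝ) : ℂ) := by
      funext i
      rw [innerSL_apply_apply, inner_smul_right, mul_assoc, ← inner_conj_symm ψ, Complex.mul_conj,
        Complex.normSq_eq_norm_sq]
      push_cast
      rfl
    rw [h2, innerSL_apply_apply, inner_adjoint_comp_self] at h1
    have h3 := Complex.hasSum_ofReal.mp h1
    rw [enorm_sq_eq_ofReal, ← h3.tsum_eq, ENNReal.ofReal_tsum_of_nonneg
      (fun i => mul_nonneg (h.nonneg i) (by positivity)) h3.summable]
    refine tsum_congr fun i => ?_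
    rw [ENNReal.ofReal_mul (h.nonneg i), enorm_sq_eq_ofReal]
  rw [hsSum]
  simp only [ContinuousLinearMap.comp_apply, hA]
  rw [ENNReal.tsum_comm]
  refine tsum_congr fun i => ?_
  rw [ENNReal.tsum_mul_left]
  congr 1
  rw [← stdB.tsum_enorm_inner_sq']
  refine tsum_congr fun j => ?_
  rw [ContinuousLinearMap.adjoint_inner_left]

lemma measurable_density (lam : ℕ → ℝ) (φ : ℕ → L2R) :
    Measurable fun x => ∑' i, ENNReal.ofReal (lam i) * ‖φ i x‖ₑ ^ 2 :=
  Measurable.tsum fun i =>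
    ((Lp.stronglyMeasurable (φ i)).measurable.enorm.pow_const 2).const_mul _

lemma lintegral_reflectedDensity (lam : ℕ → ℝ) (φ : ℕ → L2R) {f : ℝ → ℝ≥0∞} (hf : Measurable f) :
    ∫⁻ x, f x ∂(reflectedDensity lam φ)
      = ∑' i, ENNReal.ofReal (lam i) * ∫⁻ x, f (-x) * ‖φ i x‖ₑ ^ 2 := by
  have hm : Measurable fun x => ∑' i, ENNReal.ofReal (lam i) * ‖φ i (-x)‖ₑ ^ 2 :=
    (measurable_density lam φ).comp measurable_neg
  rw [reflectedDensity, lintegral_withDensity_eq_lintegral_mul _ hm hf]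
  have h1 := lintegral_neg_eq_self (μ := (volume : Measure ℝ)) (fun x =>
    (∑' i, ENNReal.ofReal (lam i) * ‖φ i x‖ₑ ^ 2) * f (-x))
  simp only [neg_neg] at h1
  refine h1.trans ?_
  simp_rw [← ENNReal.tsum_mul_right]
  have hmi : ∀ i, Measurable fun x => f (-x) * ‖φ i x‖ₑ ^ 2 := fun i =>
    (hf.comp measurable_neg).mul ((Lp.stronglyMeasurable (φ i)).measurable.enorm.pow_const 2)
  have h2 : ∀ i x, ENNReal.ofReal (lam i) * ‖φ i x‖ₑ ^ 2 * f (-x)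
      = ENNReal.ofReal (lam i) * (f (-x) * ‖φ i x‖ₑ ^ 2) := fun i x => by ring
  simp_rw [h2]
  rw [lintegral_tsum fun i => ((hmi i).const_mul _).aemeasurable]
  exact tsum_congr fun i => lintegral_const_mul _ (hmi i)

lemma reflectedDensity_preimage_neg (lam : ℕ → ℝ) (φ : ℕ → L2R) {X : Set ℝ}
    (hX : MeasurableSet X) : reflectedDensity lam φ ((fun r => -r) ⁻¹' X)
      = ∑' i, ENNReal.ofReal (lam i) * ‖mulOp (X.indicator fun _ => 1) (φ i)‖ₑ ^ 2 := by
  have hX' : MeasurableSet ((fun r : ℝ => -r) ⁻¹' X) := measurable_neg hX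
  rw [← lintegral_indicator_one hX',
    lintegral_reflectedDensity lam φ (measurable_one.indicator hX')]
  refine tsum_congr fun i => ?_
  rw [enorm_mulOp_sq (isContr_indicator hX).memLp]
  congr 1
  refine lintegral_congr fun x => ?_
  rw [enorm_indicator_one_sq]
  congr 1
  by_cases hx : x ∈ X <;> simp [hx]

/-- Inner regularity extends the inequality from closed to Borel sets, and equal total masses then
force equality. -/
lemma measure_eq_of_closed_le {μ ρ : Measure ℝ} [IsProbabilityMeasure μ] [IsProbabilityMeasure ρ]
    (h : ∀ X, IsClosed X → μ X ≤ ρ X) : ρ = μ := by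
  symm
  refine Measure.eq_of_le_of_measure_univ_eq (Measure.le_iff.mpr fun s hs => ?_) (by simp)
  rw [hs.measure_eq_iSup_isClosed_of_ne_top (measure_ne_top _ _)]
  exact iSup₂_le fun K hKs => iSup_le fun hK => (h K hK).trans (measure_mono hKs)

lemma isProbabilityMeasure_reflectedDensity {lam : ℕ → ℝ} {φ : ℕ → L2R} (h0 : ∀ i, 0 ≤ lam i)
    (h1 : HasSum lam 1) (hφ : ∀ i, ‖φ i‖ = 1) :
    IsProbabilityMeasure (reflectedDensity lam φ) := by
  constructor
  have h := reflectedDensity_preimage_neg lam φ MeasurableSet.univ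
  rw [Set.preimage_univ] at h
  rw [h]
  simp only [Set.indicator_univ, mulOp_one, ContinuousLinearMap.id_apply, enorm_sq_eq_ofReal, hφ]
  simp only [one_pow, ENNReal.ofReal_one, mul_one]
  rw [← ENNReal.ofReal_tsum_of_nonneg h0 h1.summable, h1.tsum_eq, ENNReal.ofReal_one]

theorem HaveJointObservable.arisesFromState {ρ ν : Measure ℝ} [IsProbabilityMeasure ρ]
    [IsProbabilityMeasure ν]
    (h : HaveJointObservable (positionObservable ρ) (momentumObservable ν)) :
    ArisesFromState ρ ν := by
  obtain ⟨A, hA1, hAρ, hAν⟩ := exists_limit_operator h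
  obtain ⟨lam, φ, hS⟩ := _root_.exists_isSpectralDecomposition A hA1
  -- Both densities have total mass one, so domination on closed sets suffices for the two
  -- identities.
  have hp1 := isProbabilityMeasure_reflectedDensity hS.nonneg hS.sum_one hS.orthonormal.1
  have hp2 := isProbabilityMeasure_reflectedDensity (φ := fun i => fourierPlancherel (φ i))
    hS.nonneg hS.sum_one (fun i => by rw [LinearIsometryEquiv.norm_map, hS.orthonormal.1])
  have hneg : ∀ X : Set ℝ, (fun r : ℝ => -r) ⁻¹' ((fun r : ℝ => -r) ⁻¹' X) = X := fun X => by
    ext x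
    simp
  have hind : ∀ X : Set ℝ, (fun x => (starRingEnd ℂ) (X.indicator (fun _ => (1 : ℂ)) x))
      = X.indicator fun _ => 1 := fun X => by
    funext x
    by_cases hx : x ∈ X <;> simp [hx]
  refine ⟨_, isState_adjoint_comp_self A hA1, lam, φ, hS, ?_, ?_⟩
  · refine measure_eq_of_closed_le fun X hX => ?_
    have hX' : IsClosed ((fun r : ℝ => -r) ⁻¹' X) := hX.preimage continuous_neg
    rw [← hneg X, reflectedDensity_preimage_neg lam φ hX'.measurableSet]
    refine Eq.trans_le ?_ (hAρ _ hX')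
    rw [hS.hsSum_comp, adjoint_mulOp (isContr_indicator hX'.measurableSet).memLp, hind]
  · refine measure_eq_of_closed_le fun X hX => ?_
    have hX' : IsClosed ((fun r : ℝ => -r) ⁻¹' X) := hX.preimage continuous_neg
    rw [← hneg X, reflectedDensity_preimage_neg _ _ hX'.measurableSet]
    refine Eq.trans_le ?_ (hAν _ hX')
    rw [hS.hsSum_comp]
    refine tsum_congr fun i => ?_
    congr 1
    have hadj : ContinuousLinearMap.adjoint (momProj ((fun r : ℝ => -r) ⁻¹' X))
        = momProj ((fun r : ℝ => -r) ⁻¹' X) := by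
      symm
      rw [ContinuousLinearMap.eq_adjoint_iff]
      intro φ ψ
      have hU : ∀ a b : L2R, ⟪fourierPlancherel.symm a, b⟫_ℂ = ⟪a, fourierPlancherel b⟫_ℂ :=
        fun a b => by rw [← fourierPlancherel.inner_map_map, fourierPlancherel.apply_symm_apply]
      have hU' : ∀ a b : L2R, ⟪a, fourierPlancherel.symm b⟫_ℂ = ⟪fourierPlancherel a, b⟫_ℂ :=
        fun a b => by rw [← fourierPlancherel.inner_map_map, fourierPlancherel.apply_symm_apply]
      rw [momProj_apply, momProj_apply, hU, hU',
        inner_mulOp_left (isContr_indicator hX'.measurableSet).memLp, hind]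
    rw [hadj, momProj_apply, ← ofReal_norm, ← ofReal_norm, LinearIsometryEquiv.norm_map]

end Limit

/-! ### Observables from isometries into function spaces -/

section Isometry

variable {Ω : Type*} [MeasurableSpace Ω] {μ : Measure Ω}

lemma memLp_top_indicator_one {Z : Set Ω} (hZ : MeasurableSet Z) :
    MemLp (Z.indicator fun _ => (1 : ℂ)) ∞ μ := by
  refine memLp_top_of_bound (measurable_const.indicator hZ).aestronglyMeasurable 1
    (.of_forall fun x => ?_)
  by_cases hx : x ∈ Z <;> simp [hx]

open Classical in
/-- Multiplication by the characteristic function of `Z` on `L²(μ)`. -/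
noncomputable def indOp (μ : Measure Ω) (Z : Set Ω) : Lp ℂ 2 μ →L[ℂ] Lp ℂ 2 μ :=
  if hZ : MeasurableSet Z then
    (ContinuousLinearMap.mul ℂ ℂ).holderL μ ∞ 2 2 ((memLp_top_indicator_one hZ).toLp _)
  else 0

lemma indOp_coeFn {Z : Set Ω} (hZ : MeasurableSet Z) (f : Lp ℂ 2 μ) :
    indOp μ Z f =ᵐ[μ] Z.indicator f := by
  rw [indOp, dif_pos hZ]
  filter_upwards [ContinuousLinearMap.coeFn_holder (r := 2) (ContinuousLinearMap.mul ℂ ℂ)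
    ((memLp_top_indicator_one hZ).toLp (μ := μ) _) f,
    (memLp_top_indicator_one (μ := μ) hZ).coeFn_toLp] with x h1 h2
  rw [ContinuousLinearMap.holderL_apply_apply, h1, h2]
  by_cases hx : x ∈ Z <;> simp [hx]

lemma inner_indOp {Z : Set Ω} (hZ : MeasurableSet Z) (f g : Lp ℂ 2 μ) :
    ⟪f, indOp μ Z g⟫_ℂ = ∫ z in Z, ⟪f z, g z⟫_ℂ ∂μ := by
  rw [L2.inner_def, ← integral_indicator hZ]
  refine integral_congr_ae ?_
  filter_upwards [indOp_coeFn hZ g] with x hx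
  rw [hx]
  by_cases hxZ : x ∈ Z <;> simp [hxZ]

variable {H : Type*} [NormedAddCommGroup H] [InnerProductSpace ℂ H] [CompleteSpace H]

lemma inner_isometry_conj (B : H →ₗᵢ[ℂ] Lp ℂ 2 μ) {Z : Set Ω} (hZ : MeasurableSet Z) (φ ψ : H) :
    ⟪φ, (ContinuousLinearMap.adjoint B.toContinuousLinearMap ∘L indOp μ Z ∘L
      B.toContinuousLinearMap) ψ⟫_ℂ = ∫ z in Z, ⟪B φ z, B ψ z⟫_ℂ ∂μ := by
  rw [ContinuousLinearMap.comp_apply, ContinuousLinearMap.adjoint_inner_right]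
  exact inner_indOp hZ _ _

lemma inner_self_isometry_conj (B : H →ₗᵢ[ℂ] Lp ℂ 2 μ) {Z : Set Ω} (hZ : MeasurableSet Z)
    (ψ : H) : ⟪ψ, (ContinuousLinearMap.adjoint B.toContinuousLinearMap ∘L indOp μ Z ∘L
      B.toContinuousLinearMap) ψ⟫_ℂ = ((∫ z in Z, ‖B ψ z‖ ^ 2 ∂μ : ℝ) : ℂ) := by
  rw [inner_isometry_conj B hZ, ← integral_complex_ofReal]
  refine integral_congr_ae (.of_forall fun z => ?_)
  simp [inner_self_eq_norm_sq_to_K]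

/-- The observable `Z ↦ B* 1_Z B` of an isometry `B` into `L²(μ)`. -/
noncomputable def Observable.ofIsometry (B : H →ₗᵢ[ℂ] Lp ℂ 2 μ) : Observable Ω H where
  toFun Z := ContinuousLinearMap.adjoint B.toContinuousLinearMap ∘L indOp μ Z ∘L
    B.toContinuousLinearMap
  positive Z hZ := by
    rw [ContinuousLinearMap.isPositive_iff_complex]
    intro ψ
    rw [← inner_conj_symm, inner_self_isometry_conj B hZ, Complex.conj_ofReal]
    refine ⟨by simp, ?_⟩
    simp only [RCLike.re_to_complex, Complex.ofReal_re]
    exact integral_nonneg fun z => by positivity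
  normalized := by
    ext1 ψ
    refine ext_inner_left ℂ fun φ => ?_
    rw [inner_isometry_conj B MeasurableSet.univ, setIntegral_univ, ← L2.inner_def,
      B.inner_map_map, ContinuousLinearMap.id_apply]
  additive Z hZ hd φ ψ := by
    simp only [inner_isometry_conj B (hZ _), inner_isometry_conj B (MeasurableSet.iUnion hZ)]
    exact hasSum_integral_iUnion hZ hd (L2.integrable_inner (B φ) (B ψ)).integrableOn

lemma Observable.quad_ofIsometry (B : H →ₗᵢ[ℂ] Lp ℂ 2 μ) (ψ : H) {Z : Set Ω}
    (hZ : MeasurableSet Z) : (Observable.ofIsometry B).quad ψ Z = ∫⁻ z in Z, ‖B ψ z‖ₑ ^ 2 ∂μ := by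
  rw [Observable.quad_apply _ _ hZ]
  have h := inner_self_isometry_conj B hZ ψ
  rw [Observable.ofIsometry]
  simp only []
  rw [h, Complex.ofReal_re, ofReal_integral_eq_lintegral_ofReal
    (((Lp.memLp (B ψ)).integrable_norm_pow (by norm_num)).integrableOn)
    (.of_forall fun z => by positivity)]
  refine lintegral_congr fun z => ?_
  rw [enorm_sq_eq_ofReal]

end Isometry

/-! ### Covariant phase space observables -/

section PhaseSpace

/-- The phase space function `(2π)^(-1/2) ⟨M_p T_q f, ψ⟩`. -/
noncomputable def phaseFun (f ψ : L2R) (q p : ℝ) : ℂ :=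
  ((√(2 * Real.pi))⁻¹ : ℝ) * ⟪weyl q p f, ψ⟫_ℂ

lemma phaseFun_eq_fourierInt (f ψ : L2R) (q p : ℝ) :
    phaseFun f ψ q p = fourierInt (-1) (fun x => (starRingEnd ℂ) (f (x - q)) * ψ x) p := by
  rw [phaseFun, fourierInt, L2.inner_def]
  congr 1
  refine integral_congr_ae ?_
  filter_upwards [mulOp_coeFn (isContr_expFun p).memLp (transl q f), transl_coeFn q f] with x h1 h2
  rw [weyl, ContinuousLinearMap.comp_apply, modul, h1, h2, RCLike.inner_apply, map_mul,
    expFun_conj, expFun, neg_one_mul]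
  ring

lemma stronglyMeasurable_phaseFun (f ψ : L2R) :
    StronglyMeasurable fun z : ℝ × ℝ => phaseFun f ψ z.1 z.2 := by
  simp_rw [phaseFun_eq_fourierInt]
  refine StronglyMeasurable.const_mul ?_ _
  have h : StronglyMeasurable fun w : (ℝ × ℝ) × ℝ =>
      Complex.exp (((-1 * w.1.2 * w.2 : ℝ) : ℂ) * Complex.I)
        * ((starRingEnd ℂ) (f (w.2 - w.1.1)) * ψ w.2) := by
    refine StronglyMeasurable.mul (Continuous.stronglyMeasurable (by fun_prop)) ?_
    refine StronglyMeasurable.mul ?_ ((Lp.stronglyMeasurable ψ).comp_measurable measurable_snd)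
    exact Complex.continuous_conj.comp_stronglyMeasurable
      ((Lp.stronglyMeasurable f).comp_measurable
        (measurable_snd.sub (measurable_fst.comp measurable_fst)))
  exact h.integral_prod_right

lemma measurable_prod_sq (f ψ : L2R) :
    Measurable fun z : ℝ × ℝ => ‖f (z.2 - z.1)‖ₑ ^ 2 * ‖ψ z.2‖ₑ ^ 2 :=
  (((Lp.stronglyMeasurable f).measurable.comp
    (measurable_snd.sub measurable_fst)).enorm.pow_const 2).mul
    (((Lp.stronglyMeasurable ψ).measurable.comp measurable_snd).enorm.pow_const 2)

lemma lintegral_lintegral_prod_sq (f ψ : L2R) {w : ℝ → ℝ≥0∞} (hw : Measurable w) :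
    ∫⁻ q, w q * ∫⁻ x, ‖f (x - q)‖ₑ ^ 2 * ‖ψ x‖ₑ ^ 2
      = ∫⁻ x, (∫⁻ q, w (x - q) * ‖f q‖ₑ ^ 2) * ‖ψ x‖ₑ ^ 2 := by
  have h1 : ∀ q, w q * ∫⁻ x, ‖f (x - q)‖ₑ ^ 2 * ‖ψ x‖ₑ ^ 2
      = ∫⁻ x, w q * (‖f (x - q)‖ₑ ^ 2 * ‖ψ x‖ₑ ^ 2) := fun q =>
    (lintegral_const_mul _ ((measurable_prod_sq f ψ).comp measurable_prodMk_left)).symm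
  simp_rw [h1]
  rw [lintegral_lintegral_swap
    ((hw.comp measurable_fst).mul (measurable_prod_sq f ψ)).aemeasurable]
  refine lintegral_congr fun x => ?_
  have hm : Measurable fun q => w q * ‖f (x - q)‖ₑ ^ 2 :=
    hw.mul (((Lp.stronglyMeasurable f).measurable.comp
      (measurable_const.sub measurable_id)).enorm.pow_const 2)
  simp_rw [← mul_assoc]
  rw [lintegral_mul_const _ hm]
  congr 1
  have := lintegral_sub_left_eq_self (μ := (volume : Measure ℝ))
    (fun q => w (x - q) * ‖f q‖ₑ ^ 2) x
  simp only [sub_sub_cancel] at this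
  exact this

/-- The Plancherel formula on the fibres of phase space. -/
lemma lintegral_phaseFun (f ψ : L2R) {w : ℝ → ℝ≥0∞} (hw : Measurable w) :
    ∫⁻ q, w q * ∫⁻ p, ‖phaseFun f ψ q p‖ₑ ^ 2
      = ∫⁻ x, (∫⁻ q, w (x - q) * ‖f q‖ₑ ^ 2) * ‖ψ x‖ₑ ^ 2 := by
  rw [← lintegral_lintegral_prod_sq f ψ hw]
  -- The product of a translate of `f̄` with `ψ` is always integrable but is in `L²` only for almost
  -- every `q`, by Tonelli; Plancherel is applied for those `q`.
  have hfin : ∀ᵐ q, ∫⁻ x, ‖f (x - q)‖ₑ ^ 2 * ‖ψ x‖ₑ ^ 2 < ∞ := by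
    refine ae_lt_top (measurable_prod_sq f ψ).lintegral_prod_right' ?_
    have h := lintegral_lintegral_prod_sq f ψ (w := fun _ => 1) measurable_const
    simp only [one_mul] at h
    rw [h, lintegral_const_mul' _ _ (by rw [← enorm_sq_eq_lintegral]; simp),
      ← enorm_sq_eq_lintegral, ← enorm_sq_eq_lintegral]
    exact ENNReal.mul_ne_top (by simp) (by simp)
  refine lintegral_congr_ae ?_
  filter_upwards [hfin] with q hq
  congr 1
  set g : ℝ → ℂ := fun x => (starRingEnd ℂ) (f (x - q)) * ψ x with hg
  have hgm : AEStronglyMeasurable g volume :=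
    (Complex.continuous_conj.comp_stronglyMeasurable ((Lp.stronglyMeasurable f).comp_measurable
      (measurable_id.sub_const q))).aestronglyMeasurable.mul (Lp.aestronglyMeasurable ψ)
  have hsq : ∀ x, ‖g x‖ₑ ^ 2 = ‖f (x - q)‖ₑ ^ 2 * ‖ψ x‖ₑ ^ 2 := fun x => by
    rw [hg]
    simp only []
    rw [enorm_mul, mul_pow, RCLike.enorm_conj]
  have h2 : MemLp g 2 := by
    refine ⟨hgm, ?_⟩
    have h := eLpNorm_nnreal_pow_eq_lintegral (f := g) (μ := volume) (p := 2) (by norm_num)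
    have h' : eLpNorm g 2 volume ^ 2 = ∫⁻ x, ‖g x‖ₑ ^ 2 := by simpa using h
    simp_rw [hsq] at h'
    by_contra hcon
    rw [not_lt, top_le_iff] at hcon
    rw [hcon] at h'
    simp [← h'] at hq
  have h1 : Integrable g := by
    have := L2.integrable_inner (𝕜 := ℂ) (transl q f) ψ
    refine this.congr ?_
    filter_upwards [transl_coeFn q f] with x hx
    rw [hx]
    simp [hg, mul_comm]
  have h3 : ‖fourierPlancherel (h2.toLp g)‖ₑ = ‖h2.toLp g‖ₑ := by
    rw [← ofReal_norm, ← ofReal_norm, LinearIsometryEquiv.norm_map]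
  have h4 : ‖fourierPlancherel (h2.toLp g)‖ₑ ^ 2 = ∫⁻ p, ‖phaseFun f ψ q p‖ₑ ^ 2 := by
    rw [enorm_sq_eq_lintegral]
    refine lintegral_congr_ae ?_
    filter_upwards [isPlancherel_fourierPlancherel g h1 h2] with p hp
    rw [hp, phaseFun_eq_fourierInt]
  rw [← h4, h3, enorm_sq_eq_lintegral]
  refine lintegral_congr_ae ?_
  filter_upwards [h2.coeFn_toLp] with x hx
  rw [hx, hsq]

lemma transl_modul (p q : ℝ) (ψ : L2R) :
    transl p (modul (-q) ψ) = expFun p q • weyl p (-q) ψ := by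
  refine Lp.ext ?_
  filter_upwards [transl_coeFn p (modul (-q) ψ),
    ae_sub_right p (mulOp_coeFn (isContr_expFun (-q)).memLp ψ),
    Lp.coeFn_smul (expFun p q) (weyl p (-q) ψ),
    mulOp_coeFn (isContr_expFun (-q)).memLp (transl p ψ), transl_coeFn p ψ] with x h1 h2 h3 h4 h5
  rw [h1, modul, h2, h3, Pi.smul_apply, weyl, ContinuousLinearMap.comp_apply, modul, h4, h5,
    smul_eq_mul, ← mul_assoc]
  congr 1
  rw [expFun, expFun, expFun, ← Complex.exp_add]
  congr 1
  push_cast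
  ring

/-- The Fourier operator rotates phase space: `W(q,p)` becomes `W(p,-q)` up to a phase, which the
modulus ignores. The momentum margin is thereby a position margin. -/
lemma enorm_phaseFun_fourier (f ψ : L2R) (q p : ℝ) :
    ‖phaseFun f ψ q p‖ₑ = ‖phaseFun (fourierPlancherel f) (fourierPlancherel ψ) p (-q)‖ₑ := by
  rw [phaseFun, phaseFun, ← fourierPlancherel.inner_map_map, fourierPlancherel_weyl, transl_modul,
    inner_smul_left, enorm_mul, enorm_mul, enorm_mul, RCLike.enorm_conj]
  have : ‖expFun p q‖ₑ = 1 := by rw [← ofReal_norm, norm_expFun, ENNReal.ofReal_one]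
  rw [this, one_mul]

lemma lintegral_phaseFun' (f ψ : L2R) {w : ℝ → ℝ≥0∞} (hw : Measurable w) :
    ∫⁻ p, w p * ∫⁻ q, ‖phaseFun f ψ q p‖ₑ ^ 2
      = ∫⁻ x, (∫⁻ q, w (x - q) * ‖fourierPlancherel f q‖ₑ ^ 2) * ‖fourierPlancherel ψ x‖ₑ ^ 2 := by
  rw [← lintegral_phaseFun _ _ hw]
  refine lintegral_congr fun p => ?_
  simp_rw [enorm_phaseFun_fourier f ψ]
  congr 1
  exact lintegral_neg_eq_self
    (fun q => ‖phaseFun (fourierPlancherel f) (fourierPlancherel ψ) p q‖ₑ ^ 2)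

/-- The discrete measure with weights `lam`. -/
noncomputable def weightMeasure (lam : ℕ → ℝ) : Measure ℕ :=
  Measure.count.withDensity fun j => ENNReal.ofReal (lam j)

lemma lintegral_weightMeasure (lam : ℕ → ℝ) (f : ℕ → ℝ≥0∞) :
    ∫⁻ j, f j ∂(weightMeasure lam) = ∑' j, ENNReal.ofReal (lam j) * f j := by
  rw [weightMeasure, lintegral_withDensity_eq_lintegral_mul _ (measurable_of_countable _)
    (measurable_of_countable _), lintegral_count]
  rfl

/-- The phase space measure with weights `lam`. -/
noncomputable def phaseMeasure (lam : ℕ → ℝ) : Measure (ℕ × (ℝ × ℝ)) :=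
  (weightMeasure lam).prod (volume.prod volume)

lemma lintegral_phaseMeasure (lam : ℕ → ℝ) {f : ℕ × (ℝ × ℝ) → ℝ≥0∞} (hf : Measurable f) :
    ∫⁻ z, f z ∂(phaseMeasure lam)
      = ∑' j, ENNReal.ofReal (lam j) * ∫⁻ z : ℝ × ℝ, f (j, z) ∂(volume.prod volume) := by
  rw [phaseMeasure, lintegral_prod _ hf.aemeasurable, lintegral_weightMeasure]

variable {lam : ℕ → ℝ} {φ : ℕ → L2R}

lemma stronglyMeasurable_phase (φ : ℕ → L2R) (ψ : L2R) :
    StronglyMeasurable fun z : ℕ × (ℝ × ℝ) => phaseFun (φ z.1) ψ z.2.1 z.2.2 :=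
  (measurable_from_prod_countable_right fun j =>
    (stronglyMeasurable_phaseFun (φ j) ψ).measurable).stronglyMeasurable

lemma measurable_lintegral_sub_mul {w : ℝ → ℝ≥0∞} (hw : Measurable w) (f : L2R) :
    Measurable fun x => ∫⁻ q, w (x - q) * ‖f q‖ₑ ^ 2 :=
  Measurable.lintegral_prod_right' (f := fun z : ℝ × ℝ => w (z.1 - z.2) * ‖f z.2‖ₑ ^ 2)
    ((hw.comp (measurable_fst.sub measurable_snd)).mul
      (((Lp.stronglyMeasurable f).measurable.comp measurable_snd).enorm.pow_const 2))

lemma tsum_lintegral_mul (lam : ℕ → ℝ) (φ : ℕ → L2R) (ψ : L2R) {w : ℝ → ℝ≥0∞}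
    (hw : Measurable w) :
    ∑' j, ENNReal.ofReal (lam j) * ∫⁻ x, (∫⁻ q, w (x - q) * ‖φ j q‖ₑ ^ 2) * ‖ψ x‖ₑ ^ 2
      = ∫⁻ x, (∑' j, ENNReal.ofReal (lam j) * ∫⁻ q, w (x - q) * ‖φ j q‖ₑ ^ 2) * ‖ψ x‖ₑ ^ 2 := by
  have hψm : Measurable fun x => ‖ψ x‖ₑ ^ 2 :=
    (Lp.stronglyMeasurable ψ).measurable.enorm.pow_const 2
  have hmt : ∀ j, Measurable fun x => (∫⁻ q, w (x - q) * ‖φ j q‖ₑ ^ 2) * ‖ψ x‖ₑ ^ 2 :=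
    fun j => (measurable_lintegral_sub_mul hw (φ j)).mul hψm
  simp_rw [← ENNReal.tsum_mul_right, mul_assoc]
  rw [lintegral_tsum fun j => ((hmt j).const_mul _).aemeasurable]
  exact tsum_congr fun j => (lintegral_const_mul _ (hmt j)).symm

lemma lintegral_prod_fst_mul {w : ℝ → ℝ≥0∞} (hw : Measurable w) {F : ℝ → ℝ → ℝ≥0∞}
    (hF : Measurable fun z : ℝ × ℝ => F z.1 z.2) :
    ∫⁻ z : ℝ × ℝ, w z.1 * F z.1 z.2 ∂(volume.prod volume) = ∫⁻ q, w q * ∫⁻ p, F q p := by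
  have hm : Measurable fun z : ℝ × ℝ => w z.1 * F z.1 z.2 := (hw.comp measurable_fst).mul hF
  rw [lintegral_prod _ hm.aemeasurable]
  refine lintegral_congr fun q => ?_
  have hq : Measurable fun p => F q p := hF.comp measurable_prodMk_left
  exact lintegral_const_mul (w q) hq

lemma lintegral_prod_snd_mul {w : ℝ → ℝ≥0∞} (hw : Measurable w) {F : ℝ → ℝ → ℝ≥0∞}
    (hF : Measurable fun z : ℝ × ℝ => F z.1 z.2) :
    ∫⁻ z : ℝ × ℝ, w z.2 * F z.1 z.2 ∂(volume.prod volume) = ∫⁻ p, w p * ∫⁻ q, F q p := by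
  have hm : Measurable fun z : ℝ × ℝ => w z.2 * F z.1 z.2 := (hw.comp measurable_snd).mul hF
  rw [lintegral_prod_symm _ hm.aemeasurable]
  refine lintegral_congr fun p => ?_
  have hp : Measurable fun q => F q p := hF.comp measurable_prodMk_right
  exact lintegral_const_mul (w p) hp

lemma lintegral_prod_phaseFun (f ψ : L2R) {w : ℝ → ℝ≥0∞} (hw : Measurable w) :
    ∫⁻ z : ℝ × ℝ, w z.1 * ‖phaseFun f ψ z.1 z.2‖ₑ ^ 2 ∂(volume.prod volume)
      = ∫⁻ x, (∫⁻ q, w (x - q) * ‖f q‖ₑ ^ 2) * ‖ψ x‖ₑ ^ 2 :=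
  (lintegral_prod_fst_mul hw (F := fun q p => ‖phaseFun f ψ q p‖ₑ ^ 2)
    ((stronglyMeasurable_phaseFun f ψ).measurable.enorm.pow_const 2)).trans
    (lintegral_phaseFun f ψ hw)

lemma lintegral_prod_phaseFun' (f ψ : L2R) {w : ℝ → ℝ≥0∞} (hw : Measurable w) :
    ∫⁻ z : ℝ × ℝ, w z.2 * ‖phaseFun f ψ z.1 z.2‖ₑ ^ 2 ∂(volume.prod volume)
      = ∫⁻ x, (∫⁻ q, w (x - q) * ‖fourierPlancherel f q‖ₑ ^ 2) * ‖fourierPlancherel ψ x‖ₑ ^ 2 :=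
  (lintegral_prod_snd_mul hw (F := fun q p => ‖phaseFun f ψ q p‖ₑ ^ 2)
    ((stronglyMeasurable_phaseFun f ψ).measurable.enorm.pow_const 2)).trans
    (lintegral_phaseFun' f ψ hw)

lemma lintegral_phase_position (lam : ℕ → ℝ) (φ : ℕ → L2R) (ψ : L2R) {w : ℝ → ℝ≥0∞}
    (hw : Measurable w) :
    ∫⁻ z, w z.2.1 * ‖phaseFun (φ z.1) ψ z.2.1 z.2.2‖ₑ ^ 2 ∂(phaseMeasure lam)
      = ∫⁻ x, (∑' j, ENNReal.ofReal (lam j) * ∫⁻ q, w (x - q) * ‖φ j q‖ₑ ^ 2) * ‖ψ x‖ₑ ^ 2 := by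
  have hm : Measurable fun z : ℕ × (ℝ × ℝ) => w z.2.1 * ‖phaseFun (φ z.1) ψ z.2.1 z.2.2‖ₑ ^ 2 :=
    (hw.comp (measurable_fst.comp measurable_snd)).mul
      ((stronglyMeasurable_phase φ ψ).measurable.enorm.pow_const 2)
  rw [lintegral_phaseMeasure lam hm, ← tsum_lintegral_mul lam φ ψ hw]
  exact tsum_congr fun j => congrArg _ (lintegral_prod_phaseFun (φ j) ψ hw)

lemma lintegral_phase_momentum (lam : ℕ → ℝ) (φ : ℕ → L2R) (ψ : L2R) {w : ℝ → ℝ≥0∞}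
    (hw : Measurable w) :
    ∫⁻ z, w z.2.2 * ‖phaseFun (φ z.1) ψ z.2.1 z.2.2‖ₑ ^ 2 ∂(phaseMeasure lam)
      = ∫⁻ x, (∑' j, ENNReal.ofReal (lam j) * ∫⁻ q, w (x - q) * ‖fourierPlancherel (φ j) q‖ₑ ^ 2)
          * ‖fourierPlancherel ψ x‖ₑ ^ 2 := by
  have hm : Measurable fun z : ℕ × (ℝ × ℝ) => w z.2.2 * ‖phaseFun (φ z.1) ψ z.2.1 z.2.2‖ₑ ^ 2 :=
    (hw.comp (measurable_snd.comp measurable_snd)).mul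
      ((stronglyMeasurable_phase φ ψ).measurable.enorm.pow_const 2)
  rw [lintegral_phaseMeasure lam hm,
    ← tsum_lintegral_mul lam (fun j => fourierPlancherel (φ j)) (fourierPlancherel ψ) hw]
  exact tsum_congr fun j => congrArg _ (lintegral_prod_phaseFun' (φ j) ψ hw)

/-- The margin formula with weight one; it makes the phase space map an isometry. -/
lemma lintegral_phase_eq (h0 : ∀ i, 0 ≤ lam i) (h1 : HasSum lam 1) (hφ : ∀ i, ‖φ i‖ = 1)
    (ψ : L2R) : ∫⁻ z, ‖phaseFun (φ z.1) ψ z.2.1 z.2.2‖ₑ ^ 2 ∂(phaseMeasure lam) = ‖ψ‖ₑ ^ 2 := by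
  have h := lintegral_phase_position lam φ ψ (w := fun _ => 1) measurable_const
  simp only [one_mul, ← enorm_sq_eq_lintegral] at h
  have h2 : ∑' j, ENNReal.ofReal (lam j) * ‖φ j‖ₑ ^ 2 = 1 := by
    simp only [enorm_sq_eq_ofReal, hφ, one_pow, ENNReal.ofReal_one, mul_one]
    rw [← ENNReal.ofReal_tsum_of_nonneg h0 h1.summable, h1.tsum_eq, ENNReal.ofReal_one]
  rw [h, h2, enorm_sq_eq_lintegral]
  simp

lemma memLp_phase (h0 : ∀ i, 0 ≤ lam i) (h1 : HasSum lam 1) (hφ : ∀ i, ‖φ i‖ = 1) (ψ : L2R) :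
    MemLp (fun z : ℕ × (ℝ × ℝ) => phaseFun (φ z.1) ψ z.2.1 z.2.2) 2 (phaseMeasure lam) ∧
    eLpNorm (fun z : ℕ × (ℝ × ℝ) => phaseFun (φ z.1) ψ z.2.1 z.2.2) 2 (phaseMeasure lam)
      = ‖ψ‖ₑ := by
  have h := eLpNorm_nnreal_pow_eq_lintegral
    (f := fun z : ℕ × (ℝ × ℝ) => phaseFun (φ z.1) ψ z.2.1 z.2.2) (μ := phaseMeasure lam)
    (p := 2) (by norm_num)
  have h' : eLpNorm (fun z : ℕ × (ℝ × ℝ) => phaseFun (φ z.1) ψ z.2.1 z.2.2) 2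
      (phaseMeasure lam) ^ 2 = ‖ψ‖ₑ ^ 2 := by
    rw [← lintegral_phase_eq h0 h1 hφ ψ]
    simpa using h
  have h2 := (ENNReal.pow_right_strictMono (n := 2) (by norm_num)).injective h'
  exact ⟨⟨(stronglyMeasurable_phase φ ψ).aestronglyMeasurable, by rw [h2]; simp⟩, h2⟩

/-- The isometry into functions on phase space given by a mixture of the vectors `φ j`. -/
noncomputable def phaseIsometry (h0 : ∀ i, 0 ≤ lam i) (h1 : HasSum lam 1) (hφ : ∀ i, ‖φ i‖ = 1) :
    L2R →ₗᵢ[ℂ] Lp ℂ 2 (phaseMeasure lam) where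
  toFun ψ := (memLp_phase h0 h1 hφ ψ).1.toLp _
  map_add' ψ ψ' := by
    rw [← MemLp.toLp_add]
    refine MemLp.toLp_congr _ _ (.of_forall fun z => ?_)
    simp only [phaseFun, inner_add_right, Pi.add_apply]
    ring
  map_smul' c ψ := by
    rw [RingHom.id_apply, ← MemLp.toLp_const_smul]
    refine MemLp.toLp_congr _ _ (.of_forall fun z => ?_)
    simp only [phaseFun, inner_smul_right, Pi.smul_apply, smul_eq_mul]
    ring
  norm_map' ψ := by
    change ‖(memLp_phase h0 h1 hφ ψ).1.toLp _‖ = ‖ψ‖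
    rw [Lp.norm_toLp, (memLp_phase h0 h1 hφ ψ).2, toReal_enorm]

lemma quad_phaseIsometry (h0 : ∀ i, 0 ≤ lam i) (h1 : HasSum lam 1) (hφ : ∀ i, ‖φ i‖ = 1)
    (ψ : L2R) {Z : Set (ℕ × (ℝ × ℝ))} (hZ : MeasurableSet Z) :
    (Observable.ofIsometry (phaseIsometry h0 h1 hφ)).quad ψ Z
      = ∫⁻ z, Z.indicator 1 z * ‖phaseFun (φ z.1) ψ z.2.1 z.2.2‖ₑ ^ 2 ∂(phaseMeasure lam) := by
  rw [Observable.quad_ofIsometry _ _ hZ, ← lintegral_indicator hZ]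
  refine lintegral_congr_ae ?_
  filter_upwards [(memLp_phase h0 h1 hφ ψ).1.coeFn_toLp] with z hz
  have hz' : (phaseIsometry h0 h1 hφ ψ) z = phaseFun (φ z.1) ψ z.2.1 z.2.2 := hz
  by_cases hzZ : z ∈ Z <;> simp [hzZ, hz']

lemma reflectedDensity_preimage_add (lam : ℕ → ℝ) (φ : ℕ → L2R) {X : Set ℝ} (hX : MeasurableSet X)
    (x : ℝ) : reflectedDensity lam φ ((fun r => r + x) ⁻¹' X)
      = ∑' j, ENNReal.ofReal (lam j) * ∫⁻ q, X.indicator 1 (x - q) * ‖φ j q‖ₑ ^ 2 := by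
  have hX' : MeasurableSet ((fun r : ℝ => r + x) ⁻¹' X) := (measurable_id.add_const x) hX
  rw [← lintegral_indicator_one hX',
    lintegral_reflectedDensity lam φ (measurable_one.indicator hX')]
  refine tsum_congr fun j => ?_
  congr 1
  refine lintegral_congr fun q => ?_
  congr 1
  have : -q + x = x - q := by ring
  by_cases hx : x - q ∈ X <;> simp [Set.indicator, this, hx]

theorem ArisesFromState.haveJointObservable {ρ ν : Measure ℝ} [IsProbabilityMeasure ρ]
    [IsProbabilityMeasure ν] (h : ArisesFromState ρ ν) :
    HaveJointObservable (positionObservable ρ) (momentumObservable ν) := by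
  obtain ⟨T, -, lam, φ, hS, hρ, hν⟩ := h
  have h0 := hS.nonneg
  have h1 := hS.sum_one
  have hφ := hS.orthonormal.1
  set G := Observable.ofIsometry (phaseIsometry h0 h1 hφ) with hG
  -- The mixture index `j` is a coordinate of the space on which `G` lives; projecting it away
  -- leaves an observable on the plane.
  refine ⟨G.map Prod.snd measurable_snd, fun X hX => ?_, fun Y hY => ?_⟩
  · have hm : MeasurableSet (Prod.snd ⁻¹' (X ×ˢ Set.univ) : Set (ℕ × (ℝ × ℝ))) :=
      measurable_snd (hX.prod MeasurableSet.univ)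
    refine ((positionObservable ρ).positive X hX).ext_of_ofReal (G.positive _ hm) fun ψ => ?_
    change _ = ENNReal.ofReal (⟪ψ, G (Prod.snd ⁻¹' (X ×ˢ Set.univ)) ψ⟫_ℂ).re
    rw [← Observable.quad_apply _ _ hX, ← Observable.quad_apply _ _ hm,
      quad_phaseIsometry h0 h1 hφ ψ hm, quad_positionObservable ρ ψ hX]
    have h2 := lintegral_phase_position lam φ ψ (w := X.indicator 1) (measurable_one.indicator hX)
    simp_rw [← reflectedDensity_preimage_add lam φ hX, ← hρ] at h2
    rw [← h2]
    refine lintegral_congr fun z => ?_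
    congr 1
    by_cases hz : z.2.1 ∈ X <;> simp [Set.indicator, hz]
  · have hm : MeasurableSet (Prod.snd ⁻¹' (Set.univ ×ˢ Y) : Set (ℕ × (ℝ × ℝ))) :=
      measurable_snd (MeasurableSet.univ.prod hY)
    refine ((momentumObservable ν).positive Y hY).ext_of_ofReal (G.positive _ hm) fun ψ => ?_
    change _ = ENNReal.ofReal (⟪ψ, G (Prod.snd ⁻¹' (Set.univ ×ˢ Y)) ψ⟫_ℂ).re
    rw [← Observable.quad_apply _ _ hY, ← Observable.quad_apply _ _ hm,
      quad_phaseIsometry h0 h1 hφ ψ hm, quad_momentumObservable ν ψ hY]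
    have h2 := lintegral_phase_momentum lam φ ψ (w := Y.indicator 1) (measurable_one.indicator hY)
    simp_rw [← reflectedDensity_preimage_add lam (fun j => fourierPlancherel (φ j)) hY, ← hν] at h2
    rw [← h2]
    refine lintegral_congr fun z => ?_
    congr 1
    by_cases hz : z.2.2 ∈ Y <;> simp [Set.indicator, hz]

end PhaseSpace

/-! ### The Heisenberg uncertainty relation -/

section Heisenberg

lemma inner_transl_transl (t : ℝ) (ψ χ : L2R) : ⟪transl t ψ, transl t χ⟫_ℂ = ⟪ψ, χ⟫_ℂ :=
  (Lp.compMeasurePreservingₗᵢ ℂ (fun x : ℝ => x - t)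
    (measurePreserving_sub_right volume t)).inner_map_map ψ χ

lemma norm_transl (t : ℝ) (ψ : L2R) : ‖transl t ψ‖ = ‖ψ‖ :=
  (Lp.compMeasurePreservingₗᵢ ℂ (fun x : ℝ => x - t)
    (measurePreserving_sub_right volume t)).norm_map ψ

lemma inner_mul_real_comm {g : ℝ → ℝ} {ψ ψ' Y Y' : L2R}
    (hY : Y =ᵐ[volume] fun x => (g x : ℂ) * ψ x) (hY' : Y' =ᵐ[volume] fun x => (g x : ℂ) * ψ' x) :
    ⟪ψ, Y'⟫_ℂ = ⟪Y, ψ'⟫_ℂ := by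
  rw [L2.inner_def, L2.inner_def]
  refine integral_congr_ae ?_
  filter_upwards [hY, hY'] with x h1 h2
  rw [h1, h2]
  simp only [RCLike.inner_apply, map_mul, Complex.conj_ofReal]
  ring

lemma norm_expFun_sub_one_le (t x : ℝ) : ‖expFun t x - 1‖ ≤ |t| * |x| := by
  have h := Real.norm_exp_I_mul_ofReal_sub_one_le (x := t * x)
  rw [mul_comm Complex.I, Real.norm_eq_abs, abs_mul] at h
  exact h

/-- On the Fourier side the difference is multiplication by `e^(-it(p-b)) - 1`, of modulus at most
`|t||p - b|`. -/
lemma norm_smul_transl_sub_le {ψ Z : L2R} {b : ℝ}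
    (hZ : Z =ᵐ[volume] fun p => ((p - b : ℝ) : ℂ) * fourierPlancherel ψ p) (t : ℝ) :
    ‖expFun b t • transl t ψ - ψ‖ ≤ |t| * ‖Z‖ := by
  rw [← fourierPlancherel.norm_map, map_sub, map_smul,
    isPlancherel_fourierPlancherel.comp_transl (by norm_num)]
  refine Lp.norm_le_mul_norm_of_ae_le_mul ?_
  filter_upwards [Lp.coeFn_sub (expFun b t • modul (-1 * t) (fourierPlancherel ψ))
      (fourierPlancherel ψ), Lp.coeFn_smul (expFun b t) (modul (-1 * t) (fourierPlancherel ψ)),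
    mulOp_coeFn (isContr_expFun (-1 * t)).memLp (fourierPlancherel ψ), hZ] with p h1 h2 h3 h4
  rw [h1, Pi.sub_apply, h2, Pi.smul_apply, modul, h3, h4, norm_mul, Complex.norm_real,
    Real.norm_eq_abs, ← mul_assoc]
  have h5 : expFun b t • (expFun (-1 * t) p * fourierPlancherel ψ p) - fourierPlancherel ψ p
      = (expFun (-t) (p - b) - 1) * fourierPlancherel ψ p := by
    rw [smul_eq_mul, ← mul_assoc, sub_mul, one_mul]
    congr 2
    rw [expFun, expFun, expFun, ← Complex.exp_add]
    congr 1
    push_cast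
    ring
  rw [h5, norm_mul]
  refine mul_le_mul_of_nonneg_right ?_ (norm_nonneg _)
  simpa using norm_expFun_sub_one_le (-t) (p - b)

/-- The canonical commutation relation in integrated form: `(x - a) T_t ψ = T_t (x - a) ψ + t T_t
ψ`. No derivative and no domain question arises. -/
lemma mul_transl_ae {ψ Y : L2R} {a : ℝ} (hY : Y =ᵐ[volume] fun x => ((x - a : ℝ) : ℂ) * ψ x)
    (t : ℝ) (c : ℂ) : (c • (transl t Y + (t : ℂ) • transl t ψ) : L2R)
      =ᵐ[volume] fun x => ((x - a : ℝ) : ℂ) * (c • transl t ψ : L2R) x := by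
  filter_upwards [Lp.coeFn_smul c (transl t Y + (t : ℂ) • transl t ψ),
    Lp.coeFn_add (transl t Y) ((t : ℂ) • transl t ψ), Lp.coeFn_smul (t : ℂ) (transl t ψ),
    Lp.coeFn_smul c (transl t ψ), transl_coeFn t Y, transl_coeFn t ψ,
    ae_sub_right t hY] with x h1 h2 h3 h4 h5 h6 h7
  simp only [h1, h2, h3, h4, h5, h6, h7, Pi.smul_apply, Pi.add_apply, smul_eq_mul]
  push_cast
  ring

/-- With `ψ_t = e^(ibt) T_t ψ`, the mean of `x - a` grows by `t`, so `t = ⟨ψ_t - ψ, (x - a)ψ_t⟩ +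
⟨(x - a)ψ, ψ_t - ψ⟩`. By Cauchy-Schwarz and `‖ψ_t - ψ‖ ≤ t‖Z‖` this is at most `t(2‖Y‖ + t)‖Z‖`;
divide by `t` and let `t → 0`. -/
lemma one_le_two_mul_norm_mul_norm {ψ Y Z : L2R} {a b : ℝ} (hψ : ‖ψ‖ = 1)
    (hY : Y =ᵐ[volume] fun x => ((x - a : ℝ) : ℂ) * ψ x)
    (hZ : Z =ᵐ[volume] fun p => ((p - b : ℝ) : ℂ) * fourierPlancherel ψ p) :
    1 ≤ 2 * (‖Y‖ * ‖Z‖) := by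
  have key : ∀ t : ℝ, 0 < t → 1 ≤ (2 * ‖Y‖ + t) * ‖Z‖ := by
    intro t ht
    set c := expFun b t with hc
    have hcn : ‖c‖ = 1 := norm_expFun b t
    set ψt : L2R := c • transl t ψ with hψt
    set Yt : L2R := c • (transl t Y + (t : ℂ) • transl t ψ) with hYt
    have hYt' := mul_transl_ae hY t c
    have h1 : ⟪ψt, Yt⟫_ℂ = ⟪ψ, Y⟫_ℂ + t := by
      rw [hψt, hYt, inner_smul_left, inner_smul_right, ← mul_assoc, mul_comm _ c,
        Complex.mul_conj, Complex.normSq_eq_norm_sq, hcn, inner_add_right, inner_smul_right,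
        inner_transl_transl, inner_transl_transl, inner_self_eq_norm_sq_to_K, hψ]
      simp
    have h2 : ⟪ψ, Yt⟫_ℂ = ⟪Y, ψt⟫_ℂ := inner_mul_real_comm hY hYt'
    have h3 : ⟪ψ, Y⟫_ℂ = ⟪Y, ψ⟫_ℂ := inner_mul_real_comm hY hY
    have h4 : (t : ℂ) = ⟪ψt - ψ, Yt⟫_ℂ + ⟪Y, ψt - ψ⟫_ℂ := by
      rw [inner_sub_left, inner_sub_right, h1, h2, h3]
      ring
    have h5 : t ≤ ‖ψt - ψ‖ * ‖Yt‖ + ‖Y‖ * ‖ψt - ψ‖ := by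
      have := (norm_add_le _ _).trans (add_le_add (norm_inner_le_norm (𝕜 := ℂ) (ψt - ψ) Yt)
        (norm_inner_le_norm (𝕜 := ℂ) Y (ψt - ψ)))
      rwa [← h4, Complex.norm_real, Real.norm_of_nonneg ht.le] at this
    have h6 : ‖Yt‖ ≤ ‖Y‖ + t := by
      rw [hYt, norm_smul, hcn, one_mul]
      refine (norm_add_le _ _).trans ?_
      rw [norm_smul, norm_transl, norm_transl, hψ, mul_one, Complex.norm_real,
        Real.norm_of_nonneg ht.le]
    have h7 : ‖ψt - ψ‖ ≤ t * ‖Z‖ := by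
      have := norm_smul_transl_sub_le hZ t
      rwa [abs_of_pos ht] at this
    have h8 : t * 1 ≤ t * ((2 * ‖Y‖ + t) * ‖Z‖) := by
      calc t * 1 ≤ ‖ψt - ψ‖ * ‖Yt‖ + ‖Y‖ * ‖ψt - ψ‖ := by rwa [mul_one]
        _ ≤ (t * ‖Z‖) * (‖Y‖ + t) + ‖Y‖ * (t * ‖Z‖) := by gcongr
        _ = t * ((2 * ‖Y‖ + t) * ‖Z‖) := by ring
    exact le_of_mul_le_mul_left h8 ht
  have hlim : Filter.Tendsto (fun t : ℝ => (2 * ‖Y‖ + t) * ‖Z‖) (nhdsWithin 0 (Set.Ioi 0))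
      (nhds ((2 * ‖Y‖ + 0) * ‖Z‖)) :=
    (Continuous.tendsto (by fun_prop) 0).mono_left nhdsWithin_le_nhds
  have h := ge_of_tendsto hlim (eventually_nhdsWithin_of_forall key)
  linarith

/-- The second moment of `|ψ|²` about `a`. -/
noncomputable def secondMoment (a : ℝ) (ψ : L2R) : ℝ≥0∞ := ∫⁻ x, ‖x - a‖ₑ ^ 2 * ‖ψ x‖ₑ ^ 2

lemma secondMoment_eq (a : ℝ) (ψ : L2R) :
    secondMoment a ψ = eLpNorm (fun x => ((x - a : ℝ) : ℂ) * ψ x) 2 volume ^ 2 := by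
  have h := eLpNorm_nnreal_pow_eq_lintegral (f := fun x => ((x - a : ℝ) : ℂ) * ψ x)
    (μ := volume) (p := 2) (by norm_num)
  have h' : eLpNorm (fun x => ((x - a : ℝ) : ℂ) * ψ x) 2 volume ^ 2
      = ∫⁻ x, ‖((x - a : ℝ) : ℂ) * ψ x‖ₑ ^ 2 := by simpa using h
  rw [h', secondMoment]
  refine lintegral_congr fun x => ?_
  rw [enorm_mul, mul_pow, ← ofReal_norm ((x - a : ℝ) : ℂ), Complex.norm_real, ofReal_norm]

lemma aestronglyMeasurable_sub_mul (a : ℝ) (ψ : L2R) :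
    AEStronglyMeasurable (fun x => ((x - a : ℝ) : ℂ) * ψ x) volume :=
  (Complex.measurable_ofReal.comp (measurable_id.sub_const a)).aestronglyMeasurable.mul
    (Lp.stronglyMeasurable ψ).aestronglyMeasurable

/-- Rules out the product `0 · ∞`, which is `0` in `ℝ≥0∞`, when one of the two moments is infinite.
-/
lemma secondMoment_ne_zero (a : ℝ) {ψ : L2R} (hψ : ψ ≠ 0) : secondMoment a ψ ≠ 0 := by
  intro h
  rw [secondMoment_eq, pow_eq_zero_iff two_ne_zero,
    eLpNorm_eq_zero_iff (aestronglyMeasurable_sub_mul a ψ) two_ne_zero] at h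
  refine hψ (Lp.ext ?_)
  filter_upwards [h, Lp.coeFn_zero ℂ 2 volume, Measure.ae_ne volume a] with x h1 h2 h3
  rw [h2]
  have h4 : ((x - a : ℝ) : ℂ) ≠ 0 := by exact_mod_cast sub_ne_zero.mpr h3
  exact (mul_eq_zero.mp h1).resolve_left h4

lemma exists_mul_ae {a : ℝ} {ψ : L2R} (h : secondMoment a ψ ≠ ∞) :
    ∃ Y : L2R, (Y =ᵐ[volume] fun x => ((x - a : ℝ) : ℂ) * ψ x) ∧ secondMoment a ψ = ‖Y‖ₑ ^ 2 := by
  have hm : MemLp (fun x => ((x - a : ℝ) : ℂ) * ψ x) 2 volume := by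
    refine ⟨aestronglyMeasurable_sub_mul a ψ, lt_top_iff_ne_top.mpr fun ht => h ?_⟩
    rw [secondMoment_eq, ht]
    rfl
  refine ⟨hm.toLp _, hm.coeFn_toLp, ?_⟩
  rw [secondMoment_eq, Lp.enorm_toLp]

/-- Heisenberg's uncertainty relation for a unit vector. -/
lemma quarter_le_secondMoment_mul (a b : ℝ) {ψ : L2R} (hψ : ‖ψ‖ = 1) :
    1 / 4 ≤ secondMoment a ψ * secondMoment b (fourierPlancherel ψ) := by
  have h0 : ψ ≠ 0 := norm_ne_zero_iff.mp (by rw [hψ]; exact one_ne_zero)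
  have h0' : fourierPlancherel ψ ≠ 0 :=
    norm_ne_zero_iff.mp (by rw [LinearIsometryEquiv.norm_map, hψ]; exact one_ne_zero)
  by_cases hA : secondMoment a ψ = ∞
  · rw [hA, ENNReal.top_mul (secondMoment_ne_zero b h0')]
    exact le_top
  by_cases hB : secondMoment b (fourierPlancherel ψ) = ∞
  · rw [hB, ENNReal.mul_top (secondMoment_ne_zero a h0)]
    exact le_top
  obtain ⟨Y, hY, hYn⟩ := exists_mul_ae hA
  obtain ⟨Z, hZ, hZn⟩ := exists_mul_ae hB
  have h := one_le_two_mul_norm_mul_norm hψ hY hZ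
  rw [hYn, hZn, enorm_sq_eq_ofReal, enorm_sq_eq_ofReal, ← ENNReal.ofReal_mul (by positivity)]
  have h14 : (1 / 4 : ℝ≥0∞) = ENNReal.ofReal (1 / 4) := by
    rw [ENNReal.ofReal_div_of_pos (by norm_num)]
    simp
  rw [h14]
  refine ENNReal.ofReal_le_ofReal ?_
  nlinarith [mul_nonneg (norm_nonneg Y) (norm_nonneg Z)]

/-- Cauchy-Schwarz for the weights `λ`: the right side is at least `(∑ λ_i √(A_i B_i))²`, and each
root is at least `1/2`. -/
lemma quarter_le_tsum_mul_tsum {lam : ℕ → ℝ} (h0 : ∀ i, 0 ≤ lam i) (h1 : HasSum lam 1)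
    {A B : ℕ → ℝ≥0∞} (h : ∀ i, 1 / 4 ≤ A i * B i) :
    1 / 4 ≤ (∑' i, ENNReal.ofReal (lam i) * A i) * ∑' i, ENNReal.ofReal (lam i) * B i := by
  have hH := ENNReal.lintegral_mul_le_Lp_mul_Lq (weightMeasure lam)
    (Real.HolderConjugate.two_two) (f := fun i => A i ^ (1 / 2 : ℝ))
    (g := fun i => B i ^ (1 / 2 : ℝ)) (measurable_of_countable _).aemeasurable
    (measurable_of_countable _).aemeasurable
  have hp : ∀ x : ℝ≥0∞, (x ^ (1 / 2 : ℝ)) ^ (2 : ℝ) = x := fun x => by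
    rw [← ENNReal.rpow_mul]
    norm_num
  simp only [hp, lintegral_weightMeasure, Pi.mul_apply] at hH
  rw [← ENNReal.mul_rpow_of_nonneg _ _ (by norm_num)] at hH
  have hl : (1 / 4 : ℝ≥0∞) ^ (1 / 2 : ℝ)
      ≤ ∑' i, ENNReal.ofReal (lam i) * (A i ^ (1 / 2 : ℝ) * B i ^ (1 / 2 : ℝ)) := by
    calc (1 / 4 : ℝ≥0∞) ^ (1 / 2 : ℝ)
        = ∑' i, ENNReal.ofReal (lam i) * (1 / 4 : ℝ≥0∞) ^ (1 / 2 : ℝ) := by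
          rw [ENNReal.tsum_mul_right, ← ENNReal.ofReal_tsum_of_nonneg h0 h1.summable, h1.tsum_eq,
            ENNReal.ofReal_one, one_mul]
      _ ≤ _ := by
          refine ENNReal.tsum_le_tsum fun i => ?_
          rw [← ENNReal.mul_rpow_of_nonneg _ _ (by norm_num)]
          gcongr
          exact h i
  have := ENNReal.rpow_le_rpow (hl.trans hH) (zero_le_two (α := ℝ))
  rwa [hp, hp] at this

end Heisenberg

/-! ### Variances of outcome distributions -/

section Variances

/-- Variances of independent variables add. If the sum has no finite second moment the bound is
trivial. -/
lemma evariance_add_evariance_le (μ ρ : Measure ℝ) [IsProbabilityMeasure μ]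
    [IsProbabilityMeasure ρ] :
    evariance id μ + evariance id ρ
      ≤ evariance id ((μ.prod ρ).map fun z : ℝ × ℝ => z.1 + z.2) := by
  have hm : Measurable fun z : ℝ × ℝ => z.1 + z.2 := measurable_fst.add measurable_snd
  have hp : IsProbabilityMeasure ((μ.prod ρ).map fun z : ℝ × ℝ => z.1 + z.2) :=
    Measure.isProbabilityMeasure_map hm.aemeasurable
  by_cases hfin : MemLp id 2 ((μ.prod ρ).map fun z : ℝ × ℝ => z.1 + z.2)
  swap
  · rw [evariance_eq_top measurable_id.aestronglyMeasurable hfin]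
    exact le_top
  have hsum : MemLp (fun z : ℝ × ℝ => z.1 + z.2) 2 (μ.prod ρ) :=
    (memLp_map_measure_iff measurable_id.aestronglyMeasurable hm.aemeasurable).mp hfin
  have hint := (memLp_two_iff_integrable_sq hsum.1).mp hsum
  have hμ : MemLp id 2 μ := by
    -- By Fubini some translate of the identity is square integrable, hence so is the identity.
    obtain ⟨r, hr⟩ := hint.prod_left_ae.exists
    have hr' : MemLp (fun x : ℝ => x + r) 2 μ :=
      (memLp_two_iff_integrable_sq (measurable_id.add_const r).aestronglyMeasurable).mpr hr
    have := hr'.sub (memLp_const r)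
    convert this using 1
    ext x
    simp
  have hρ : MemLp id 2 ρ := by
    obtain ⟨x, hx⟩ := hint.prod_right_ae.exists
    have hx' : MemLp (fun r : ℝ => x + r) 2 ρ :=
      (memLp_two_iff_integrable_sq (measurable_id.const_add x).aestronglyMeasurable).mpr hx
    have := hx'.sub (memLp_const x)
    convert this using 1
    ext r
    simp
  have h1 : MemLp (fun z : ℝ × ℝ => z.1) 2 (μ.prod ρ) := hμ.comp_fst ρ
  have h2 : MemLp (fun z : ℝ × ℝ => z.2) 2 (μ.prod ρ) := hρ.comp_snd μ
  have hv := IndepFun.variance_fun_add h1 h2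
    (indepFun_prod (μ := μ) (ν := ρ) measurable_id measurable_id)
  have hvar : ∀ {Ω : Type} [MeasurableSpace Ω] {P : Measure Ω} [IsProbabilityMeasure P] {f : Ω → ℝ}
      (_ : Measurable f), Var[id; P.map f] = Var[f; P] := fun hf => by
    rw [variance_map aemeasurable_id hf.aemeasurable]
    rfl
  have e1 : Var[fun z : ℝ × ℝ => z.1; μ.prod ρ] = Var[id; μ] := by
    rw [← hvar measurable_fst, Measure.map_fst_prod, measure_univ, one_smul]
  have e2 : Var[fun z : ℝ × ℝ => z.2; μ.prod ρ] = Var[id; ρ] := by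
    rw [← hvar measurable_snd, Measure.map_snd_prod, measure_univ, one_smul]
  rw [← hμ.ofReal_variance_eq, ← hρ.ofReal_variance_eq, ← hfin.ofReal_variance_eq, hvar hm, hv,
    e1, e2, ENNReal.ofReal_add (variance_nonneg _ _) (variance_nonneg _ _)]

/-- `AB + ab` contributes `1/2`. The cross terms have product at least `1/16`, so by the
arithmetic-geometric mean inequality they contribute another `1/2`. -/
lemma one_le_add_mul_add {A B a b : ℝ≥0∞} (h : 1 / 4 ≤ A * B) (h' : 1 / 4 ≤ a * b) :
    1 ≤ (A + a) * (B + b) := by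
  have h4 : (0 : ℝ≥0∞) < 1 / 4 := by simp
  have hB : B ≠ 0 := fun hB => by simp [hB] at h
  have hA : A ≠ 0 := fun hA => by simp [hA] at h
  by_cases hAt : A + a = ∞
  · rw [hAt, ENNReal.top_mul (by simp [hB])]
    exact le_top
  by_cases hBt : B + b = ∞
  · rw [hBt, ENNReal.mul_top (by simp [hA])]
    exact le_top
  rw [ENNReal.add_eq_top, not_or] at hAt hBt
  lift A to NNReal using hAt.1
  lift a to NNReal using hAt.2
  lift B to NNReal using hBt.1
  lift b to NNReal using hBt.2
  have e : (1 / 4 : ℝ≥0∞) = ((1 / 4 : NNReal) : ℝ≥0∞) := by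
    rw [ENNReal.coe_div (by norm_num)]
    simp
  rw [e] at h h'
  norm_cast at h h' ⊢
  have g : (1 / 4 : ℝ) ≤ A * B := by exact_mod_cast h
  have g' : (1 / 4 : ℝ) ≤ a * b := by exact_mod_cast h'
  have : (1 : ℝ) ≤ (A + a) * (B + b) := by
    have hn : (1 / 4 : ℝ) * (1 / 4) ≤ (A * B) * (a * b) :=
      mul_le_mul g g' (by norm_num) (by positivity)
    have hp : (0 : ℝ) ≤ A * b + a * B := by positivity
    have hs : (1 / 2 : ℝ) ^ 2 ≤ (A * b + a * B) ^ 2 := by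
      nlinarith [sq_nonneg ((A : ℝ) * b - a * B)]
    have := le_of_sq_le_sq hs hp
    linarith
  exact_mod_cast this

variable {lam : ℕ → ℝ} {φ : ℕ → L2R}

/-- One centre, determined by the mean of the mixture, serves all `φ i`; Heisenberg's relation is
therefore needed about arbitrary centres. The reflection flips its sign. -/
lemma evariance_reflectedDensity (lam : ℕ → ℝ) (φ : ℕ → L2R) :
    ∃ a, evariance id (reflectedDensity lam φ)
      = ∑' i, ENNReal.ofReal (lam i) * secondMoment a (φ i) := by
  refine ⟨-∫ x, id x ∂(reflectedDensity lam φ), ?_⟩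
  rw [evariance, lintegral_reflectedDensity lam φ (by fun_prop)]
  refine tsum_congr fun i => ?_
  rw [secondMoment]
  congr 1
  refine lintegral_congr fun x => ?_
  rw [← enorm_neg]
  congr 3
  simp only [id]
  ring

lemma quarter_le_evariance_mul (h0 : ∀ i, 0 ≤ lam i) (h1 : HasSum lam 1)
    (hφ : ∀ i, ‖φ i‖ = 1) :
    1 / 4 ≤ evariance id (reflectedDensity lam φ)
      * evariance id (reflectedDensity lam fun i => fourierPlancherel (φ i)) := by
  obtain ⟨a, ha⟩ := evariance_reflectedDensity lam φ
  obtain ⟨b, hb⟩ := evariance_reflectedDensity lam fun i => fourierPlancherel (φ i)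
  rw [ha, hb]
  exact quarter_le_tsum_mul_tsum h0 h1 fun i => quarter_le_secondMoment_mul a b (hφ i)

lemma evariance_map_neg (μ : Measure ℝ) :
    evariance id (μ.map fun x => -x) = evariance id μ := by
  have hm : Measurable fun x : ℝ => -x := measurable_neg
  rw [evariance, evariance, lintegral_map (by fun_prop) hm,
    integral_map hm.aemeasurable measurable_id.aestronglyMeasurable]
  refine lintegral_congr fun x => ?_
  simp only [id]
  rw [integral_neg, ← enorm_neg]
  congr 2
  ring

/-- The law of the sum of `-x` and `r`, where `x` and `r` are independent with laws
`reflectedDensity lam φ` and `ρ`. -/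
noncomputable def smearedLaw (lam : ℕ → ℝ) (φ : ℕ → L2R) (ρ : Measure ℝ) : Measure ℝ :=
  (((reflectedDensity lam φ).map fun x => -x).prod ρ).map fun z : ℝ × ℝ => z.1 + z.2

lemma isProbabilityMeasure_smearedLaw (h0 : ∀ i, 0 ≤ lam i) (h1 : HasSum lam 1)
    (hφ : ∀ i, ‖φ i‖ = 1) (ρ : Measure ℝ) [IsProbabilityMeasure ρ] :
    IsProbabilityMeasure (smearedLaw lam φ ρ) := by
  have := isProbabilityMeasure_reflectedDensity h0 h1 hφ
  have : IsProbabilityMeasure ((reflectedDensity lam φ).map fun x => -x) :=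
    Measure.isProbabilityMeasure_map measurable_neg.aemeasurable
  exact Measure.isProbabilityMeasure_map (measurable_fst.add measurable_snd).aemeasurable

/-- The convolution evaluates to the spectral form of `tr (S E_ρ(X))`, which identifies it as the
outcome distribution. -/
lemma smearedLaw_apply (lam : ℕ → ℝ) (φ : ℕ → L2R) (ρ : Measure ℝ) [IsProbabilityMeasure ρ]
    {X : Set ℝ} (hX : MeasurableSet X) :
    smearedLaw lam φ ρ X
      = ∑' i, ENNReal.ofReal (lam i) * (positionObservable ρ).quad (φ i) X := by
  have hm : Measurable fun z : ℝ × ℝ => z.1 + z.2 := measurable_fst.add measurable_snd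
  have hρ := measurable_measure_add_preimage ρ hX
  rw [smearedLaw, Measure.map_apply hm hX, Measure.prod_apply (hm hX)]
  have h : ∀ x : ℝ, Prod.mk x ⁻¹' ((fun z : ℝ × ℝ => z.1 + z.2) ⁻¹' X)
      = (fun r => r + x) ⁻¹' X := fun x => by
    ext r
    simp [add_comm]
  simp_rw [h]
  have hρ' : Measurable fun x : ℝ => ρ ((fun r => r + -x) ⁻¹' X) := hρ.comp measurable_neg
  rw [lintegral_map hρ measurable_neg, lintegral_reflectedDensity lam φ hρ']
  refine tsum_congr fun i => ?_
  rw [quad_positionObservable ρ (φ i) hX]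
  simp only [neg_neg]

lemma le_evariance_smearedLaw (h0 : ∀ i, 0 ≤ lam i) (h1 : HasSum lam 1)
    (hφ : ∀ i, ‖φ i‖ = 1) (ρ : Measure ℝ) [IsProbabilityMeasure ρ] :
    evariance id (reflectedDensity lam φ) + evariance id ρ
      ≤ evariance id (smearedLaw lam φ ρ) := by
  have := isProbabilityMeasure_reflectedDensity h0 h1 hφ
  have : IsProbabilityMeasure ((reflectedDensity lam φ).map fun x => -x) :=
    Measure.isProbabilityMeasure_map measurable_neg.aemeasurable
  rw [← evariance_map_neg (reflectedDensity lam φ)]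
  exact evariance_add_evariance_le _ ρ

lemma IsSpectralDecomposition.isOutcomeDistribution {S : L2R →L[ℂ] L2R}
    (h : IsSpectralDecomposition S lam φ) {Ω : Type*} [MeasurableSpace Ω] (E : Observable Ω L2R)
    {p : Measure Ω} (hp : IsProbabilityMeasure p)
    (hpE : ∀ X, MeasurableSet X → p X = ∑' i, ENNReal.ofReal (lam i) * E.quad (φ i) X) :
    IsOutcomeDistribution E S p := by
  refine ⟨hp, fun X hX => ?_⟩
  have ht := h.hasTrace_comp (E X)
  have hr : p.real X = ∑' i, lam i * (⟪φ i, E X (φ i)⟫_ℂ).re := by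
    have hn : ∀ i, 0 ≤ (⟪φ i, E X (φ i)⟫_ℂ).re := fun i =>
      (E.positive X hX).re_inner_nonneg_right (φ i)
    have hX' := hpE X hX
    have hfin := hX' ▸ measure_ne_top p X
    rw [Measure.real, hX', ENNReal.tsum_toReal_eq fun i => ENNReal.ne_top_of_tsum_ne_top hfin i]
    refine tsum_congr fun i => ?_
    rw [E.quad_apply _ hX, ENNReal.toReal_mul, ENNReal.toReal_ofReal (h.nonneg i),
      ENNReal.toReal_ofReal (hn i)]
  rw [hr, Complex.ofReal_tsum]
  convert ht using 3 with i
  rw [(E.positive X hX).inner_eq_re (φ i), Complex.ofReal_mul]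
  simp

theorem ArisesFromState.uncertaintyRelation {ρ ν : Measure ℝ} [IsProbabilityMeasure ρ]
    [IsProbabilityMeasure ν] (h : ArisesFromState ρ ν) :
    UncertaintyRelation (positionObservable ρ) (momentumObservable ν) := by
  obtain ⟨T, -, lam', φ', hT, hρ, hν⟩ := h
  intro S hS
  obtain ⟨lam, φ, hφ⟩ := hS.exists_isSpectralDecomposition
  have h0 := hφ.nonneg
  have h1 := hφ.sum_one
  have hn := hφ.orthonormal.1
  have hn' : ∀ i, ‖fourierPlancherel (φ i)‖ = 1 := fun i => by
    rw [LinearIsometryEquiv.norm_map, hn]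
  refine ⟨smearedLaw lam φ ρ, smearedLaw lam (fun i => fourierPlancherel (φ i)) ν,
    hφ.isOutcomeDistribution _ (isProbabilityMeasure_smearedLaw h0 h1 hn ρ)
      fun X hX => smearedLaw_apply lam φ ρ hX,
    hφ.isOutcomeDistribution _ (isProbabilityMeasure_smearedLaw h0 h1 hn' ν) fun Y hY => ?_, ?_⟩
  · rw [smearedLaw_apply lam _ ν hY]
    refine tsum_congr fun i => ?_
    rw [quad_momentumObservable ν (φ i) hY, quad_positionObservable ν _ hY]
  · refine (one_le_add_mul_add (quarter_le_evariance_mul h0 h1 hn) ?_).trans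
      (mul_le_mul' (le_evariance_smearedLaw h0 h1 hn ρ) (le_evariance_smearedLaw h0 h1 hn' ν))
    have := quarter_le_evariance_mul hT.nonneg hT.sum_one hT.orthonormal.1
    rwa [← hρ, ← hν] at this

end Variances

/-! ### The equivalences and the uncertainty relation -/

theorem mainTheorem2 (ρ ν : Measure ℝ) [IsProbabilityMeasure ρ] [IsProbabilityMeasure ν] :
    (FunctionallyCoexistent.{u} (positionObservable ρ) (momentumObservable ν) ↔
      ArisesFromState ρ ν) ∧
    (HaveJointObservable (positionObservable ρ) (momentumObservable ν) ↔ ArisesFromState ρ ν) ∧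
    (FunctionallyCoexistent.{u} (positionObservable ρ) (momentumObservable ν) →
      UncertaintyRelation (positionObservable ρ) (momentumObservable ν)) ∧
    (HaveJointObservable (positionObservable ρ) (momentumObservable ν) →
      UncertaintyRelation (positionObservable ρ) (momentumObservable ν)) := by
  have h1 : FunctionallyCoexistent.{u} (positionObservable ρ) (momentumObservable ν) →
      ArisesFromState ρ ν := fun h => h.haveJointObservable.arisesFromState
  have h2 : HaveJointObservable (positionObservable ρ) (momentumObservable ν) →
      ArisesFromState ρ ν := HaveJointObservable.arisesFromState
  exact ⟨⟨h1, fun h => h.haveJointObservable.functionallyCoexistent⟩,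
    ⟨h2, ArisesFromState.haveJointObservable⟩, fun h => (h1 h).uncertaintyRelation,
    fun h => (h2 h).uncertaintyRelation⟩
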